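/- All multigraphs are finite and loopless. A 2-fold cover of a multigraph $G$ is a pair $(L,H)$, where $H$ is a loopless multigraph and $L$ assigns to every $v\in V(G)$ a set $L(v)=\{p(v),r(v)\}$ of two distinct vertices of $H$, called poor and rich, respectively, such that the sets $L(v)$ partition $V(H)$, the vertices $p(v)$ and $r(v)$ are joined by exactly one edge of $H$, and the remaining edges of $H$ are obtained by taking, for every edge $e=uv$ of $G$, a perfect matching $M(e)$ between $L(u)$ and $L(v)$ (parallel edges of $G$ contribute separate matchings, so parallel edges of $H$ are counted with multiplicity). For a map $\phi:V(G)\to V(H)$ with $\phi(v)\in L(v)$ for all $v$, let $H_\phi$ be the subgraph of $H$ induced by $\phi(V(G))$. For $0\le i\le j$, $\phi$ is an $(i,j)$-coloring of the cover if every poor vertex of $H_\phi$ has degree at most $i$ in $H_\phi$ and every rich vertex of $H_\phi$ has degree at most $j$ in $H_\phi$. The multigraph $G$ is $(i,j)$-colorable if each of its 2-fold covers has an $(i,j)$-coloring, and $(i,j)$-critical if it is not $(i,j)$-colorable but every proper subgraph of it is. Let $f_{DP}(i,j,n)$ be the minimum number of edges of an $n$-vertex $(i,j)$-critical multigraph ($+\infty$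 if there is none). Theorem. 1. If $j\ge 1$, then $f_{DP}(0,j,n)\ge n+j$ for every $n$, with equality for every $n\ge 2j+2$. 2. If $i\ge 1$ and $j\ge 2i+1$, then $f_{DP}(i,j,n)\ge \frac{(2i+1)n-(2i-j)}{i+1}$ for every $n$, and for each such pair $(i,j)$ equality holds for infinitely many $n$. 3. If $i\ge 1$ and $i+2\le j\le 2i$, then $f_{DP}(i,j,n)\ge \frac{2jn+2}{j+1}$ for every $n$, and for each such pair $(i,j)$ equality holds for infinitely many $n$. 4. If $i\ge 1$, then $f_{DP}(i,i+1,n)\ge \frac{(2i^2+4i+1)n+1}{i^2+3i+1}$ for every $n$, and for each $i\ge 1$ equality holds for infinitely many $n$. 5. If $i\ge 1$, then $f_{DP}(i,i,n)\ge \frac{(2i+2)n}{i+2}$ for every $n$, and for each $i\ge 1$ equality holds for infinitely many $n$. -/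

import Mathlib

open scoped ENNReal

namespace DefectiveDP

/-- A 2-fold cover `(L, H)` of a loopless multigraph `G`, together with its poor and rich vertices.
Every list `L(v)` consists of one poor vertex `p(v)` and one rich vertex `r(v)`; the lists partition
the vertex set of the cover graph `H`, and each of them is complete in `H`.
All the other edges of `H` come from the edges of `G`: an edge `e` of `G` with ends `u` and `v`
contributes a perfect matching `M(e)` between `L(u)` and `L(v)`.  Parallel edges of `G` contribute
separate matchings, so `H` is a multigraph as well. -/
structure TwoFoldCover {α β : Type} (G : Graph α β) (W F : Type) where
  /-- the cover graph `H` -/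
  graph : Graph W F
  /-- the poor vertex `p(v)` of `L(v)` -/
  poor : α → W
  /-- the rich vertex `r(v)` of `L(v)` -/
  rich : α → W
  /-- the list `L(v)` -/
  L : α → Set W
  /-- the set `M(e)` of edges of `H` -/
  M : β → Set F
  loopless : graph.Loopless
  L_eq : ∀ v ∈ G.vertexSet, L v = {poor v, rich v}
  poor_ne_rich : ∀ v ∈ G.vertexSet, poor v ≠ rich v
  L_subset : ∀ v ∈ G.vertexSet, L v ⊆ graph.vertexSet
  exists_mem_L : ∀ x ∈ graph.vertexSet, ∃ v ∈ G.vertexSet, x ∈ L v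
  L_disjoint : ∀ u ∈ G.vertexSet, ∀ v ∈ G.vertexSet, u ≠ v → Disjoint (L u) (L v)
  L_complete : ∀ v ∈ G.vertexSet, ∃! f, graph.IsLink f (poor v) (rich v)
  M_link : ∀ e u v, G.IsLink e u v → ∀ f ∈ M e, ∃ x ∈ L u, ∃ y ∈ L v, graph.IsLink f x y
  M_perfect : ∀ e u v, G.IsLink e u v → ∀ x ∈ L u, ∃! f, f ∈ M e ∧ graph.Inc f x
  mem_M : ∀ f x y u v, graph.IsLink f x y → u ∈ G.vertexSet → v ∈ G.vertexSet →
    x ∈ L u → y ∈ L v → u ≠ v → ∃! e, e ∈ G.edgeSet ∧ f ∈ M e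

namespace TwoFoldCover

variable {α β W F : Type} {G : Graph α β}

/-- An `H`-map: an injection of `V(G)` into `V(H)` that picks a vertex of `L(v)` for each `v`.
(The values outside `V(G)` are irrelevant.) -/
def IsMap (H : TwoFoldCover G W F) (φ : α → W) : Prop :=
  Set.InjOn φ G.vertexSet ∧ ∀ v ∈ G.vertexSet, φ v ∈ H.L v

/-- The subgraph `H_φ` of the cover graph induced by `φ(V(G))`. -/
def inducedGraph (H : TwoFoldCover G W F) (φ : α → W) : Graph W F :=
  H.graph.induce (φ '' G.vertexSet)

/-- The degree of `x` in `H_φ`; parallel edges are counted separately. -/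
noncomputable def inducedDegree (H : TwoFoldCover G W F) (φ : α → W) (x : W) : ℕ∞ :=
  ((H.inducedGraph φ).incidenceSet x).encard

/-- `φ` is an `(i, j)`-defective DP-coloring of the cover: the poor vertices of `H_φ` have degree
at most `i` and the rich ones have degree at most `j`. -/
def IsColoring (H : TwoFoldCover G W F) (i j : ℕ) (φ : α → W) : Prop :=
  H.IsMap φ ∧ ∀ v ∈ G.vertexSet,
    (φ v = H.poor v → H.inducedDegree φ (φ v) ≤ i) ∧
    (φ v = H.rich v → H.inducedDegree φ (φ v) ≤ j)

end TwoFoldCover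

/-- `G` is `(i, j)`-defective-DP-colorable: every 2-fold cover of `G` has an `(i, j)`-coloring. -/
def Colorable {α β : Type} (i j : ℕ) (G : Graph α β) : Prop :=
  ∀ (W F : Type) (H : TwoFoldCover G W F), ∃ φ : α → W, H.IsColoring i j φ

/-- A finite loopless multigraph is `(i, j)`-critical if it is not `(i, j)`-colorable, but every
proper subgraph of it is. -/
structure IsCritical {α β : Type} (i j : ℕ) (G : Graph α β) : Prop where
  finite_vertexSet : G.vertexSet.Finite
  finite_edgeSet : G.edgeSet.Finite
  loopless : G.Loopless
  not_colorable : ¬ Colorable i j G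
  colorable_of_lt : ∀ G' : Graph α β, G' < G → Colorable i j G'

/-- `f_DP(i, j, n)`: the minimum number of edges in an `n`-vertex `(i, j)`-critical multigraph
(`⊤` if there is no such multigraph).  Every finite multigraph is isomorphic to one whose vertices
and edges are labelled by natural numbers. -/
noncomputable def fDP (i j n : ℕ) : ℕ∞ :=
  sInf {m : ℕ∞ | ∃ G : Graph ℕ ℕ,
    IsCritical i j G ∧ G.vertexSet.encard = n ∧ G.edgeSet.encard = m}

/-- `f_DP(i, j, n)` as an extended real number, for comparison with fractions. -/
noncomputable def fDPReal (i j n : ℕ) : EReal := ((fDP i j n : ℝ≥0∞) : EReal)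

end DefectiveDP

namespace DefectiveDP

/-! A matching between two lists of size two is straight or crossed, so a 2-fold cover amounts to a
sign on every edge, and a map `φ` is a colouring of the vertices by poor and rich. An edge
contributes to `H_φ` exactly when its sign is violated. Each vertex carries slots of both colours,
one more than the number of violated edges it tolerates. Letting the slots vary from vertex to
vertex makes induction possible.

For `i ≥ 1` the lower bounds come from potentials. A vertex gets a weight that depends on its slots,
with value `F` for full slots; an edge costs `B`; the potential of a set is its weight minus the
cost of its inner edges. The core is that a signed graph whose nonempty sets all have potential at
least `τ` is colourable (`col_of_sparse_maxWeight`, `col_of_sparse_balanced`, `col_of_sparse_near`).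
The induction uses three reductions: contract a coloured set of low potential to a vertex with one
slot per permitted colour, split an edge (delete it and take a slot of each colour at both ends),
or, for `j = i + 1`, delete a coloured set and forbid the colours that would violate edges to it. If
no set has low potential, integrality leaves enough surplus to pay for splitting. Irreducible graphs
are coloured directly or excluded by discharging. In a critical multigraph some signing is not
colourable but all its proper induced parts are. If `V` had potential at least `τ`, reducing a set
of least potential would colour the graph; hence `F n - B m ≤ τ - 1`.

For `i = 0` one minimizes the number of violated edges among colourings whose violated edges join
rich vertices. A count of the other edges bounds the degree of every rich vertex
(`col_of_connected`).

For sharpness, note that the potential at full slots ignores signs. An uncolourable signed graph in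
which `V` has potential `τ - 1` and every smaller nonempty set at least `τ` therefore has a critical
underlying multigraph (`isCritical_toGraph`). Such graphs are paths or cycles along which colours
are forced, with attached gadgets that use up slots: a leaf joined by two edges of opposite signs
takes one slot whatever the colour, and a path of length two ending in a forced vertex takes one
poor slot. -/

/-- The multigraph with given ends of the edges. -/
def graphOfEnds {α β : Type} (V : Set α) (E : Set β) (p q : β → α) (hp : ∀ e ∈ E, p e ∈ V)
    (hq : ∀ e ∈ E, q e ∈ V) : Graph α β where
  vertexSet := V
  edgeSet := E
  IsLink e x y := e ∈ E ∧ (p e = x ∧ q e = y ∨ p e = y ∧ q e = x)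
  isLink_symm e he := ⟨fun x y h => ⟨h.1, h.2.symm⟩⟩
  eq_or_eq_of_isLink_of_isLink := by grind
  edge_mem_iff_exists_isLink e := ⟨fun h => ⟨p e, q e, h, Or.inl ⟨rfl, rfl⟩⟩, fun ⟨_, _, h⟩ => h.1⟩
  left_mem_of_isLink := by grind

/-- A finite signed multigraph with a supply of slots at each vertex for each of the two colours.
An edge with sign `false` wants its ends to be coloured differently, an edge with sign `true` wants
them to have the same colour.  The colour `false` stands for poor and `true` for rich. -/
structure SignedGraph (α β : Type) where
  V : Finset α
  E : Finset β
  fst : β → α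
  snd : β → α
  sgn : β → Bool
  slots : α → Bool → ℕ
  fst_mem : ∀ e ∈ E, fst e ∈ V
  snd_mem : ∀ e ∈ E, snd e ∈ V
  fst_ne_snd : ∀ e ∈ E, fst e ≠ snd e

/-! ### Signed multigraphs, their colourings and the operations on them -/

namespace SignedGraph

set_option linter.unusedSectionVars false

variable {α β : Type} [DecidableEq α] [DecidableEq β] (C : SignedGraph α β)

/-- The edge `e` is violated by the colouring `φ`. -/
def Active (φ : α → Bool) (e : β) : Prop := (φ (C.fst e) ^^ φ (C.snd e)) = C.sgn e

instance (φ : α → Bool) : DecidablePred (C.Active φ) :=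
  fun e => inferInstanceAs (Decidable ((φ (C.fst e) ^^ φ (C.snd e)) = C.sgn e))

/-- The edge `e` is incident with the vertex `v`. -/
def Inc (v : α) (e : β) : Prop := C.fst e = v ∨ C.snd e = v

instance (v : α) : DecidablePred (C.Inc v) :=
  fun e => inferInstanceAs (Decidable (C.fst e = v ∨ C.snd e = v))

/-- The number of violated edges at `v`. -/
def deg (φ : α → Bool) (v : α) : ℕ := (C.E.filter fun e => C.Inc v e ∧ C.Active φ e).card

/-- At every vertex fewer edges are violated than there are slots for its colour. -/
def IsCol (φ : α → Bool) : Prop := ∀ v ∈ C.V, C.deg φ v < C.slots v (φ v)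

/-- The signed graph has an admissible colouring. -/
def Col : Prop := ∃ φ, C.IsCol φ

/-- The edges inside `S`. -/
def inside (S : Finset α) : Finset β := C.E.filter fun e => C.fst e ∈ S ∧ C.snd e ∈ S

/-- The edges between `X` and `U`. -/
def cross (X U : Finset α) : Finset β :=
  C.E.filter fun e => (C.fst e ∈ X ∧ C.snd e ∈ U) ∨ (C.fst e ∈ U ∧ C.snd e ∈ X)

/-- The signed subgraph induced by `S`. -/
@[simps] def restrict (S : Finset α) : SignedGraph α β where
  V := C.V ∩ S
  E := C.inside S
  fst := C.fst
  snd := C.snd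
  sgn := C.sgn
  slots := C.slots
  fst_mem e he := by
    simp only [inside, Finset.mem_filter] at he
    exact Finset.mem_inter.2 ⟨C.fst_mem e he.1, he.2.1⟩
  snd_mem e he := by
    simp only [inside, Finset.mem_filter] at he
    exact Finset.mem_inter.2 ⟨C.snd_mem e he.1, he.2.2⟩
  fst_ne_snd e he := C.fst_ne_snd e (Finset.mem_filter.1 he).1

/-- Change the numbers of slots. -/
@[simps] def withSlots (k : α → Bool → ℕ) : SignedGraph α β := { C with slots := k }

/-- Delete an edge. -/
@[simps] def eraseEdge (e : β) : SignedGraph α β where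
  V := C.V
  E := C.E.erase e
  fst := C.fst
  snd := C.snd
  sgn := C.sgn
  slots := C.slots
  fst_mem e he := C.fst_mem e (Finset.mem_of_mem_erase he)
  snd_mem e he := C.snd_mem e (Finset.mem_of_mem_erase he)
  fst_ne_snd e he := C.fst_ne_snd e (Finset.mem_of_mem_erase he)

/-- Contract `U` to the vertex `t`; the new vertex being rich stands for the colouring `φ` of `U`,
and it being poor for the complement of `φ`. -/
@[simps] def contract (U : Finset α) (t : α) (φ : α → Bool) (kt : Bool → ℕ)
    (ht : t ∈ U) : SignedGraph α β where
  V := insert t (C.V \ U)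
  E := C.E.filter fun e => ¬ (C.fst e ∈ U ∧ C.snd e ∈ U)
  fst e := if C.fst e ∈ U then t else C.fst e
  snd e := if C.snd e ∈ U then t else C.snd e
  sgn e := C.sgn e ^^ ((C.fst e ∈ U && !φ (C.fst e)) ^^ (C.snd e ∈ U && !φ (C.snd e)))
  slots v := if v = t then kt else C.slots v
  fst_mem e he := by
    have := C.fst_mem e (Finset.mem_filter.1 he).1
    split_ifs <;> simp_all
  snd_mem e he := by
    have := C.snd_mem e (Finset.mem_filter.1 he).1
    split_ifs <;> simp_all
  fst_ne_snd e he := by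
    obtain ⟨he, hU⟩ := Finset.mem_filter.1 he
    have := C.fst_ne_snd e he
    split_ifs with h1 h2 h2
    · exact absurd ⟨h1, h2⟩ hU
    · exact fun h => h2 (h ▸ ht)
    · exact fun h => h1 (h ▸ ht)
    · exact this

/-- The potential of a set of vertices. -/
def rho (f : (Bool → ℕ) → ℤ) (B : ℤ) (S : Finset α) : ℤ :=
  ∑ v ∈ S, f (C.slots v) - B * (C.inside S).card

/-- All nonempty sets of vertices have potential at least `τ`. -/
def Sparse (f : (Bool → ℕ) → ℤ) (B τ : ℤ) : Prop :=
  ∀ S ⊆ C.V, S.Nonempty → τ ≤ C.rho f B S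

/-! ### Potentials and the gluing of colourings -/

variable {C}

lemma mem_inside {S : Finset α} {e : β} :
    e ∈ C.inside S ↔ e ∈ C.E ∧ C.fst e ∈ S ∧ C.snd e ∈ S := by simp [inside]

lemma mem_cross {X U : Finset α} {e : β} :
    e ∈ C.cross X U ↔
      e ∈ C.E ∧ ((C.fst e ∈ X ∧ C.snd e ∈ U) ∨ (C.fst e ∈ U ∧ C.snd e ∈ X)) := by simp [cross]

lemma inside_V : C.inside C.V = C.E := by
  ext e
  simp only [mem_inside, and_iff_left_iff_imp]
  exact fun h => ⟨C.fst_mem e h, C.snd_mem e h⟩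

lemma inside_mono {S T : Finset α} (h : S ⊆ T) : C.inside S ⊆ C.inside T := by
  intro e
  simp only [mem_inside]
  exact fun ⟨h1, h2, h3⟩ => ⟨h1, h h2, h h3⟩

lemma card_inside_union {X U : Finset α} (h : Disjoint X U) :
    (C.inside (X ∪ U)).card = (C.inside X).card + (C.inside U).card + (C.cross X U).card := by
  have h1 : C.inside (X ∪ U) = C.inside X ∪ C.inside U ∪ C.cross X U := by
    ext e
    simp only [mem_inside, mem_cross, Finset.mem_union]
    tauto
  have hd : ∀ a ∈ X, a ∉ U := fun a ha => Finset.disjoint_left.1 h ha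
  rw [h1, Finset.card_union_of_disjoint, Finset.card_union_of_disjoint]
  · rw [Finset.disjoint_left]
    simp only [mem_inside]
    exact fun e h1 h2 => hd _ h1.2.1 h2.2.1
  · rw [Finset.disjoint_left]
    simp only [mem_inside, mem_cross, Finset.mem_union]
    have := hd
    grind

lemma rho_union (f : (Bool → ℕ) → ℤ) (B : ℤ) {X U : Finset α} (h : Disjoint X U) :
    C.rho f B (X ∪ U) = C.rho f B X + C.rho f B U - B * (C.cross X U).card := by
  simp only [rho, card_inside_union h, Finset.sum_union h]
  push_cast
  ring

lemma inside_singleton (v : α) : C.inside {v} = ∅ := by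
  ext e
  simp only [mem_inside, Finset.mem_singleton, Finset.notMem_empty, iff_false]
  exact fun ⟨h, h1, h2⟩ => C.fst_ne_snd e h (h1.trans h2.symm)

lemma rho_singleton (f : (Bool → ℕ) → ℤ) (B : ℤ) (v : α) :
    C.rho f B {v} = f (C.slots v) := by
  simp [rho, inside_singleton]

lemma rho_restrict (f : (Bool → ℕ) → ℤ) (B : ℤ) {S T : Finset α} (h : S ⊆ T) :
    (C.restrict T).rho f B S = C.rho f B S := by
  have : (C.restrict T).inside S = C.inside S := by
    ext e
    simp only [mem_inside, restrict_E, restrict_fst, restrict_snd]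
    exact ⟨fun h' => ⟨h'.1.1, h'.2⟩, fun h' => ⟨⟨h'.1, h h'.2.1, h h'.2.2⟩, h'.2⟩⟩
  simp only [rho, this]
  rfl

lemma Sparse.restrict {f : (Bool → ℕ) → ℤ} {B τ : ℤ} (h : C.Sparse f B τ) (T : Finset α) :
    (C.restrict T).Sparse f B τ := by
  intro S hS hne
  rw [restrict_V, Finset.subset_inter_iff] at hS
  rw [rho_restrict f B hS.2]
  exact h S hS.1 hne

lemma active_congr {φ ψ : α → Bool} {e : β} (h1 : φ (C.fst e) = ψ (C.fst e))
    (h2 : φ (C.snd e) = ψ (C.snd e)) : C.Active φ e ↔ C.Active ψ e := by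
  simp [Active, h1, h2]

/-- The degree of a vertex is the sum of its degrees inside its part and across the parts. -/
lemma deg_glue {X U : Finset α} (hV : C.V = X ∪ U) (hd : Disjoint X U) (φ : α → Bool) {v : α}
    (hv : v ∈ U) : C.deg φ v =
      (C.restrict U).deg φ v + ((C.cross X U).filter fun e => C.Inc v e ∧ C.Active φ e).card := by
  have hd' : ∀ a ∈ X, a ∉ U := fun a ha => Finset.disjoint_left.1 hd ha
  unfold deg
  rw [← Finset.card_union_of_disjoint]
  · congr 1
    ext e
    simp only [Finset.mem_filter, Finset.mem_union, restrict_E, mem_inside, mem_cross]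
    constructor
    · rintro ⟨he, hi, ha⟩
      have h1 := C.fst_mem e he
      have h2 := C.snd_mem e he
      rw [hV, Finset.mem_union] at h1 h2
      have hi' := hi
      rcases hi' with rfl | rfl
      · rcases h2 with h2 | h2
        · exact Or.inr ⟨⟨he, Or.inr ⟨hv, h2⟩⟩, hi, ha⟩
        · exact Or.inl ⟨⟨he, hv, h2⟩, hi, ha⟩
      · rcases h1 with h1 | h1
        · exact Or.inr ⟨⟨he, Or.inl ⟨h1, hv⟩⟩, hi, ha⟩
        · exact Or.inl ⟨⟨he, h1, hv⟩, hi, ha⟩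
    · rintro (⟨⟨he, -⟩, hi, ha⟩ | ⟨⟨he, -⟩, hi, ha⟩) <;> exact ⟨he, hi, ha⟩
  · rw [Finset.disjoint_left]
    simp only [Finset.mem_filter, restrict_E, mem_inside, mem_cross]
    grind

lemma deg_congr {φ ψ : α → Bool} (h : ∀ v ∈ C.V, φ v = ψ v) (v : α) :
    C.deg φ v = C.deg ψ v := by
  unfold deg
  congr 1
  refine Finset.filter_congr fun e he => ?_
  rw [active_congr (h _ (C.fst_mem e he)) (h _ (C.snd_mem e he))]

lemma cross_comm (X U : Finset α) : C.cross X U = C.cross U X := by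
  ext e
  simp only [mem_cross]
  tauto

lemma deg_withSlots (k : α → Bool → ℕ) (φ : α → Bool) (v : α) :
    (C.withSlots k).deg φ v = C.deg φ v := rfl

lemma inside_withSlots (k : α → Bool → ℕ) (S : Finset α) :
    (C.withSlots k).inside S = C.inside S := rfl

lemma rho_withSlots (f : (Bool → ℕ) → ℤ) (B : ℤ) (k : α → Bool → ℕ) (S : Finset α) :
    (C.withSlots k).rho f B S =
      C.rho f B S - ∑ v ∈ S, (f (C.slots v) - f (k v)) := by
  have : (C.withSlots k).slots = k := rfl
  simp only [rho, inside_withSlots, this, Finset.sum_sub_distrib]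
  ring

/-- Colourings of two parts, with no violated edge between them, combine. -/
lemma isCol_glue {X U : Finset α} (hV : C.V = X ∪ U) (hd : Disjoint X U) {φ : α → Bool}
    (hX : (C.restrict X).IsCol φ) (hU : (C.restrict U).IsCol φ)
    (hc : ∀ e ∈ C.cross X U, ¬ C.Active φ e) : C.IsCol φ := by
  have h0 : ∀ v, ((C.cross X U).filter fun e => C.Inc v e ∧ C.Active φ e).card = 0 := by
    intro v
    rw [Finset.card_eq_zero, Finset.filter_eq_empty_iff]
    exact fun e he h => hc e he h.2
  intro v hv
  rw [hV, Finset.mem_union] at hv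
  rcases hv with hv | hv
  · rw [deg_glue (hV.trans (Finset.union_comm _ _)) hd.symm φ hv, cross_comm, h0]
    exact hX v (by simp [hV, hv])
  · rw [deg_glue hV hd φ hv, h0]
    exact hU v (by simp [hV, hv])

lemma IsCol.congr {φ ψ : α → Bool} (hφ : C.IsCol φ) (h : ∀ v ∈ C.V, φ v = ψ v) : C.IsCol ψ := by
  intro v hv
  rw [← deg_congr h, ← h v hv]
  exact hφ v hv

/-- Two colourings of complementary parts, with no violated edge between them. -/
lemma col_of_parts {X U : Finset α} (hV : C.V = X ∪ U) (hd : Disjoint X U) {φ ψ : α → Bool}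
    (hX : (C.restrict X).IsCol ψ) (hU : (C.restrict U).IsCol φ)
    (hc : ∀ e ∈ C.cross X U, ¬ C.Active (fun w => if w ∈ U then φ w else ψ w) e) : C.Col := by
  refine ⟨_, isCol_glue hV hd (hX.congr ?_) (hU.congr ?_) hc⟩
  · intro v hv
    have : v ∉ U := Finset.disjoint_left.1 hd (Finset.mem_inter.1 hv).2
    simp [this]
  · intro v hv
    simp [(Finset.mem_inter.1 hv).2]

/-! ### Contractions, deletions and splittings -/

/-- The sign is switched once for each end in `U` that `φ` makes poor, which compensates for reading
the colour of `t` in place of the colour of that end. -/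
lemma contract_active {U : Finset α} {t : α} {φ ψ : α → Bool} {kt : Bool → ℕ} (ht : t ∈ U)
    (e : β) : (C.contract U t φ kt ht).Active ψ e ↔
      C.Active (fun w => if w ∈ U then φ w ^^ !ψ t else ψ w) e := by
  unfold Active
  simp only [contract_fst, contract_snd, contract_sgn]
  by_cases h1 : C.fst e ∈ U <;> by_cases h2 : C.snd e ∈ U <;> simp only [h1, h2, if_true, if_false,
    decide_true, decide_false, Bool.true_and, Bool.false_and] <;>
  cases φ (C.fst e) <;> cases φ (C.snd e) <;> cases ψ t <;> cases ψ (C.fst e) <;>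
  cases ψ (C.snd e) <;> cases C.sgn e <;> decide

/-- With at most one slot per colour, `t` has no violated edge, so no edge leaving `U` is violated
and the degrees inside `U` are those of `φ` or of its complement. A colour of `t` may have a slot
only if the corresponding colouring of `U` is admissible. -/
lemma col_of_contract {U : Finset α} {t : α} {φ : α → Bool} {kt : Bool → ℕ} (ht : t ∈ U)
    (hφ : ∀ κ, 0 < kt κ → (C.restrict U).IsCol fun v => φ v ^^ !κ) (hkt : ∀ κ, kt κ ≤ 1)
    (h : (C.contract U t φ kt ht).Col) : C.Col := by
  obtain ⟨ψ, hψ⟩ := h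
  have h0 := hψ t (by simp)
  have hs : (C.contract U t φ kt ht).slots t = kt := by
    funext κ; simp [contract_slots]
  rw [hs] at h0
  have h1 : (C.contract U t φ kt ht).deg ψ t = 0 := by
    have := hkt (ψ t)
    omega
  rw [deg, Finset.card_eq_zero, Finset.filter_eq_empty_iff] at h1
  refine ⟨fun w => if w ∈ U then φ w ^^ !ψ t else ψ w, fun v hv => ?_⟩
  by_cases hvU : v ∈ U
  · simp only [hvU, if_true]
    refine lt_of_le_of_lt ?_ (hφ (ψ t) (by omega) v (by simp [hv, hvU]))
    refine Finset.card_le_card fun e he => ?_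
    obtain ⟨he, hi, ha⟩ := Finset.mem_filter.1 he
    by_cases hin : C.fst e ∈ U ∧ C.snd e ∈ U
    · simp only [Finset.mem_filter, restrict_E, mem_inside]
      refine ⟨⟨he, hin⟩, hi, ?_⟩
      change C.Active (fun v => φ v ^^ !ψ t) e
      refine (active_congr ?_ ?_).1 ha <;> simp [hin]
    · exfalso
      refine h1 (x := e) (by simp only [contract_E, Finset.mem_filter]; exact ⟨he, hin⟩) ⟨?_, ?_⟩
      · rcases hi with hi | hi
        · left; simp [hi, hvU]
        · right; simp [hi, hvU]
      · rwa [contract_active]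
  · simp only [hvU, if_false]
    have h2 := hψ v (by simp [hv, hvU])
    have hvt : v ≠ t := fun h => hvU (h ▸ ht)
    rw [show (C.contract U t φ kt ht).slots v = C.slots v by funext κ; simp [contract_slots, hvt]]
      at h2
    refine lt_of_le_of_lt ?_ h2
    refine Finset.card_le_card fun e he => ?_
    obtain ⟨he, hi, ha⟩ := Finset.mem_filter.1 he
    simp only [Finset.mem_filter, contract_E]
    refine ⟨⟨he, ?_⟩, ?_, ?_⟩
    · rintro ⟨h3, h4⟩
      rcases hi with rfl | rfl
      · exact hvU h3
      · exact hvU h4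
    · rcases hi with hi | hi
      · left; simp [hi, hvU]
      · right; simp [hi, hvU]
    · rwa [contract_active]

lemma rho_contract_insert (f : (Bool → ℕ) → ℤ) (B : ℤ) {U X : Finset α} {t : α} {φ : α → Bool}
    {kt : Bool → ℕ} (ht : t ∈ U) (hd : Disjoint X U) :
    (C.contract U t φ kt ht).rho f B (insert t X) =
      C.rho f B (X ∪ U) - C.rho f B U + f kt := by
  have hX : ∀ a ∈ X, a ∉ U := fun a ha => Finset.disjoint_left.1 hd ha
  have htX : t ∉ X := fun h => hX t h ht
  have h1 : (C.contract U t φ kt ht).inside (insert t X) = C.inside (X ∪ U) \ C.inside U := by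
    ext e
    simp only [mem_inside, contract_E, contract_fst, contract_snd, Finset.mem_filter,
      Finset.mem_sdiff, Finset.mem_insert, Finset.mem_union]
    have h1 : (if C.fst e ∈ U then t else C.fst e) = t ∨ (if C.fst e ∈ U then t else C.fst e) ∈ X
        ↔ C.fst e ∈ X ∨ C.fst e ∈ U := by grind
    have h2 : (if C.snd e ∈ U then t else C.snd e) = t ∨ (if C.snd e ∈ U then t else C.snd e) ∈ X
        ↔ C.snd e ∈ X ∨ C.snd e ∈ U := by grind
    rw [h1, h2]
    clear h1 h2 htX hX hd
    tauto
  have h2 : ((C.inside (X ∪ U) \ C.inside U).card : ℤ) =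
      (C.inside (X ∪ U)).card - (C.inside U).card := by
    have hsub : C.inside U ⊆ C.inside (X ∪ U) := inside_mono Finset.subset_union_right
    rw [Finset.card_sdiff_of_subset hsub, Nat.cast_sub (Finset.card_le_card hsub)]
  have h3 : ∑ v ∈ X, f ((C.contract U t φ kt ht).slots v) = ∑ v ∈ X, f (C.slots v) := by
    refine Finset.sum_congr rfl fun v hv => ?_
    congr 1
    funext κ
    have : v ≠ t := fun h => htX (h ▸ hv)
    simp [contract_slots, this]
  have h4 : (C.contract U t φ kt ht).slots t = kt := by
    funext κ; simp [contract_slots]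
  simp only [rho, h1, h2, Finset.sum_insert htX, h3, h4, Finset.sum_union hd]
  ring

lemma rho_contract_of_disjoint (f : (Bool → ℕ) → ℤ) (B : ℤ) {U X : Finset α} {t : α}
    {φ : α → Bool} {kt : Bool → ℕ} (ht : t ∈ U) (hd : Disjoint X U) :
    (C.contract U t φ kt ht).rho f B X = C.rho f B X := by
  have hX : ∀ a ∈ X, a ∉ U := fun a ha => Finset.disjoint_left.1 hd ha
  have htX : t ∉ X := fun h => hX t h ht
  have h1 : (C.contract U t φ kt ht).inside X = C.inside X := by
    ext e
    simp only [mem_inside, contract_E, contract_fst, contract_snd, Finset.mem_filter]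
    grind
  have h3 : ∑ v ∈ X, f ((C.contract U t φ kt ht).slots v) = ∑ v ∈ X, f (C.slots v) := by
    refine Finset.sum_congr rfl fun v hv => ?_
    congr 1
    funext κ
    have : v ≠ t := fun h => htX (h ▸ hv)
    simp [contract_slots, this]
  simp only [rho, h1, h3]

/-- Contracting a set keeps sparsity if the potential of the new vertex is large enough. -/
lemma sparse_contract {f : (Bool → ℕ) → ℤ} {B τ : ℤ} {U : Finset α} {t : α} {φ : α → Bool}
    {kt : Bool → ℕ} (ht : t ∈ U)
    (h1 : ∀ X ⊆ C.V \ U, τ ≤ C.rho f B (X ∪ U) - C.rho f B U + f kt)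
    (h2 : ∀ X ⊆ C.V \ U, X.Nonempty → τ ≤ C.rho f B X) :
    (C.contract U t φ kt ht).Sparse f B τ := by
  intro S hS hne
  rw [contract_V] at hS
  have key : ∀ X ⊆ C.V \ U, Disjoint X U := fun X hX =>
    Finset.disjoint_left.2 fun a ha => (Finset.mem_sdiff.1 (hX ha)).2
  by_cases htS : t ∈ S
  · have hX : S.erase t ⊆ C.V \ U := fun a ha => by
      have := hS (Finset.mem_of_mem_erase ha)
      simpa [Finset.ne_of_mem_erase ha] using this
    rw [← Finset.insert_erase htS, rho_contract_insert f B ht (key _ hX)]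
    exact h1 _ hX
  · have hX : S ⊆ C.V \ U := fun a ha => by
      have h := hS ha
      rcases Finset.mem_insert.1 h with rfl | h
      · exact absurd ha htS
      · exact h
    rw [rho_contract_of_disjoint f B ht (key _ hX)]
    exact h2 _ hX hne

lemma card_contract_E {U : Finset α} {t : α} {φ : α → Bool} {kt : Bool → ℕ} (ht : t ∈ U) :
    (C.contract U t φ kt ht).E.card ≤ C.E.card := Finset.card_filter_le _ _

/-- The slots that remain outside `U` if no edge to the coloured set `U` may be violated. -/
def killSlots (C : SignedGraph α β) (U : Finset α) (φ : α → Bool) (v : α) (κ : Bool) : ℕ :=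
  if ∃ e ∈ C.cross {v} U, C.Active (fun w => if w ∈ U then φ w else κ) e then 0 else C.slots v κ

/-- Delete a coloured set `U` and forbid all violations of the edges that leave it. -/
def kill (C : SignedGraph α β) (U : Finset α) (φ : α → Bool) : SignedGraph α β :=
  (C.restrict (C.V \ U)).withSlots (C.killSlots U φ)

lemma col_of_kill {U : Finset α} {φ : α → Bool} (hU : U ⊆ C.V) (hφ : (C.restrict U).IsCol φ)
    (h : (C.kill U φ).Col) : C.Col := by
  obtain ⟨ψ, hψ⟩ := h
  have hle : ∀ v κ, C.killSlots U φ v κ ≤ C.slots v κ := by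
    intro v κ
    unfold killSlots
    split_ifs <;> simp
  refine col_of_parts (X := C.V \ U) (U := U) (Finset.sdiff_union_of_subset hU).symm
    Finset.sdiff_disjoint (ψ := ψ) (φ := φ) (fun v hv => ?_) hφ ?_
  · exact lt_of_lt_of_le (hψ v hv) (hle v _)
  · intro e he ha
    rw [mem_cross] at he
    have key : ∀ v, v ∈ C.V \ U → C.Inc v e → e ∈ C.cross {v} U → False := by
      intro v hv hi hc
      have h1 := hψ v (by simpa [kill] using hv)
      -- A violated edge of the cut would have removed every slot of the colour that its outer end
      -- uses.
      have h2 : (C.kill U φ).slots v (ψ v) = 0 := by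
        change C.killSlots U φ v (ψ v) = 0
        unfold killSlots
        rw [if_pos]
        refine ⟨e, hc, (active_congr ?_ ?_).1 ha⟩
        · by_cases hf : C.fst e ∈ U
          · simp [hf]
          · rcases hi with rfl | rfl
            · simp [hf]
            · rw [mem_cross] at hc
              simp [hf] at hc hv
              grind
        · by_cases hf : C.snd e ∈ U
          · simp [hf]
          · rcases hi with rfl | rfl
            · rw [mem_cross] at hc
              simp [hf] at hc hv
              grind
            · simp [hf]
      omega
    rcases he.2 with ⟨h1, h2⟩ | ⟨h1, h2⟩
    · exact key _ h1 (Or.inl rfl) (by rw [mem_cross]; simp [he.1, h2])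
    · exact key _ h2 (Or.inr rfl) (by rw [mem_cross]; simp [he.1, h1])

lemma deg_eraseEdge_of_active {φ : α → Bool} {e : β} {v : α} :
    C.deg φ v ≤ (C.eraseEdge e).deg φ v + if C.Inc v e ∧ C.Active φ e then 1 else 0 := by
  unfold deg
  have : (C.E.filter fun e => C.Inc v e ∧ C.Active φ e) ⊆
      ((C.E.erase e).filter fun e => C.Inc v e ∧ C.Active φ e) ∪
        if C.Inc v e ∧ C.Active φ e then {e} else ∅ := by
    intro e' he'
    rw [Finset.mem_filter] at he'
    by_cases h : e' = e
    · subst h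
      simp [he'.2]
    · simp [he', h]
  refine (Finset.card_le_card this).trans ((Finset.card_union_le _ _).trans ?_)
  gcongr
  · exact le_rfl
  · split_ifs <;> simp

/-- An edge may be deleted if the slots that are left pay for it. -/
lemma col_of_eraseEdge {e : β} (he : e ∈ C.E) {k : α → Bool → ℕ} (hk : ∀ v κ, k v κ ≤ C.slots v κ)
    (hk' : ∀ φ : α → Bool, (∀ v, C.Inc v e → 0 < k v (φ v)) → C.Active φ e →
      ∀ v, C.Inc v e → k v (φ v) + 1 ≤ C.slots v (φ v))
    (h : ((C.eraseEdge e).withSlots k).Col) : C.Col := by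
  obtain ⟨φ, hφ⟩ := h
  have hφ' : ∀ v ∈ C.V, (C.eraseEdge e).deg φ v < k v (φ v) := fun v hv => hφ v hv
  have hin : ∀ v, C.Inc v e → v ∈ C.V := by
    rintro v (rfl | rfl)
    exacts [C.fst_mem e he, C.snd_mem e he]
  refine ⟨φ, fun v hv => ?_⟩
  have h1 := deg_eraseEdge_of_active (C := C) (φ := φ) (e := e) (v := v)
  have h2 := hφ' v hv
  have h3 := hk v (φ v)
  split_ifs at h1 with hc
  · have := hk' φ (fun w hw => (Nat.zero_le _).trans_lt (hφ' w (hin w hw))) hc.2 v hc.1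
    omega
  · omega

lemma rho_eraseEdge (f : (Bool → ℕ) → ℤ) (B : ℤ) {e : β} (he : e ∈ C.E) (S : Finset α) :
    (C.eraseEdge e).rho f B S =
      C.rho f B S + if C.fst e ∈ S ∧ C.snd e ∈ S then B else 0 := by
  have h1 : (C.eraseEdge e).inside S = (C.inside S).erase e := by
    ext e'
    simp only [mem_inside, Finset.mem_erase, eraseEdge_E, eraseEdge_fst, eraseEdge_snd]
    tauto
  have h2 : (C.eraseEdge e).slots = C.slots := rfl
  simp only [rho, h1, h2]
  split_ifs with h
  · have hm : e ∈ C.inside S := mem_inside.2 ⟨he, h⟩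
    rw [Finset.cast_card_erase_of_mem hm]
    ring
  · rw [Finset.erase_eq_of_notMem (by simp only [mem_inside]; tauto)]
    ring

lemma sum_eq_of_support_pair {g : α → ℤ} {a b : α} (hab : a ≠ b)
    (hg : ∀ v, v ≠ a → v ≠ b → g v = 0) (S : Finset α) :
    ∑ v ∈ S, g v = (if a ∈ S then g a else 0) + if b ∈ S then g b else 0 := by
  have h : ∀ v, g v = (if v = a then g a else 0) + if v = b then g b else 0 := by
    intro v
    by_cases h1 : v = a
    · subst h1; simp [hab]
    · by_cases h2 : v = b
      · subst h2; simp [h1]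
      · simp [h1, h2, hg v h1 h2]
  rw [Finset.sum_congr rfl fun v _ => h v, Finset.sum_add_distrib, Finset.sum_ite_eq',
    Finset.sum_ite_eq']

/-- The potential after an edge is deleted and its ends lose some slots. -/
lemma rho_eraseEdge_withSlots (f : (Bool → ℕ) → ℤ) (B : ℤ) {e : β} (he : e ∈ C.E)
    {k : α → Bool → ℕ} (hk : ∀ v, v ≠ C.fst e → v ≠ C.snd e → k v = C.slots v) (S : Finset α) :
    ((C.eraseEdge e).withSlots k).rho f B S =
      C.rho f B S + (if C.fst e ∈ S ∧ C.snd e ∈ S then B else 0)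
        - (if C.fst e ∈ S then f (C.slots (C.fst e)) - f (k (C.fst e)) else 0)
        - (if C.snd e ∈ S then f (C.slots (C.snd e)) - f (k (C.snd e)) else 0) := by
  rw [rho_withSlots, rho_eraseEdge f B he]
  have h2 : (C.eraseEdge e).slots = C.slots := rfl
  rw [h2, sum_eq_of_support_pair (C.fst_ne_snd e he)
    (fun v h1 h2 => by rw [hk v h1 h2, sub_self])]
  ring

/-- One slot less at the vertices in `S`, for both colours. -/
def decSlots (C : SignedGraph α β) (S : Finset α) (v : α) (κ : Bool) : ℕ :=
  if v ∈ S then C.slots v κ - 1 else C.slots v κ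

lemma decSlots_le (S : Finset α) (v : α) (κ : Bool) : C.decSlots S v κ ≤ C.slots v κ := by
  unfold decSlots
  split_ifs <;> omega

lemma decSlots_of_notMem {S : Finset α} {v : α} (h : v ∉ S) : C.decSlots S v = C.slots v := by
  funext κ
  simp [decSlots, h]

lemma decSlots_of_mem {S : Finset α} {v : α} (h : v ∈ S) :
    C.decSlots S v = fun κ => C.slots v κ - 1 := by
  funext κ
  simp [decSlots, h]

/-- Deleting an edge and taking a slot of each colour from both ends. -/
def split (C : SignedGraph α β) (e : β) : SignedGraph α β :=
  (C.eraseEdge e).withSlots (C.decSlots {C.fst e, C.snd e})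

/-- A colour in use still has a positive number of slots after the truncated subtraction, so it
really lost one; that slot absorbs `e` if `e` is violated. -/
lemma col_of_split {e : β} (he : e ∈ C.E) (h : (C.split e).Col) : C.Col := by
  refine col_of_eraseEdge he (decSlots_le _) ?_ h
  intro φ h1 _ v hv
  have h2 := h1 v hv
  have h3 : v ∈ ({C.fst e, C.snd e} : Finset α) := by
    rcases hv with rfl | rfl <;> simp
  rw [decSlots_of_mem h3] at h2 ⊢
  dsimp only at h2 ⊢
  omega

/-- Splitting an edge keeps sparsity if each slot pair costs at most `L`, twice `L` is at most `B`,
and all sets with one end of the edge have potential at least `τ + L`. -/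
lemma sparse_split {f : (Bool → ℕ) → ℤ} {B τ L : ℤ} {e : β} (he : e ∈ C.E)
    (hC : C.Sparse f B τ)
    (hL : ∀ v, C.Inc v e → f (C.slots v) - f (fun κ => C.slots v κ - 1) ≤ L)
    (h1 : ∀ S ⊂ C.V, (C.fst e ∈ S ∨ C.snd e ∈ S) → ¬ (C.fst e ∈ S ∧ C.snd e ∈ S) →
      τ + L ≤ C.rho f B S)
    (h2 : ∀ S ⊆ C.V, C.fst e ∈ S → C.snd e ∈ S → τ + 2 * L - B ≤ C.rho f B S) :
    (C.split e).Sparse f B τ := by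
  intro S hS hne
  have hf : C.fst e ∈ ({C.fst e, C.snd e} : Finset α) := by simp
  have hs : C.snd e ∈ ({C.fst e, C.snd e} : Finset α) := by simp
  have hLf := hL _ (Or.inl rfl)
  have hLs := hL _ (Or.inr rfl)
  have hS' : S ⊆ C.V := hS
  have hτ := hC S hS' hne
  unfold split
  rw [rho_eraseEdge_withSlots f B he (fun v h1 h2 => decSlots_of_notMem (by simp [h1, h2]))]
  rw [decSlots_of_mem hf, decSlots_of_mem hs]
  by_cases h5 : C.fst e ∈ S <;> by_cases h6 : C.snd e ∈ S <;>
    simp only [h5, h6, and_true, and_false, if_true, if_false]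
  -- With both ends in `S`, the deleted edge returns `B` and the ends cost at most `2 * L`.
  · linarith [h2 S hS' h5 h6]
  · have hss : S ⊂ C.V := hS'.ssubset_of_ne fun h => h6 (h ▸ C.snd_mem e he)
    linarith [h1 S hss (Or.inl h5) (fun h => h6 h.2)]
  · have hss : S ⊂ C.V := hS'.ssubset_of_ne fun h => h5 (h ▸ C.fst_mem e he)
    linarith [h1 S hss (Or.inr h6) (fun h => h5 h.1)]
  · linarith

lemma card_split (e : β) (he : e ∈ C.E) :
    (C.split e).V.card + (C.split e).E.card < C.V.card + C.E.card := by
  have : (C.E.erase e).card < C.E.card := Finset.card_erase_lt_of_mem he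
  simpa [split] using this

lemma card_restrict_lt {U : Finset α} (hU : U ⊂ C.V) :
    (C.restrict U).V.card + (C.restrict U).E.card < C.V.card + C.E.card := by
  have h1 : (C.V ∩ U).card < C.V.card :=
    (Finset.card_le_card Finset.inter_subset_right).trans_lt (Finset.card_lt_card hU)
  have h2 : (C.inside U).card ≤ C.E.card := Finset.card_filter_le _ _
  simp only [restrict_V, restrict_E]
  omega

/-! ### The case `j ≥ i + 2` -/

lemma Inc.exists_other {v : α} {e : β} (h : C.Inc v e) (he : e ∈ C.E) :
    ∃ w ∈ C.V, w ≠ v ∧ ((C.fst e = v ∧ C.snd e = w) ∨ (C.fst e = w ∧ C.snd e = v)) := by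
  have := C.fst_ne_snd e he
  rcases h with rfl | rfl
  · exact ⟨_, C.snd_mem e he, this.symm, Or.inl ⟨rfl, rfl⟩⟩
  · exact ⟨_, C.fst_mem e he, this, Or.inr ⟨rfl, rfl⟩⟩

lemma rho_le_of_subset_inside (f : (Bool → ℕ) → ℤ) {B : ℤ} (hB : 0 ≤ B) {S : Finset α}
    {K : Finset β} (hK : K ⊆ C.inside S) :
    C.rho f B S ≤ ∑ v ∈ S, f (C.slots v) - B * K.card := by
  have : (K.card : ℤ) ≤ (C.inside S).card := by exact_mod_cast Finset.card_le_card hK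
  unfold rho
  nlinarith

/-- The potential of the ends of an edge. -/
lemma rho_ends_le (f : (Bool → ℕ) → ℤ) {B : ℤ} (hB : 0 ≤ B) {e : β} (he : e ∈ C.E) :
    C.rho f B {C.fst e, C.snd e} ≤ f (C.slots (C.fst e)) + f (C.slots (C.snd e)) - B := by
  have h := rho_le_of_subset_inside (C := C) f hB (S := {C.fst e, C.snd e}) (K := {e})
    (by simp [mem_inside, he])
  rwa [Finset.sum_pair (C.fst_ne_snd e he), Finset.card_singleton, Nat.cast_one, mul_one] at h

/-- If no edge is violated, then one slot for the colour of each vertex suffices. -/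
lemma isCol_of_forall_not_active {φ : α → Bool} (h : ∀ e ∈ C.E, ¬ C.Active φ e)
    (hk : ∀ v ∈ C.V, 0 < C.slots v (φ v)) : C.IsCol φ := by
  intro v hv
  have : C.deg φ v = 0 := by
    rw [deg, Finset.card_eq_zero, Finset.filter_eq_empty_iff]
    exact fun e he h' => h e he h'.2
  rw [this]
  exact hk v hv

/-- The weight of a vertex for which losing a slot of each colour costs `L`. -/
def maxWeight (F L : ℤ) (i j : ℕ) (k : Bool → ℕ) : ℤ :=
  F - L * (max (i + 1 - k false) (j + 1 - k true) : ℕ)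

lemma maxWeight_sub_le {F L : ℤ} (hL : 0 ≤ L) (i j : ℕ) (k : Bool → ℕ) :
    maxWeight F L i j k - maxWeight F L i j (fun κ => k κ - 1) ≤ L := by
  unfold maxWeight
  have : ((max (i + 1 - (k false - 1)) (j + 1 - (k true - 1)) : ℕ) : ℤ) ≤
      (max (i + 1 - k false) (j + 1 - k true) : ℕ) + 1 := by
    norm_cast
    omega
  nlinarith

lemma maxWeight_le {F L : ℤ} (hL : 0 ≤ L) (i j : ℕ) (k : Bool → ℕ) :
    maxWeight F L i j k ≤ F := by
  unfold maxWeight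
  have : (0 : ℤ) ≤ (max (i + 1 - k false) (j + 1 - k true) : ℕ) := Int.natCast_nonneg _
  nlinarith

section MaxWeight

variable {F L B : ℤ} {i j : ℕ}

/-- This is the vertex to which sets are contracted, and its weight is the threshold for
contraction. The rich deficiency `j` exceeds the poor deficiency `i + 1`. -/
lemma maxWeight_poor_zero (hij : i + 2 ≤ j) : maxWeight F L i j (fun κ => if κ then 1 else 0) =
    F - L * j := by
  unfold maxWeight
  simp only [if_true, Bool.false_eq_true, if_false]
  rw [show max (i + 1 - 0) (j + 1 - 1) = j by omega]

/-- Without rich slots the deficiency is at least `j + 1`, and the weight falls below the sparsity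
bound. -/
lemma rich_pos_of_le_maxWeight (hL : 0 < L) {k : Bool → ℕ}
    (h : F - L * j - L + 1 ≤ maxWeight F L i j k) : 0 < k true := by
  by_contra h0
  have : ((j : ℤ) + 1) ≤ (max (i + 1 - k false) (j + 1 - k true) : ℕ) := by
    norm_cast
    omega
  unfold maxWeight at h
  nlinarith

/-- The heart of the matter: no edge joins two vertices of large weight. -/
lemma col_of_light_ends (hL : 0 < L) (hFB : F + L ≤ 2 * B)
    (h2L : 2 * L ≤ B) (hσ : F ≤ L * j) (hF : F ≤ B + L * i)
    (hC : C.Sparse (maxWeight F L i j) B (F - L * j - L + 1))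
    (hE : ∀ e ∈ C.E, maxWeight F L i j (C.slots (C.fst e)) ≤ F - L * j ∨
      maxWeight F L i j (C.slots (C.snd e)) ≤ F - L * j) : C.Col := by
  set f := maxWeight F L i j with hf
  have hB : 0 ≤ B := by linarith
  have h1 : ∀ v ∈ C.V, F - L * j - L + 1 ≤ f (C.slots v) := fun v hv => by
    simpa [rho_singleton] using hC {v} (by simpa using hv) (by simp)
  -- Call a vertex light if its weight is at most `F - L * j`, and heavy otherwise. Two adjacent
  -- light vertices have potential at most `2 * (F - L * j) - B`, too little since `F ≤ L * j` and
  -- `2 * L ≤ B`.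
  have hTT : ∀ e ∈ C.E, f (C.slots (C.fst e)) ≤ F - L * j → f (C.slots (C.snd e)) ≤ F - L * j →
      False := by
    intro e he ha hb
    have h3 := rho_ends_le (C := C) f hB he
    have h4 := hC {C.fst e, C.snd e} (by
      intro x hx
      simp only [Finset.mem_insert, Finset.mem_singleton] at hx
      rcases hx with rfl | rfl
      exacts [C.fst_mem e he, C.snd_mem e he]) (by simp)
    linarith
  have hother : ∀ z e, e ∈ C.E → C.Inc z e → F - L * j < f (C.slots z) →
      ∃ t ∈ C.V, t ≠ z ∧ f (C.slots t) ≤ F - L * j ∧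
        ((C.fst e = z ∧ C.snd e = t) ∨ (C.fst e = t ∧ C.snd e = z)) := by
    intro z e he hi hz
    obtain ⟨t, htV, htz, ht⟩ := hi.exists_other he
    refine ⟨t, htV, htz, ?_, ht⟩
    rcases ht with ⟨rfl, rfl⟩ | ⟨rfl, rfl⟩ <;> rcases hE e he with h | h <;>
      first | exact h | exact absurd h (not_le.2 hz)
  -- Two edges at a heavy vertex lead to light vertices, possibly the same one, of total weight at
  -- most `F - L * j`. The potential is then at most `F + (F - L * j) - 2 * B`, which `F + L ≤ 2 *
  -- B` excludes.
  have huniq : ∀ z ∈ C.V, F - L * j < f (C.slots z) → ∀ e ∈ C.E, ∀ e' ∈ C.E, C.Inc z e →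
      C.Inc z e' → e = e' := by
    intro z hzV hz e he e' he' hi hi'
    by_contra hne
    obtain ⟨t, htV, htz, ht, hte⟩ := hother z e he hi hz
    obtain ⟨t', htV', htz', ht', hte'⟩ := hother z e' he' hi' hz
    have hS : ({e, e'} : Finset β) ⊆ C.inside (insert z ({t, t'} : Finset α)) := by
      intro x hx
      simp only [Finset.mem_insert, Finset.mem_singleton] at hx
      simp only [mem_inside, Finset.mem_insert, Finset.mem_singleton]
      grind
    have h3 := rho_le_of_subset_inside (C := C) f hB hS
    have h4 := hC (insert z ({t, t'} : Finset α)) (by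
      intro x hx
      simp only [Finset.mem_insert, Finset.mem_singleton] at hx
      grind) (by simp)
    rw [Finset.card_pair hne, Finset.sum_insert (by
      simp only [Finset.mem_insert, Finset.mem_singleton]
      grind)] at h3
    have h5 : ∑ v ∈ ({t, t'} : Finset α), f (C.slots v) ≤ F - L * j := by
      by_cases htt : t = t'
      · simpa [htt] using ht'
      · rw [Finset.sum_pair htt]
        linarith
    have h6 : f (C.slots z) ≤ F := maxWeight_le hL.le _ _ _
    push_cast at h3
    linarith
  -- Without poor slots the weight of `z` is at most `F - L * (i + 1)`, and `F ≤ B + L * i` rules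
  -- out an edge from `z` to a light vertex.
  have hpoor : ∀ z ∈ C.V, F - L * j < f (C.slots z) → ∀ e ∈ C.E, C.Inc z e →
      0 < C.slots z false := by
    intro z hzV hz e he hi
    obtain ⟨t, htV, htz, ht, hte⟩ := hother z e he hi hz
    have h3 := rho_ends_le (C := C) f hB he
    have h4 := hC {C.fst e, C.snd e} (by
      intro x hx
      simp only [Finset.mem_insert, Finset.mem_singleton] at hx
      rcases hx with rfl | rfl
      exacts [C.fst_mem e he, C.snd_mem e he]) (by simp)
    have h5 : f (C.slots (C.fst e)) + f (C.slots (C.snd e)) = f (C.slots z) + f (C.slots t) := by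
      rcases hte with ⟨h, h'⟩ | ⟨h, h'⟩ <;> rw [h, h']
      ring
    by_contra h0
    have h6 : ((i : ℤ) + 1) ≤ (max (i + 1 - C.slots z false) (j + 1 - C.slots z true) : ℕ) := by
      norm_cast
      omega
    have h7 : f (C.slots z) ≤ F - L * (i + 1) := by
      rw [hf, maxWeight]
      nlinarith
    linarith
  classical
  -- Light vertices are rich. A heavy vertex has at most one edge and takes the colour that
  -- satisfies it, so no edge is violated.
  refine ⟨fun v => !decide (∃ e ∈ C.E, C.Inc v e ∧ C.sgn e = false ∧ F - L * j < f (C.slots v)),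
    isCol_of_forall_not_active ?_ ?_⟩
  · have key : ∀ e ∈ C.E, ∀ z, C.Inc z e → F - L * j < f (C.slots z) →
        (!decide (∃ e ∈ C.E, C.Inc z e ∧ C.sgn e = false ∧ F - L * j < f (C.slots z))) =
          C.sgn e := by
      intro e he z hi hz
      have hzV : z ∈ C.V := by
        rcases hi with rfl | rfl
        exacts [C.fst_mem e he, C.snd_mem e he]
      cases hs : C.sgn e
      · simp only [Bool.not_eq_false', decide_eq_true_eq]
        exact ⟨e, he, hi, hs, hz⟩
      · simp only [Bool.not_eq_true', decide_eq_false_iff_not]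
        rintro ⟨e', he', hi', hs', -⟩
        rw [huniq z hzV hz e he e' he' hi hi', hs'] at hs
        exact absurd hs (by decide)
    have key' : ∀ t, f (C.slots t) ≤ F - L * j →
        (!decide (∃ e ∈ C.E, C.Inc t e ∧ C.sgn e = false ∧ F - L * j < f (C.slots t))) = true := by
      intro t ht
      simp only [Bool.not_eq_true', decide_eq_false_iff_not]
      rintro ⟨e', -, -, -, h⟩
      exact absurd ht (not_le.2 h)
    intro e he
    unfold Active
    beta_reduce
    rcases hE e he with h | h
    · have h' : F - L * j < f (C.slots (C.snd e)) := not_le.1 fun h' => hTT e he h h'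
      rw [key' _ h, key e he _ (Or.inr rfl) h']
      cases C.sgn e <;> decide
    · have h' : F - L * j < f (C.slots (C.fst e)) := not_le.1 fun h' => hTT e he h' h
      rw [key' _ h, key e he _ (Or.inl rfl) h']
      cases C.sgn e <;> decide
  · intro v hv
    by_cases h : ∃ e ∈ C.E, C.Inc v e ∧ C.sgn e = false ∧ F - L * j < f (C.slots v)
    · simp only [h, decide_true, Bool.not_true]
      obtain ⟨e, he, hi, -, hz⟩ := h
      exact hpoor v hv hz e he hi
    · simp only [h, decide_false, Bool.not_false]
      exact rich_pos_of_le_maxWeight hL (h1 v hv)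

/-- Contracting a set to a rich vertex with a single slot. -/
lemma col_of_contract_rich {f : (Bool → ℕ) → ℤ} {τ : ℤ} {U : Finset α}
    (hne : U.Nonempty) (hU : (C.restrict U).Col)
    (h1 : ∀ X ⊆ C.V \ U,
      τ ≤ C.rho f B (X ∪ U) - C.rho f B U + f (fun κ => if κ then 1 else 0))
    (h2 : ∀ X ⊆ C.V \ U, X.Nonempty → τ ≤ C.rho f B X)
    (h : ∀ C' : SignedGraph α β, C'.V.card + U.card = (C.V ∪ U).card + 1 → C'.E.card ≤ C.E.card →
      C'.Sparse f B τ → C'.Col) : C.Col := by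
  obtain ⟨φ, hφ⟩ := hU
  obtain ⟨t, ht⟩ := hne
  refine col_of_contract ht (φ := φ) (kt := fun κ => if κ then 1 else 0) ?_ ?_
    (h _ ?_ (card_contract_E ht) (sparse_contract ht h1 h2))
  · intro κ hκ
    cases κ
    · simp at hκ
    · simpa using hφ
  · intro κ
    cases κ <;> simp
  · rw [contract_V, Finset.card_insert_of_notMem (by simp [ht]), ← Finset.union_sdiff_right,
      Finset.card_sdiff_of_subset Finset.subset_union_right]
    have := Finset.card_le_card (Finset.subset_union_right (s₁ := C.V) (s₂ := U))
    omega

/-- A proper set of at least two vertices with potential at most `F - L * j` is contracted to a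
vertex of exactly that weight, which lowers no potential. If there is none, then by integrality
every proper set that contains just one end of an edge between heavy vertices has potential at least
`F - L * j + 1`, exactly `L` above the bound, so such an edge can be split. Otherwise every edge has
a light end. -/
theorem col_of_sparse_maxWeight (hij : i + 2 ≤ j) (hL : 0 < L) (hFB : F + L ≤ 2 * B)
    (h2L : 2 * L ≤ B) (hσ : F ≤ L * j) (hF : F ≤ B + L * i)
    (hC : C.Sparse (maxWeight F L i j) B (F - L * j - L + 1)) : C.Col := by
  induction hn : C.V.card + C.E.card using Nat.strong_induction_on generalizing C with
  | _ n ih =>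
  subst hn
  set f := maxWeight F L i j with hf
  by_cases hA : ∃ U ⊂ C.V, 2 ≤ U.card ∧ C.rho f B U ≤ F - L * j
  · obtain ⟨U, hU, hcard, hρ⟩ := hA
    have hne : U.Nonempty := Finset.card_pos.1 (by omega)
    refine col_of_contract_rich (B := B) (f := f) (τ := F - L * j - L + 1) hne
      (ih _ (card_restrict_lt hU) (hC.restrict U) rfl) ?_
      (fun X hX => hC X (hX.trans Finset.sdiff_subset)) ?_
    · intro X hX
      have := hC (X ∪ U) (Finset.union_subset (hX.trans Finset.sdiff_subset) hU.1)
        (hne.mono Finset.subset_union_right)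
      rw [hf, maxWeight_poor_zero hij, ← hf]
      linarith
    · intro C' h1 h2 h3
      rw [Finset.union_eq_left.2 hU.1] at h1
      exact ih _ (by omega) h3 rfl
  · push Not at hA
    by_cases hE : ∃ e ∈ C.E, F - L * j < f (C.slots (C.fst e)) ∧ F - L * j < f (C.slots (C.snd e))
    · obtain ⟨e, he, h1, h2⟩ := hE
      refine col_of_split he (ih _ (card_split e he) (sparse_split he hC (L := L)
        (fun v _ => maxWeight_sub_le hL.le i j _) ?_ ?_) rfl)
      · intro S hS hor hand
        rcases Nat.lt_or_ge S.card 2 with hlt | hge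
        · have hSne : S.Nonempty := by
            rcases hor with h | h
            exacts [⟨_, h⟩, ⟨_, h⟩]
          have : S.card = 1 := by
            have := Finset.card_pos.2 hSne
            omega
          obtain ⟨a, rfl⟩ := Finset.card_eq_one.1 this
          rw [rho_singleton]
          simp only [Finset.mem_singleton] at hor
          rcases hor with h | h
          · rw [← h]; linarith
          · rw [← h]; linarith
        · linarith [hA S hS hge]
      · intro S hS h3 h4
        have := hC S hS ⟨_, h3⟩
        linarith
    · push Not at hE
      refine col_of_light_ends hL hFB h2L hσ hF hC fun e he => ?_
      by_contra! hcon
      exact absurd (hE e he hcon.1) (not_le.2 hcon.2)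

end MaxWeight

/-- A set of least potential, and among those one of largest size. -/
lemma exists_min_rho (f : (Bool → ℕ) → ℤ) (B : ℤ) (hV : C.V.Nonempty) :
    ∃ S ⊆ C.V, S.Nonempty ∧ (∀ T ⊆ C.V, T.Nonempty → C.rho f B S ≤ C.rho f B T) ∧
      ∀ T ⊆ C.V, S ⊂ T → C.rho f B S < C.rho f B T := by
  have hne : (C.V.powerset.filter Finset.Nonempty).Nonempty := ⟨C.V, by simpa using hV⟩
  obtain ⟨S₀, hS₀, hmin⟩ := Finset.exists_min_image _ (C.rho f B) hne
  have hne' : ((C.V.powerset.filter Finset.Nonempty).filter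
      fun S => C.rho f B S = C.rho f B S₀).Nonempty := ⟨S₀, by simp [hS₀]⟩
  obtain ⟨S, hS, hmax⟩ := Finset.exists_max_image _ Finset.card hne'
  simp only [Finset.mem_filter, Finset.mem_powerset] at hS hmax hmin
  refine ⟨S, hS.1.1, hS.1.2, fun T hT hTne => ?_, fun T hT hST => ?_⟩
  · rw [hS.2]
    exact hmin T ⟨hT, hTne⟩
  · have hTne : T.Nonempty := hS.1.2.mono hST.1
    refine lt_of_le_of_ne (hS.2 ▸ hmin T ⟨hT, hTne⟩) fun heq => ?_
    have := hmax T ⟨⟨hT, hTne⟩, by rw [← heq, hS.2]⟩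
    exact absurd (Finset.card_lt_card hST) (not_lt.2 this)

/-- Sets disjoint from a set of least potential. -/
lemma rho_of_disjoint_min {f : (Bool → ℕ) → ℤ} {B : ℤ} (hB : 0 ≤ B) {S X : Finset α}
    (hX : X ⊆ C.V \ S) : C.rho f B (X ∪ S) - C.rho f B S ≤ C.rho f B X := by
  have hd : Disjoint X S := Finset.disjoint_left.2 fun a ha => (Finset.mem_sdiff.1 (hX ha)).2
  rw [rho_union f B hd]
  nlinarith [Int.natCast_nonneg (C.cross X S).card]

/-- A set `S` of least potential that breaks sparsity would be proper, hence colourable, and can be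
contracted. By minimality, sets through the new vertex have potential at least `F - L * j`, and sets
that avoid `S` have potential at least `0`, so the contracted graph is sparse. -/
theorem rho_lt_of_not_col_maxWeight {F L B : ℤ} {i j : ℕ} (hij : i + 2 ≤ j) (hL : 0 < L)
    (hFB : F + L ≤ 2 * B) (h2L : 2 * L ≤ B) (hσ : F ≤ L * j) (hF : F ≤ B + L * i)
    (hC : ¬ C.Col) (hcrit : ∀ S ⊂ C.V, (C.restrict S).Col) :
    C.rho (maxWeight F L i j) B C.V < F - L * j - L + 1 := by
  by_contra! hV
  have hne : C.V.Nonempty := by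
    by_contra h
    rw [Finset.not_nonempty_iff_eq_empty] at h
    exact hC ⟨fun _ => true, by simp [IsCol, h]⟩
  obtain ⟨S, hS, hSne, hmin, hmax⟩ := exists_min_rho (C := C) (maxWeight F L i j) B hne
  refine hC ?_
  by_cases hτ : F - L * j - L + 1 ≤ C.rho (maxWeight F L i j) B S
  · exact col_of_sparse_maxWeight hij hL hFB h2L hσ hF
      fun T hT hTne => hτ.trans (hmin T hT hTne)
  · have hSV : S ⊂ C.V := hS.ssubset_of_ne fun h => hτ (h ▸ hV)
    have h3 : ∀ X ⊆ C.V \ S, 0 ≤ C.rho (maxWeight F L i j) B (X ∪ S) -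
        C.rho (maxWeight F L i j) B S := fun X hX =>
      sub_nonneg.2 (hmin _ (Finset.union_subset (hX.trans Finset.sdiff_subset) hS)
        (hSne.mono Finset.subset_union_right))
    refine col_of_contract_rich (B := B) (f := maxWeight F L i j) (τ := F - L * j - L + 1) hSne
      (hcrit S hSV) ?_ ?_
      fun C' _ _ h => col_of_sparse_maxWeight hij hL hFB h2L hσ hF h
    · intro X hX
      rw [maxWeight_poor_zero hij]
      linarith [h3 X hX]
    · intro X hX _
      linarith [h3 X hX, rho_of_disjoint_min (f := maxWeight F L i j) (show 0 ≤ B by linarith) hX]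

/-! ### The case `j = i` -/

/-- Counting pairs of an edge and one of its ends. -/
lemma sum_incident {M : Type} [AddCommMonoid M] (W : β → α → M) :
    ∑ v ∈ C.V, ∑ e ∈ C.E.filter (C.Inc v), W e v =
      ∑ e ∈ C.E, (W e (C.fst e) + W e (C.snd e)) := by
  simp_rw [Finset.sum_filter]
  rw [Finset.sum_comm]
  refine Finset.sum_congr rfl fun e he => ?_
  have h : ∀ v, (if C.Inc v e then W e v else 0) =
      (if v = C.fst e then W e v else 0) + if v = C.snd e then W e v else 0 := by
    intro v
    have := C.fst_ne_snd e he
    unfold Inc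
    by_cases h1 : v = C.fst e
    · subst h1
      simp [this]
    · by_cases h2 : v = C.snd e
      · subst h2
        simp [h1]
      · simp [h1, h2, Ne.symm h1, Ne.symm h2]
  rw [Finset.sum_congr rfl fun v _ => h v, Finset.sum_add_distrib, Finset.sum_ite_eq',
    Finset.sum_ite_eq', if_pos (C.fst_mem e he), if_pos (C.snd_mem e he)]

lemma restrict_erase_V (v : α) : (C.restrict (C.V.erase v)).V = C.V.erase v := by
  simp [Finset.inter_eq_right.2 (Finset.erase_subset v C.V)]

lemma exists_not_active_update {v : α} {e : β} (he : e ∈ C.E) (hi : C.Inc v e) (ψ : α → Bool) :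
    ∃ κ, ¬ C.Active (Function.update ψ v κ) e := by
  obtain ⟨w, -, hwv, hw⟩ := hi.exists_other he
  refine ⟨ψ w ^^ !C.sgn e, ?_⟩
  unfold Active
  rcases hw with ⟨h1, h2⟩ | ⟨h1, h2⟩ <;> rw [h1, h2, Function.update_self,
    Function.update_of_ne hwv] <;> cases ψ w <;> cases C.sgn e <;> decide

lemma cross_singleton_erase (v : α) (_ : v ∈ C.V) :
    C.cross {v} (C.V.erase v) = C.E.filter (C.Inc v) := by
  ext e
  simp only [mem_cross, Finset.mem_filter, Finset.mem_singleton, Finset.mem_erase, Inc]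
  refine and_congr_right fun he => ?_
  have := C.fst_ne_snd e he
  have := C.fst_mem e he
  have := C.snd_mem e he
  grind

lemma deg_update_of_ne {v w : α} (hv : v ∈ C.V) (hw : w ∈ C.V.erase v) (ψ : α → Bool) (κ : Bool) :
    C.deg (Function.update ψ v κ) w = (C.restrict (C.V.erase v)).deg ψ w +
      ((C.E.filter (C.Inc v)).filter
        fun e => C.Inc w e ∧ C.Active (Function.update ψ v κ) e).card := by
  rw [deg_glue (X := {v}) (U := C.V.erase v) (by rw [← Finset.insert_eq, Finset.insert_erase hv])
    (by simp) _ hw, cross_singleton_erase v hv]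
  congr 1
  refine deg_congr (fun x hx => ?_) w
  rw [restrict_erase_V] at hx
  exact Function.update_of_ne (Finset.ne_of_mem_erase hx) _ _

/-- A vertex of degree at most one can be coloured last. -/
lemma col_of_degree_le_one {v : α} (hv : v ∈ C.V) (hk : ∀ κ, 0 < C.slots v κ)
    (hdeg : (C.E.filter (C.Inc v)).card ≤ 1) (h : (C.restrict (C.V.erase v)).Col) : C.Col := by
  obtain ⟨ψ, hψ⟩ := h
  have : ∃ κ, ∀ e ∈ C.E.filter (C.Inc v), ¬ C.Active (Function.update ψ v κ) e := by
    rcases (C.E.filter (C.Inc v)).eq_empty_or_nonempty with h0 | ⟨e, he⟩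
    · exact ⟨true, by simp [h0]⟩
    · obtain ⟨he', hi⟩ := Finset.mem_filter.1 he
      obtain ⟨κ, hκ⟩ := exists_not_active_update he' hi ψ
      refine ⟨κ, fun e' he'' => ?_⟩
      rwa [Finset.card_le_one.1 hdeg e' he'' e he]
  obtain ⟨κ, hκ⟩ := this
  refine ⟨Function.update ψ v κ, fun w hw => ?_⟩
  by_cases hwv : w = v
  · subst hwv
    have : C.deg (Function.update ψ w κ) w = 0 := by
      rw [deg, Finset.card_eq_zero, Finset.filter_eq_empty_iff]
      exact fun e he h => hκ e (Finset.mem_filter.2 ⟨he, h.1⟩) h.2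
    rw [this]
    exact hk _
  · have hw' : w ∈ C.V.erase v := Finset.mem_erase.2 ⟨hwv, hw⟩
    rw [deg_update_of_ne hv hw', Function.update_of_ne hwv,
      Finset.card_eq_zero.2 (Finset.filter_eq_empty_iff.2 fun e he h => hκ e he h.2)]
    exact hψ w (by rwa [restrict_erase_V])

/-- A vertex of degree two can be coloured last if one of its neighbours gives up a slot. -/
lemma col_of_degree_two {v u : α} (hv : v ∈ C.V) (hk : ∀ κ, 1 < C.slots v κ) {e₁ e₂ : β}
    (he : C.E.filter (C.Inc v) = {e₁, e₂}) (hu : C.Inc u e₁)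
    (huv : u ≠ v) (h : ((C.restrict (C.V.erase v)).withSlots (C.decSlots {u})).Col) : C.Col := by
  obtain ⟨ψ, hψ⟩ := h
  have he₂ : e₂ ∈ C.E.filter (C.Inc v) := by simp [he]
  obtain ⟨he₂', hi⟩ := Finset.mem_filter.1 he₂
  have he₁ : e₁ ∈ C.E.filter (C.Inc v) := by simp [he]
  obtain ⟨he₁', hi₁⟩ := Finset.mem_filter.1 he₁
  -- The colour of `v` satisfies `e₂`. Only `e₁` may be violated; the second slot at `v` and the
  -- slot given up by `u` pay for it.
  obtain ⟨κ, hκ⟩ := exists_not_active_update he₂' hi ψ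
  have hact : ∀ e ∈ C.E.filter (C.Inc v), C.Active (Function.update ψ v κ) e → e = e₁ := by
    intro e he' ha
    rw [he] at he'
    simp only [Finset.mem_insert, Finset.mem_singleton] at he'
    rcases he' with h | h
    · exact h
    · exact absurd (h ▸ ha) hκ
  refine ⟨Function.update ψ v κ, fun w hw => ?_⟩
  by_cases hwv : w = v
  · subst hwv
    refine lt_of_le_of_lt ?_ (hk _)
    rw [deg]
    refine Finset.card_le_one.2 fun a ha b hb => ?_
    simp only [Finset.mem_filter] at ha hb
    rw [hact a (by simp [ha]) ha.2.2, hact b (by simp [hb]) hb.2.2]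
  · have hw' : w ∈ C.V.erase v := Finset.mem_erase.2 ⟨hwv, hw⟩
    have h1 : (C.restrict (C.V.erase v)).deg ψ w < C.decSlots {u} w (ψ w) :=
      hψ w (by change w ∈ (C.restrict (C.V.erase v)).V; rwa [restrict_erase_V])
    rw [deg_update_of_ne hv hw', Function.update_of_ne hwv]
    by_cases hwu : w = u
    · subst hwu
      rw [decSlots_of_mem (by simp)] at h1
      have : ((C.E.filter (C.Inc v)).filter
          fun e => C.Inc w e ∧ C.Active (Function.update ψ v κ) e).card ≤ 1 := by
        refine Finset.card_le_one.2 fun a ha b hb => ?_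
        rw [Finset.mem_filter] at ha hb
        rw [hact a ha.1 ha.2.2, hact b hb.1 hb.2.2]
      dsimp only at h1
      omega
    · rw [decSlots_of_notMem (by simpa using hwu)] at h1
      rw [Finset.card_eq_zero.2]
      · exact h1
      · rw [Finset.filter_eq_empty_iff]
        rintro e he' ⟨h2, h3⟩
        have := hact e he' h3
        subst this
        have := C.fst_ne_snd e he₁'
        unfold Inc at hi₁ hu h2
        grind

/-- The weight of a vertex with the same number of slots for both colours. -/
def balancedWeight (i : ℕ) (k : Bool → ℕ) : ℤ := 2 * (min (k false) (i + 1) : ℕ)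

/-- Complementing all colours violates the same edges. Hence for `j = i` a contracted vertex may
keep a slot of each colour. -/
lemma IsCol.flip {φ : α → Bool} (hC : ∀ v, C.slots v false = C.slots v true) (hφ : C.IsCol φ)
    (b : Bool) : C.IsCol fun v => φ v ^^ b := by
  intro v hv
  have h1 : C.deg (fun v => φ v ^^ b) v = C.deg φ v := by
    unfold deg Active
    congr 1
    refine Finset.filter_congr fun e _ => ?_
    have h : ∀ x y : Bool, ((x ^^ b) ^^ (y ^^ b)) = (x ^^ y) := by
      intro x y
      cases x <;> cases y <;> cases b <;> rfl
    rw [h]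
  have h2 : ∀ κ κ', C.slots v κ = C.slots v κ' := by
    intro κ κ'
    cases κ <;> cases κ' <;> simp [hC]
  rw [h1, h2 _ (φ v)]
  exact hφ v hv

lemma col_of_contract_balanced {f : (Bool → ℕ) → ℤ} {B τ : ℤ} {U : Finset α}
    (hC : ∀ v, C.slots v false = C.slots v true) (hne : U.Nonempty) (hU : (C.restrict U).Col)
    (h1 : ∀ X ⊆ C.V \ U, τ ≤ C.rho f B (X ∪ U) - C.rho f B U + f (fun _ => 1))
    (h2 : ∀ X ⊆ C.V \ U, X.Nonempty → τ ≤ C.rho f B X)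
    (h : ∀ C' : SignedGraph α β, C'.V.card + U.card = (C.V ∪ U).card + 1 → C'.E.card ≤ C.E.card →
      (∀ v, C'.slots v false = C'.slots v true) → C'.Sparse f B τ → C'.Col) : C.Col := by
  obtain ⟨φ, hφ⟩ := hU
  obtain ⟨t, ht⟩ := hne
  refine col_of_contract ht (φ := φ) (kt := fun _ => 1) ?_ (fun _ => le_rfl)
    (h _ ?_ (card_contract_E ht) ?_ (sparse_contract ht h1 h2))
  · exact fun κ _ => IsCol.flip (C := C.restrict U) hC hφ _
  · rw [contract_V, Finset.card_insert_of_notMem (by simp [ht]), ← Finset.union_sdiff_right,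
      Finset.card_sdiff_of_subset Finset.subset_union_right]
    have := Finset.card_le_card (Finset.subset_union_right (s₁ := C.V) (s₂ := U))
    omega
  · intro v
    by_cases hv : v = t <;> simp [contract_slots, hv, hC]

section Balanced

variable {i : ℕ}

lemma balancedWeight_one : balancedWeight i (fun _ => 1) = 2 := by
  simp [balancedWeight]

/-- If no proper set has small potential, all degrees are at least two, edges have a light end
except perhaps at vertices of degree three, then the potential is not positive. -/
lemma rho_nonpos_of_degrees (hdeg : ∀ v ∈ C.V, 2 ≤ (C.E.filter (C.Inc v)).card)
    (hTT : ∀ e ∈ C.E, C.slots (C.fst e) false ≤ 1 → C.slots (C.snd e) false ≤ 1 → False)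
    (hZ : ∀ v ∈ C.V, 1 < C.slots v false →
      (∀ e ∈ C.E, C.Inc v e → C.slots (C.fst e) false ≤ 1 ∨ C.slots (C.snd e) false ≤ 1) ∨
      (i = 1 ∧ 3 ≤ (C.E.filter (C.Inc v)).card)) :
    C.rho (balancedWeight i) (i + 2) C.V ≤ 0 := by
  -- Discharging: each edge distributes `2 * (i + 2)` to its ends. An end with at most one slot per
  -- colour receives `2`, the larger end opposite to it `2 * (i + 1)`, and two larger ends receive
  -- `i + 2` each. Every vertex must collect twice its weight.
  set W : β → α → ℤ := fun e v => if C.slots v false ≤ 1 then 2 else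
    if C.slots (C.fst e) false ≤ 1 ∨ C.slots (C.snd e) false ≤ 1 then 2 * (i + 1) else i + 2 with hW
  have hsum := sum_incident (C := C) W
  have h1 : ∑ e ∈ C.E, (W e (C.fst e) + W e (C.snd e)) = ∑ e ∈ C.E, (2 * ((i : ℤ) + 2)) := by
    refine Finset.sum_congr rfl fun e he => ?_
    have := hTT e he
    simp only [hW]
    by_cases ha : C.slots (C.fst e) false ≤ 1 <;> by_cases hb : C.slots (C.snd e) false ≤ 1
    · exact (this ha hb).elim
    · simp only [ha, hb, if_true, if_false, true_or]; ring
    · simp only [ha, hb, if_true, if_false, or_true]; ring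
    · simp only [ha, hb, if_false, or_self]; ring
  have h2 : ∑ v ∈ C.V, 2 * balancedWeight i (C.slots v) ≤
      ∑ v ∈ C.V, ∑ e ∈ C.E.filter (C.Inc v), W e v := by
    refine Finset.sum_le_sum fun v hv => ?_
    have hd := hdeg v hv
    have hd' : (2 : ℤ) ≤ (C.E.filter (C.Inc v)).card := by exact_mod_cast hd
    by_cases ha : C.slots v false ≤ 1
    · have h3 : ∑ e ∈ C.E.filter (C.Inc v), W e v = (C.E.filter (C.Inc v)).card * 2 := by
        simp [hW, ha]
      have h4 : balancedWeight i (C.slots v) ≤ 2 := by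
        unfold balancedWeight
        have : min (C.slots v false) (i + 1) ≤ 1 := by omega
        have : ((min (C.slots v false) (i + 1) : ℕ) : ℤ) ≤ 1 := by exact_mod_cast this
        linarith
      rw [h3]
      linarith
    · have h4 : balancedWeight i (C.slots v) ≤ 2 * (i + 1) := by
        unfold balancedWeight
        have : ((min (C.slots v false) (i + 1) : ℕ) : ℤ) ≤ ((i + 1 : ℕ) : ℤ) := by
          exact_mod_cast min_le_right _ _
        push_cast at this ⊢
        linarith
      rcases hZ v hv (by omega) with h | ⟨hi, h3⟩
      · have h3 : ∑ e ∈ C.E.filter (C.Inc v), W e v =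
            ∑ e ∈ C.E.filter (C.Inc v), (2 * ((i : ℤ) + 1)) := by
          refine Finset.sum_congr rfl fun e he => ?_
          obtain ⟨he, hi⟩ := Finset.mem_filter.1 he
          simp [hW, ha, h e he hi]
        rw [h3, Finset.sum_const, nsmul_eq_mul]
        nlinarith
      -- For `i = 1` each edge brings at least `3`, so three edges bring `9`, more than twice the
      -- maximal weight `4`.
      · have h5 : ∑ e ∈ C.E.filter (C.Inc v), (3 : ℤ) ≤ ∑ e ∈ C.E.filter (C.Inc v), W e v := by
          refine Finset.sum_le_sum fun e _ => ?_
          simp only [hW, ha, if_false, hi]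
          split_ifs <;> norm_num
        rw [Finset.sum_const, nsmul_eq_mul] at h5
        have h3' : (3 : ℤ) ≤ (C.E.filter (C.Inc v)).card := by exact_mod_cast h3
        subst hi
        push_cast at h4
        linarith
  rw [← Finset.mul_sum, hsum, h1, Finset.sum_const, nsmul_eq_mul] at h2
  rw [rho, inside_V]
  linarith

/-- Proper sets of potential at most `2`, the weight of a vertex with one slot per colour, are
contracted. Splitting an edge between vertices with two or more slots costs `4`, which `B = i + 2`
covers only for `i ≥ 2`. For `i = 1` an end of degree two of such an edge is coloured last instead.
Whatever remains is excluded by discharging. -/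
theorem col_of_sparse_balanced (hi : 1 ≤ i) (hbal : ∀ v, C.slots v false = C.slots v true)
    (hC : C.Sparse (balancedWeight i) (i + 2) 1) : C.Col := by
  induction hn : C.V.card + C.E.card using Nat.strong_induction_on generalizing C with
  | _ n ih =>
  subst hn
  set f := balancedWeight i with hf
  have hi' : (1 : ℤ) ≤ i := by exact_mod_cast hi
  have hB : (0 : ℤ) ≤ i + 2 := by linarith
  have hfle : ∀ v, C.slots v false ≤ 1 → f (C.slots v) ≤ 2 := by
    intro v hv
    rw [hf, balancedWeight]
    have : ((min (C.slots v false) (i + 1) : ℕ) : ℤ) ≤ 1 := by norm_cast; omega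
    linarith
  have hfge : ∀ v, 1 < C.slots v false → 4 ≤ f (C.slots v) := by
    intro v hv
    rw [hf, balancedWeight]
    have : (2 : ℤ) ≤ (min (C.slots v false) (i + 1) : ℕ) := by norm_cast; omega
    linarith
  have hfdec : ∀ v, f (C.slots v) - f (fun κ => C.slots v κ - 1) ≤ 2 := by
    intro v
    simp only [hf, balancedWeight]
    have : ((min (C.slots v false) (i + 1) : ℕ) : ℤ) ≤
      (min (C.slots v false - 1) (i + 1) : ℕ) + 1 := by norm_cast; omega
    linarith
  have h1 : ∀ v ∈ C.V, ∀ κ, 0 < C.slots v κ := by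
    intro v hv κ
    have h := hC {v} (by simpa using hv) (by simp)
    rw [rho_singleton, hf, balancedWeight] at h
    have h' : 0 < C.slots v false := by
      by_contra h0
      rw [show C.slots v false = 0 by omega] at h
      simp at h
    cases κ
    · exact h'
    · rw [← hbal]; exact h'
  by_cases hA : ∃ U ⊂ C.V, 2 ≤ U.card ∧ C.rho f (i + 2) U ≤ 2
  · obtain ⟨U, hU, hcard, hρ⟩ := hA
    have hne : U.Nonempty := Finset.card_pos.1 (by omega)
    refine col_of_contract_balanced (B := i + 2) (f := f) (τ := 1) hbal hne
      (ih _ (card_restrict_lt hU) hbal (hC.restrict U) rfl) ?_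
      (fun X hX => hC X (hX.trans Finset.sdiff_subset)) ?_
    · intro X hX
      have := hC (X ∪ U) (Finset.union_subset (hX.trans Finset.sdiff_subset) hU.1)
        (hne.mono Finset.subset_union_right)
      rw [hf, balancedWeight_one, ← hf]
      linarith
    · intro C' h1 h2 h3 h4
      rw [Finset.union_eq_left.2 hU.1] at h1
      exact ih _ (by omega) h3 h4 rfl
  push Not at hA
  have hends : ∀ e ∈ C.E, ({C.fst e, C.snd e} : Finset α) ⊆ C.V := by
    intro e he x hx
    simp only [Finset.mem_insert, Finset.mem_singleton] at hx
    rcases hx with rfl | rfl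
    exacts [C.fst_mem e he, C.snd_mem e he]
  have hone : ∀ S ⊂ C.V, ∀ v ∈ S, 1 < C.slots v false → 3 ≤ C.rho f (i + 2) S := by
    intro S hS v hv hk
    rcases Nat.lt_or_ge S.card 2 with hlt | hge
    · have : S.card = 1 := by
        have := Finset.card_pos.2 ⟨v, hv⟩
        omega
      obtain ⟨a, rfl⟩ := Finset.card_eq_one.1 this
      rw [rho_singleton, ← Finset.mem_singleton.1 hv]
      linarith [hfge v hk]
    · linarith [hA S hS hge]
  by_cases hd1 : ∃ v ∈ C.V, (C.E.filter (C.Inc v)).card ≤ 1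
  · obtain ⟨v, hv, hd⟩ := hd1
    exact col_of_degree_le_one hv (h1 v hv) hd
      (ih _ (card_restrict_lt (Finset.erase_ssubset hv)) hbal (hC.restrict _) rfl)
  push Not at hd1
  by_cases hsp : 2 ≤ i ∧ ∃ e ∈ C.E, 1 < C.slots (C.fst e) false ∧ 1 < C.slots (C.snd e) false
  · obtain ⟨hi2, e, he, ha, hb⟩ := hsp
    have hi2' : (2 : ℤ) ≤ i := by exact_mod_cast hi2
    refine col_of_split he (ih _ (card_split e he) (fun v => ?_) (sparse_split he hC (L := 2)
        (fun v _ => hfdec v) ?_ ?_) rfl)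
    · change C.decSlots _ v false = C.decSlots _ v true
      simp [decSlots, hbal]
    · rintro S hS (h | h) -
      · linarith [hone S hS _ h ha]
      · linarith [hone S hS _ h hb]
    · intro S hS h3 h4
      linarith [hC S hS ⟨_, h3⟩]
  by_cases hd2 : ∃ v ∈ C.V, 1 < C.slots v false ∧ (C.E.filter (C.Inc v)).card = 2 ∧
      ∃ e ∈ C.E, C.Inc v e ∧ 1 < C.slots (C.fst e) false ∧ 1 < C.slots (C.snd e) false
  · obtain ⟨v, hv, hvk, hcard, e, he, hinc, ha, hb⟩ := hd2
    obtain ⟨e₂, he₂⟩ : ∃ e₂, C.E.filter (C.Inc v) = {e, e₂} := by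
      obtain ⟨a, b, -, hab⟩ := Finset.card_eq_two.1 hcard
      have : e ∈ C.E.filter (C.Inc v) := by simp [he, hinc]
      rw [hab] at this
      simp only [Finset.mem_insert, Finset.mem_singleton] at this
      rcases this with rfl | rfl
      · exact ⟨b, hab⟩
      · exact ⟨a, by rw [hab, Finset.pair_comm]⟩
    obtain ⟨u, huV, huv, hu⟩ := hinc.exists_other he
    have huk : 1 < C.slots u false := by
      rcases hu with ⟨-, rfl⟩ | ⟨rfl, -⟩ <;> assumption
    refine col_of_degree_two hv (u := u) (fun κ => by cases κ <;> simp [← hbal, hvk]) he₂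
      (by rcases hu with ⟨-, h⟩ | ⟨h, -⟩ <;> simp [Inc, h]) huv (ih _ ?_ ?_ ?_ rfl)
    · exact card_restrict_lt (Finset.erase_ssubset hv)
    · intro w
      change C.decSlots _ w false = C.decSlots _ w true
      simp [decSlots, hbal]
    · intro S hS hne
      change S ⊆ (C.restrict (C.V.erase v)).V at hS
      rw [restrict_erase_V] at hS
      have hSV : S ⊂ C.V := hS.trans_ssubset (Finset.erase_ssubset hv)
      rw [rho_withSlots, rho_restrict _ _ hS]
      have hs : (C.restrict (C.V.erase v)).slots = C.slots := rfl
      rw [hs, sum_eq_of_support_pair huv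
        (fun w hw _ => by rw [decSlots_of_notMem (by simpa using hw), sub_self]),
        decSlots_of_mem (Finset.mem_singleton_self u)]
      rw [if_neg (show v ∉ S from fun h => Finset.notMem_erase v C.V (hS h))]
      split_ifs with huS
      · linarith [hone S hSV u huS huk, hfdec u]
      · linarith [hC S hSV.1 hne]
  rcases C.V.eq_empty_or_nonempty with hV | hV
  · exact ⟨fun _ => true, by simp [IsCol, hV]⟩
  exfalso
  have h3 := hC C.V subset_rfl hV
  refine absurd (rho_nonpos_of_degrees (i := i) (fun v hv => hd1 v hv) ?_ ?_) (not_le.2 h3)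
  · intro e he ha hb
    have h4 := rho_ends_le (C := C) f hB he
    have h5 := hfle _ ha
    have h6 := hfle _ hb
    -- If the two ends are all of `V`, the bound for proper sets is not available, but the minimum
    -- degree yields two parallel edges.
    rcases (hends e he).eq_or_ssubset with heq | hss
    · have hc2 : (C.E.filter (C.Inc (C.fst e))) ⊆ C.inside {C.fst e, C.snd e} := by
        rw [heq, inside_V]
        exact Finset.filter_subset _ _
      have h7 := rho_le_of_subset_inside (C := C) f hB hc2
      have h8 := hd1 _ (C.fst_mem e he)
      have h8' : (2 : ℤ) ≤ (C.E.filter (C.Inc (C.fst e))).card := by exact_mod_cast h8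
      rw [Finset.sum_pair (C.fst_ne_snd e he)] at h7
      have h9 := hC {C.fst e, C.snd e} (hends e he) (by simp)
      nlinarith
    · have := hA _ hss (by rw [Finset.card_pair (C.fst_ne_snd e he)])
      linarith
  · intro v hv hk
    by_cases h : ∀ e ∈ C.E, C.Inc v e → C.slots (C.fst e) false ≤ 1 ∨ C.slots (C.snd e) false ≤ 1
    · exact Or.inl h
    · push Not at h
      obtain ⟨e, he, hinc, ha, hb⟩ := h
      refine Or.inr ⟨?_, ?_⟩
      · by_contra hne
        exact hsp ⟨by omega, e, he, ha, hb⟩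
      · have h4 := hd1 v hv
        by_contra hlt
        exact hd2 ⟨v, hv, hk, by omega, e, he, hinc, ha, hb⟩

theorem rho_lt_of_not_col_balanced (hi : 1 ≤ i) (hbal : ∀ v, C.slots v false = C.slots v true)
    (hC : ¬ C.Col) (hcrit : ∀ S ⊂ C.V, (C.restrict S).Col) :
    C.rho (balancedWeight i) (i + 2) C.V < 1 := by
  by_contra! hV
  have hi' : (1 : ℤ) ≤ i := by exact_mod_cast hi
  have hne : C.V.Nonempty := by
    by_contra h
    rw [Finset.not_nonempty_iff_eq_empty] at h
    exact hC ⟨fun _ => true, by simp [IsCol, h]⟩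
  obtain ⟨S, hS, hSne, hmin, hmax⟩ := exists_min_rho (C := C) (balancedWeight i) (i + 2) hne
  refine hC ?_
  by_cases hτ : 1 ≤ C.rho (balancedWeight i) (i + 2) S
  · exact col_of_sparse_balanced hi hbal fun T hT hTne => hτ.trans (hmin T hT hTne)
  · have hSV : S ⊂ C.V := hS.ssubset_of_ne fun h => hτ (h ▸ hV)
    refine col_of_contract_balanced (B := i + 2) (f := balancedWeight i) (τ := 1) hbal hSne
      (hcrit S hSV) ?_ ?_ fun C' _ _ h h' => col_of_sparse_balanced hi h h'
    · intro X hX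
      rw [balancedWeight_one]
      linarith [hmin _ (Finset.union_subset (hX.trans Finset.sdiff_subset) hS)
        (hSne.mono Finset.subset_union_right)]
    -- Since `τ = 1` is positive, minimality of `S` gives only `0` here; its maximality among the
    -- sets of least potential supplies the missing unit.
    · intro X hX ⟨x, hx⟩
      have h4 := rho_of_disjoint_min (f := balancedWeight i) (show (0 : ℤ) ≤ i + 2 by linarith) hX
      have h5 := hmax (X ∪ S) (Finset.union_subset (hX.trans Finset.sdiff_subset) hS)
        (Finset.ssubset_iff_subset_ne.2 ⟨Finset.subset_union_right, fun h =>
          (Finset.mem_sdiff.1 (hX hx)).2 (h ▸ Finset.mem_union_left _ hx)⟩)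
      linarith

end Balanced

/-! ### The case `j = i + 1` -/

/-- The weight of a vertex in the case `j = i + 1`. -/
def nearWeight (i : ℕ) (k : Bool → ℕ) : ℤ :=
  2 * (i : ℤ) ^ 2 + 4 * (i : ℤ) + 1 -
    if k true = 0 then ((i : ℤ) + 1) ^ 2 + ((i : ℤ) + 1) * ((i + 1 - k false : ℕ) : ℤ)
    else (i : ℤ) * (((i + 1 - k false : ℕ) : ℤ) + ((i + 2 - k true : ℕ) : ℤ)) +
      ((max (i + 1 - k false) (i + 2 - k true) : ℕ) : ℤ)

section NearWeight

variable {i : ℕ}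

/-- Here `x` and `y` count missing slots. The weight keeps three prices low: `i + 1` for one slot,
`2 * i + 1` for a slot of each colour, and `(i + 1) ^ 2` for a whole colour. At `x = 0` this formula
would charge `(i + 1) * (i + 2)` for all rich slots, hence the separate value when none is left. -/
lemma nearWeight_eq (k : Bool → ℕ) (h : k true ≠ 0) {x y : ℕ} (hx : i + 1 - k false = x)
    (hy : i + 2 - k true = y) : nearWeight i k =
      2 * i ^ 2 + 4 * i + 1 - (i * (x + y) + max (x : ℤ) y) := by
  rw [nearWeight, if_neg h, hx, hy, Nat.cast_max]

lemma nearWeight_eq_of_rich_zero (k : Bool → ℕ) (h : k true = 0) {x : ℕ}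
    (hx : i + 1 - k false = x) : nearWeight i k =
      2 * i ^ 2 + 4 * i + 1 - (((i : ℤ) + 1) ^ 2 + (i + 1) * x) := by
  rw [nearWeight, if_pos h, hx]

/-- A vertex without slots has weight `2 * i ^ 2 + 4 * i + 1 - 2 * (i + 1) ^ 2 = -1`, just below the
threshold `0`. -/
lemma exists_slot_of_nearWeight_nonneg {k : Bool → ℕ} (h : 0 ≤ nearWeight i k) : ∃ κ, 0 < k κ := by
  by_contra! h0
  have h1 : k true = 0 := Nat.le_zero.1 (h0 true)
  have h2 : k false = 0 := Nat.le_zero.1 (h0 false)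
  rw [nearWeight_eq_of_rich_zero k h1 (x := i + 1) (by omega)] at h
  push_cast at h
  nlinarith

lemma nearWeight_le (k : Bool → ℕ) : nearWeight i k ≤ 2 * i ^ 2 + 4 * i + 1 := by
  unfold nearWeight
  split_ifs
  · have : (0 : ℤ) ≤ ((i : ℤ) + 1) ^ 2 + (i + 1) * (i + 1 - k false : ℕ) := by positivity
    linarith
  · have : (0 : ℤ) ≤ i * ((i + 1 - k false : ℕ) + (i + 2 - k true : ℕ)) +
      (max (i + 1 - k false) (i + 2 - k true) : ℕ) := by positivity
    linarith

/-- Losing a poor slot. -/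
lemma nearWeight_sub_le_poor {k k' : Bool → ℕ} (h1 : k' true = k true)
    (h2 : k false ≤ k' false + 1) : nearWeight i k - nearWeight i k' ≤ i + 1 := by
  obtain ⟨x, hx⟩ : ∃ x, i + 1 - k false = x := ⟨_, rfl⟩
  obtain ⟨x', hx'⟩ : ∃ x', i + 1 - k' false = x' := ⟨_, rfl⟩
  have hxx : (x' : ℤ) ≤ x + 1 := by norm_cast; omega
  have hi : (0 : ℤ) ≤ i := Int.natCast_nonneg _
  by_cases h0 : k true = 0
  · rw [nearWeight_eq_of_rich_zero k h0 hx, nearWeight_eq_of_rich_zero k' (h1.trans h0) hx']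
    nlinarith
  · obtain ⟨y, hy⟩ : ∃ y, i + 2 - k true = y := ⟨_, rfl⟩
    rw [nearWeight_eq k h0 hx hy, nearWeight_eq k' (h1 ▸ h0) hx' (by rw [h1, hy])]
    have : max (x' : ℤ) y ≤ max (x : ℤ) y + 1 := by omega
    nlinarith

/-- Losing a rich slot. -/
lemma nearWeight_sub_le_rich {k k' : Bool → ℕ} (h1 : k' false = k false)
    (h2 : k true ≤ k' true + 1) : nearWeight i k - nearWeight i k' ≤ i + 1 := by
  obtain ⟨x, hx⟩ : ∃ x, i + 1 - k false = x := ⟨_, rfl⟩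
  obtain ⟨y, hy⟩ : ∃ y, i + 2 - k true = y := ⟨_, rfl⟩
  obtain ⟨y', hy'⟩ : ∃ y', i + 2 - k' true = y' := ⟨_, rfl⟩
  have hi : (0 : ℤ) ≤ i := Int.natCast_nonneg _
  have hxi : (x : ℤ) ≤ i + 1 := by norm_cast; omega
  have hx0 : (0 : ℤ) ≤ x := Int.natCast_nonneg _
  by_cases h0' : k' true = 0
  · rw [nearWeight_eq_of_rich_zero k' h0' (by rw [h1, hx])]
    by_cases h0 : k true = 0
    · rw [nearWeight_eq_of_rich_zero k h0 hx]
      linarith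
    · rw [nearWeight_eq k h0 hx hy]
      have : (y : ℤ) = i + 1 := by norm_cast; omega
      rw [this]
      have : max (x : ℤ) (i + 1) = i + 1 := max_eq_right hxi
      rw [this]
      nlinarith
  · rw [nearWeight_eq k' h0' (by rw [h1, hx]) hy']
    by_cases h0 : k true = 0
    · rw [nearWeight_eq_of_rich_zero k h0 hx]
      have : (y' : ℤ) ≤ i + 1 := by norm_cast; omega
      have : max (x : ℤ) y' ≤ i + 1 := by omega
      nlinarith
    · rw [nearWeight_eq k h0 hx hy]
      have hyy : (y' : ℤ) ≤ y + 1 := by norm_cast; omega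
      have : max (x : ℤ) y' ≤ max (x : ℤ) y + 1 := by omega
      nlinarith

/-- Losing a slot of each colour. -/
lemma nearWeight_sub_le (k : Bool → ℕ) :
    nearWeight i k - nearWeight i (fun κ => k κ - 1) ≤ 2 * i + 1 := by
  obtain ⟨x, hx⟩ : ∃ x, i + 1 - k false = x := ⟨_, rfl⟩
  obtain ⟨y, hy⟩ : ∃ y, i + 2 - k true = y := ⟨_, rfl⟩
  obtain ⟨x', hx'⟩ : ∃ x', i + 1 - (k false - 1) = x' := ⟨_, rfl⟩
  obtain ⟨y', hy'⟩ : ∃ y', i + 2 - (k true - 1) = y' := ⟨_, rfl⟩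
  have hi : (0 : ℤ) ≤ i := Int.natCast_nonneg _
  have hxx : (x' : ℤ) ≤ x + 1 := by norm_cast; omega
  have hxi : (x : ℤ) ≤ i + 1 := by norm_cast; omega
  have hxi' : (x' : ℤ) ≤ i + 1 := by norm_cast; omega
  by_cases h1 : k true - 1 = 0
  · rw [nearWeight_eq_of_rich_zero (fun κ => k κ - 1) h1 hx']
    by_cases h0 : k true = 0
    · rw [nearWeight_eq_of_rich_zero k h0 hx]
      nlinarith
    · rw [nearWeight_eq k h0 hx hy]
      have : (y : ℤ) = i + 1 := by norm_cast; omega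
      rw [this, max_eq_right hxi]
      nlinarith
  · have h0 : k true ≠ 0 := by omega
    rw [nearWeight_eq (fun κ => k κ - 1) h1 hx' hy', nearWeight_eq k h0 hx hy]
    have hyy : (y' : ℤ) ≤ y + 1 := by norm_cast; omega
    have : max (x' : ℤ) y' ≤ max (x : ℤ) y + 1 := by omega
    nlinarith

/-- Losing all poor slots. -/
lemma nearWeight_sub_le_kill_poor {k k' : Bool → ℕ} (h1 : k' true = k true) :
    nearWeight i k - nearWeight i k' ≤ ((i : ℤ) + 1) ^ 2 := by
  obtain ⟨x, hx⟩ : ∃ x, i + 1 - k false = x := ⟨_, rfl⟩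
  obtain ⟨x', hx'⟩ : ∃ x', i + 1 - k' false = x' := ⟨_, rfl⟩
  have hxx : (x' : ℤ) ≤ i + 1 := by norm_cast; omega
  have hx0 : (0 : ℤ) ≤ x := Int.natCast_nonneg _
  have hi : (0 : ℤ) ≤ i := Int.natCast_nonneg _
  by_cases h0 : k true = 0
  · rw [nearWeight_eq_of_rich_zero k h0 hx, nearWeight_eq_of_rich_zero k' (h1.trans h0) hx']
    nlinarith
  · obtain ⟨y, hy⟩ : ∃ y, i + 2 - k true = y := ⟨_, rfl⟩
    rw [nearWeight_eq k h0 hx hy, nearWeight_eq k' (h1 ▸ h0) hx' (by rw [h1, hy])]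
    have : max (x' : ℤ) y ≤ max (x : ℤ) y + (i + 1) := by omega
    nlinarith

/-- Losing all rich slots. -/
lemma nearWeight_sub_le_kill_rich {k k' : Bool → ℕ} (h1 : k' false = k false) (h2 : k' true = 0) :
    nearWeight i k - nearWeight i k' ≤ ((i : ℤ) + 1) ^ 2 := by
  obtain ⟨x, hx⟩ : ∃ x, i + 1 - k false = x := ⟨_, rfl⟩
  have hx0 : (0 : ℤ) ≤ x := Int.natCast_nonneg _
  have hi : (0 : ℤ) ≤ i := Int.natCast_nonneg _
  rw [nearWeight_eq_of_rich_zero k' h2 (by rw [h1, hx])]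
  by_cases h0 : k true = 0
  · rw [nearWeight_eq_of_rich_zero k h0 hx]
    nlinarith
  · obtain ⟨y, hy⟩ : ∃ y, i + 2 - k true = y := ⟨_, rfl⟩
    have hy0 : (0 : ℤ) ≤ y := Int.natCast_nonneg _
    rw [nearWeight_eq k h0 hx hy]
    have : (x : ℤ) ≤ max (x : ℤ) y := le_max_left _ _
    nlinarith

end NearWeight

/-! ### Deleting a coloured set -/

lemma card_cross_eq_sum {X U : Finset α} (hd : Disjoint X U) :
    (C.cross X U).card = ∑ v ∈ X, (C.cross {v} U).card := by
  have hd' : ∀ a ∈ X, a ∉ U := fun a ha => Finset.disjoint_left.1 hd ha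
  rw [Finset.card_eq_sum_card_fiberwise (f := fun e => if C.fst e ∈ X then C.fst e else C.snd e)
    (t := X)]
  · refine Finset.sum_congr rfl fun v hv => ?_
    congr 1
    ext e
    simp only [mem_cross, Finset.mem_filter, Finset.mem_singleton]
    grind
  · intro e he
    have := mem_cross.1 he
    simp only
    grind

lemma card_active_add_card_active {U : Finset α} {v : α} (hv : v ∉ U) (φ : α → Bool) :
    ((C.cross {v} U).filter (C.Active fun w => if w ∈ U then φ w else false)).card +
      ((C.cross {v} U).filter (C.Active fun w => if w ∈ U then φ w else true)).card =
      (C.cross {v} U).card := by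
  rw [← Finset.card_filter_add_card_filter_not
    (s := C.cross {v} U) (C.Active fun w => if w ∈ U then φ w else false)]
  congr 2
  refine Finset.filter_congr fun e he => ?_
  obtain ⟨-, he⟩ := mem_cross.1 he
  simp only [Finset.mem_singleton] at he
  unfold Active
  rcases he with ⟨rfl, h⟩ | ⟨h, rfl⟩
  · simp only [hv, h, if_true, if_false]
    cases φ (C.snd e) <;> cases C.sgn e <;> decide
  · simp only [hv, h, if_true, if_false]
    cases φ (C.fst e) <;> cases C.sgn e <;> decide

/-- Each edge from `v` to `U` is violated by exactly one colour of `v`, so it forbids one colour, at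
a price of at most `(i + 1) ^ 2`. The colours are forbidden one after the other. -/
lemma nearWeight_killSlots {i : ℕ} {U : Finset α} {v : α} (hv : v ∉ U) (φ : α → Bool) :
    nearWeight i (C.slots v) - nearWeight i (C.killSlots U φ v) ≤
      ((i : ℤ) + 1) ^ 2 * (C.cross {v} U).card := by
  rw [← card_active_add_card_active hv φ]
  have key : ∀ κ, ((C.cross {v} U).filter (C.Active fun w => if w ∈ U then φ w else κ)).card = 0 ∧
      C.killSlots U φ v κ = C.slots v κ ∨
      1 ≤ ((C.cross {v} U).filter (C.Active fun w => if w ∈ U then φ w else κ)).card ∧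
      C.killSlots U φ v κ = 0 := by
    intro κ
    unfold killSlots
    split_ifs with h
    · obtain ⟨e, he, ha⟩ := h
      exact Or.inr ⟨Finset.card_pos.2 ⟨e, Finset.mem_filter.2 ⟨he, ha⟩⟩, rfl⟩
    · push Not at h
      exact Or.inl ⟨Finset.card_eq_zero.2 (Finset.filter_eq_empty_iff.2 h), rfl⟩
  set a := ((C.cross {v} U).filter (C.Active fun w => if w ∈ U then φ w else false)).card
  set b := ((C.cross {v} U).filter (C.Active fun w => if w ∈ U then φ w else true)).card
  have hi : (0 : ℤ) < ((i : ℤ) + 1) ^ 2 := by positivity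
  set k := C.slots v
  set k' := C.killSlots U φ v
  have h1 : nearWeight i k - nearWeight i (fun κ => if κ then k true else k' false) ≤
      ((i : ℤ) + 1) ^ 2 * a := by
    rcases key false with ⟨h0, h⟩ | ⟨h0, h⟩
    · have : (fun κ => if κ = true then k true else k' false) = k := by
        funext κ
        cases κ <;> simp [h]
      rw [this, sub_self]
      positivity
    · have h2 := nearWeight_sub_le_kill_poor (i := i) (k := k)
        (k' := fun κ => if κ then k true else k' false) (by simp)
      have h0' : (1 : ℤ) ≤ a := by exact_mod_cast h0
      nlinarith
  have h2 : nearWeight i (fun κ => if κ then k true else k' false) - nearWeight i k' ≤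
      ((i : ℤ) + 1) ^ 2 * b := by
    rcases key true with ⟨h0, h⟩ | ⟨h0, h⟩
    · have : (fun κ => if κ = true then k true else k' false) = k' := by
        funext κ
        cases κ <;> simp [h]
      rw [this, sub_self]
      positivity
    · have h2 := nearWeight_sub_le_kill_rich (i := i)
        (k := fun κ => if κ then k true else k' false) (k' := k') (by simp) h
      have h0' : (1 : ℤ) ≤ b := by exact_mod_cast h0
      nlinarith
  push_cast
  linarith

/-- Since `B = (i + 1) ^ 2 + i`, every edge of the cut returns `i` more than it costs. -/
lemma rho_kill {i : ℕ} {U X : Finset α} (hX : X ⊆ C.V \ U) (φ : α → Bool) :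
    C.rho (nearWeight i) (i ^ 2 + 3 * i + 1) (X ∪ U) - C.rho (nearWeight i) (i ^ 2 + 3 * i + 1) U +
      i * (C.cross X U).card ≤ (C.kill U φ).rho (nearWeight i) (i ^ 2 + 3 * i + 1) X := by
  have hd : Disjoint X U := Finset.disjoint_left.2 fun a ha => (Finset.mem_sdiff.1 (hX ha)).2
  unfold kill
  rw [rho_withSlots, rho_restrict _ _ hX, rho_union _ _ hd]
  have hs : (C.restrict (C.V \ U)).slots = C.slots := rfl
  rw [hs]
  have h1 : ∑ v ∈ X, (nearWeight i (C.slots v) - nearWeight i (C.killSlots U φ v)) ≤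
      ∑ v ∈ X, ((i : ℤ) + 1) ^ 2 * (C.cross {v} U).card :=
    Finset.sum_le_sum fun v hv => nearWeight_killSlots (Finset.mem_sdiff.1 (hX hv)).2 φ
  rw [← Finset.mul_sum, ← Nat.cast_sum, ← card_cross_eq_sum hd] at h1
  nlinarith

lemma card_kill_lt {U : Finset α} (hU : U ⊆ C.V) (hne : U.Nonempty) (φ : α → Bool) :
    (C.kill U φ).V.card + (C.kill U φ).E.card < C.V.card + C.E.card := by
  refine card_restrict_lt (C := C) (U := C.V \ U) (Finset.sdiff_ssubset hU hne)

lemma mem_kill_V {U X : Finset α} {φ : α → Bool} (h : X ⊆ (C.kill U φ).V) : X ⊆ C.V \ U :=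
  fun _ ha => (Finset.mem_inter.1 (h ha)).2

/-- One slot less for the colour `κ` at the vertex `u`. -/
def decAt (C : SignedGraph α β) (u : α) (κ : Bool) (v : α) (κ' : Bool) : ℕ :=
  if v = u ∧ κ' = κ then C.slots v κ' - 1 else C.slots v κ'

lemma decAt_le (u : α) (κ : Bool) (v : α) (κ' : Bool) : C.decAt u κ v κ' ≤ C.slots v κ' := by
  unfold decAt
  split_ifs <;> omega

lemma decAt_of_ne {u v : α} (h : v ≠ u) (κ : Bool) : C.decAt u κ v = C.slots v := by
  funext κ'
  simp [decAt, h]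

lemma nearWeight_decAt {i : ℕ} (u : α) (κ : Bool) :
    nearWeight i (C.slots u) - nearWeight i (C.decAt u κ u) ≤ i + 1 := by
  cases κ
  · refine nearWeight_sub_le_poor ?_ ?_
    · simp [decAt]
    · simp [decAt]
      omega
  · refine nearWeight_sub_le_rich ?_ ?_
    · simp [decAt]
    · simp [decAt]
      omega

lemma sparse_decAt {i : ℕ} {B : ℤ} (h : C.Sparse (nearWeight i) B 0)
    {u : α} (hu : ∀ S ⊆ C.V, u ∈ S → (i : ℤ) + 1 ≤ C.rho (nearWeight i) B S) (κ : Bool) :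
    (C.withSlots (C.decAt u κ)).Sparse (nearWeight i) B 0 := by
  intro S hS hne
  rw [rho_withSlots]
  have h1 : ∑ v ∈ S, (nearWeight i (C.slots v) - nearWeight i (C.decAt u κ v)) =
      if u ∈ S then nearWeight i (C.slots u) - nearWeight i (C.decAt u κ u) else 0 := by
    rw [← Finset.sum_ite_eq' S u (fun v => nearWeight i (C.slots v) - nearWeight i (C.decAt u κ v))]
    refine Finset.sum_congr rfl fun v _ => ?_
    split_ifs with hv
    · rw [hv]
    · rw [decAt_of_ne hv, sub_self]
  rw [h1]
  split_ifs with hm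
  · linarith [hu S hS hm, nearWeight_decAt (C := C) (i := i) u κ]
  · linarith [h S hS hne]

/-- Colourings of the two sides of a bridge combine if the bridge is paid for. -/
lemma col_of_bridge {X U : Finset α} (hV : C.V = X ∪ U) (hd : Disjoint X U) {e : β}
    (he : C.cross X U = {e}) {φ ψ : α → Bool}
    (hX : (C.restrict X).IsCol ψ) (hU : (C.restrict U).IsCol φ)
    (hact : C.Active (fun w => if w ∈ U then φ w else ψ w) e →
      (∀ v ∈ U, C.Inc v e → (C.restrict U).deg φ v + 1 < C.slots v (φ v)) ∧
      ∀ v ∈ X, C.Inc v e → (C.restrict X).deg ψ v + 1 < C.slots v (ψ v)) : C.Col := by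
  set Φ : α → Bool := fun w => if w ∈ U then φ w else ψ w with hΦ
  have hc : ∀ v, ((C.cross X U).filter fun e => C.Inc v e ∧ C.Active Φ e).card =
      if C.Inc v e ∧ C.Active Φ e then 1 else 0 := by
    intro v
    rw [he, Finset.filter_singleton]
    split_ifs <;> simp
  refine ⟨Φ, fun v hv => ?_⟩
  rw [hV, Finset.mem_union] at hv
  by_cases hvU : v ∈ U
  · rw [deg_glue hV hd Φ hvU, hc]
    have h1 : (C.restrict U).deg Φ v = (C.restrict U).deg φ v :=
      deg_congr (fun w hw => by simp [hΦ, (Finset.mem_inter.1 hw).2]) v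
    have h2 : Φ v = φ v := by simp [hΦ, hvU]
    rw [h1, h2]
    split_ifs with h
    · exact (hact h.2).1 v hvU h.1
    · exact hU v (by simp [hV, hvU])
  · have hvX : v ∈ X := hv.resolve_right hvU
    rw [deg_glue (hV.trans (Finset.union_comm _ _)) hd.symm Φ hvX, cross_comm, hc]
    have h1 : (C.restrict X).deg Φ v = (C.restrict X).deg ψ v :=
      deg_congr (fun w hw => by
        have : w ∉ U := Finset.disjoint_left.1 hd (Finset.mem_inter.1 hw).2
        simp [hΦ, this]) v
    have h2 : Φ v = ψ v := by simp [hΦ, hvU]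
    rw [h1, h2]
    split_ifs with h
    · exact (hact h.2).2 v hvX h.1
    · exact hX v (by simp [hV, hvX])

lemma IsCol.of_withSlots {k : α → Bool → ℕ} {φ : α → Bool} (h : (C.withSlots k).IsCol φ)
    (hk : ∀ v κ, k v κ ≤ C.slots v κ) : C.IsCol φ :=
  fun v hv => (h v hv).trans_le (hk v _)

/-! ### Colouring sparse signed graphs for `j = i + 1` -/

section Near

variable {i : ℕ}

/-- A sparse signed graph all of whose proper sets have potential above `i` has no bridge, if
smaller sparse signed graphs can be coloured. -/
lemma col_of_card_cross_eq_one (hC : C.Sparse (nearWeight i) (i ^ 2 + 3 * i + 1) 0)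
    (ih : ∀ C' : SignedGraph α β, C'.V.card + C'.E.card < C.V.card + C.E.card →
      C'.Sparse (nearWeight i) (i ^ 2 + 3 * i + 1) 0 → C'.Col)
    (hgap : ∀ S ⊂ C.V, S.Nonempty →
      (i : ℤ) + 1 ≤ C.rho (nearWeight i) (i ^ 2 + 3 * i + 1) S)
    {U : Finset α} (hU : U ⊂ C.V) (hne : U.Nonempty) (h1 : (C.cross (C.V \ U) U).card = 1) :
    C.Col := by
  obtain ⟨e, he⟩ := Finset.card_eq_one.1 h1
  have heE : e ∈ C.E ∧ ((C.fst e ∈ C.V \ U ∧ C.snd e ∈ U) ∨ (C.fst e ∈ U ∧ C.snd e ∈ C.V \ U)) :=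
    mem_cross.1 (by rw [he]; simp)
  set X := C.V \ U with hXdef
  have hX : X ⊂ C.V := Finset.sdiff_ssubset hU.1 hne
  have hVXU : C.V = X ∪ U := (Finset.sdiff_union_of_subset hU.1).symm
  have hd : Disjoint X U := Finset.sdiff_disjoint
  obtain ⟨u, hu, x, hx, hux⟩ : ∃ u ∈ U, ∃ x ∈ X,
      (C.fst e = u ∧ C.snd e = x) ∨ (C.fst e = x ∧ C.snd e = u) := by
    rcases heE.2 with ⟨h, h'⟩ | ⟨h, h'⟩
    · exact ⟨_, h', _, h, Or.inr ⟨rfl, rfl⟩⟩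
    · exact ⟨_, h, _, h', Or.inl ⟨rfl, rfl⟩⟩
  have hincU : ∀ v ∈ U, C.Inc v e → v = u := by
    intro v hv hi
    have : x ∉ U := Finset.disjoint_left.1 hd hx
    rcases hux with ⟨h, h'⟩ | ⟨h, h'⟩ <;> rcases hi with rfl | rfl <;> grind
  have hincX : ∀ v ∈ X, C.Inc v e → v = x := by
    intro v hv hi
    have : v ∉ U := Finset.disjoint_left.1 hd hv
    rcases hux with ⟨h, h'⟩ | ⟨h, h'⟩ <;> rcases hi with rfl | rfl <;> grind
  -- The gap `i + 1` pays for one slot of one colour at one vertex.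
  have hcolS : ∀ S ⊂ C.V, ∀ w ∈ S, ∀ κ,
      ∃ φ, ((C.restrict S).withSlots (C.decAt w κ)).IsCol φ := by
    intro S hS w hw κ
    refine ih _ (card_restrict_lt hS) ?_
    refine sparse_decAt (C := C.restrict S) (hC.restrict S) (fun T hT hwT => ?_) κ
    have hTS : T ⊆ S := hT.trans Finset.inter_subset_right
    rw [rho_restrict _ _ hTS]
    exact hgap T (hTS.trans_ssubset hS) ⟨w, hwT⟩
  have hdec : ∀ S, ∀ w ∈ S, ∀ κ φ, S ⊂ C.V →
      ((C.restrict S).withSlots (C.decAt w κ)).IsCol φ →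
      (C.restrict S).IsCol φ ∧ (φ w = κ → (C.restrict S).deg φ w + 1 < C.slots w κ) := by
    intro S w hw κ φ hS hφ
    refine ⟨IsCol.of_withSlots hφ (decAt_le w κ), fun hκ => ?_⟩
    have h : (C.restrict S).deg φ w < C.decAt w κ w (φ w) :=
      hφ w (by change w ∈ C.V ∩ S; exact Finset.mem_inter.2 ⟨hS.1 hw, hw⟩)
    simp only [decAt, hκ, and_self, if_true] at h
    omega
  -- the violation of the bridge depends on the colours of its ends only
  have hact : ∀ φ ψ : α → Bool, C.Active (fun w => if w ∈ U then φ w else ψ w) e ↔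
      (φ u ^^ ψ x) = C.sgn e := by
    intro φ ψ
    have : x ∉ U := Finset.disjoint_left.1 hd hx
    unfold Active
    rcases hux with ⟨h, h'⟩ | ⟨h, h'⟩ <;> simp [h, h', hu, this, Bool.xor_comm]
  -- Suppose `u` has a slot to spare. On the other side a slot is reserved for the colour of `x`
  -- that violates the bridge: if `x` takes it, both ends can afford the violation, and otherwise
  -- the bridge is satisfied.
  have spare : ∀ κ φ, ((C.restrict U).withSlots (C.decAt u κ)).IsCol φ → φ u = κ → C.Col := by
    intro κ φ hφ hκ
    obtain ⟨h2, h3⟩ := hdec U u hu κ φ hU hφ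
    obtain ⟨ψ, hψ⟩ := hcolS X hX x hx (κ ^^ C.sgn e)
    obtain ⟨h4, h5⟩ := hdec X x hx _ ψ hX hψ
    refine col_of_bridge hVXU hd he h4 h2 fun ha => ?_
    rw [hact, hκ] at ha
    have hψx : ψ x = (κ ^^ C.sgn e) := by
      rw [← ha]
      cases κ <;> simp
    refine ⟨fun v hv hi => ?_, fun v hv hi => ?_⟩
    · rw [hincU v hv hi, hκ]
      exact h3 hκ
    · rw [hincX v hv hi, hψx]
      exact h5 hψx
  obtain ⟨φ₀, hφ₀⟩ := hcolS U hU u hu false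
  obtain ⟨φ₁, hφ₁⟩ := hcolS U hU u hu true
  by_cases h₀ : φ₀ u = false
  · exact spare _ _ hφ₀ h₀
  by_cases h₁ : φ₁ u = true
  · exact spare _ _ hφ₁ h₁
  -- Now `u` is rich in `φ₀` and poor in `φ₁`, so one of the two satisfies the bridge whatever the
  -- colour of `x`.
  obtain ⟨ψ, hψ⟩ := ih _ (card_restrict_lt hX) (hC.restrict X)
  have hex : ∃ φ, (C.restrict U).IsCol φ ∧ (φ u ^^ ψ x) ≠ C.sgn e := by
    by_cases hs : (φ₀ u ^^ ψ x) = C.sgn e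
    · refine ⟨φ₁, (hdec U u hu _ φ₁ hU hφ₁).1, ?_⟩
      rw [← hs]
      simp only [Bool.not_eq_true, Bool.not_eq_false] at h₀ h₁
      rw [h₀, h₁]
      cases ψ x <;> decide
    · exact ⟨φ₀, (hdec U u hu _ φ₀ hU hφ₀).1, hs⟩
  obtain ⟨φ, hφ, hne'⟩ := hex
  exact col_of_bridge hVXU hd he hψ hφ fun ha => absurd ((hact φ ψ).1 ha) hne'

lemma col_of_no_edges (hC : C.Sparse (nearWeight i) (i ^ 2 + 3 * i + 1) 0) (hE : C.E = ∅) :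
    C.Col := by
  have h : ∀ v, ∃ κ, v ∈ C.V → 0 < C.slots v κ := by
    intro v
    by_cases hv : v ∈ C.V
    · have h := hC {v} (by simpa using hv) (by simp)
      rw [rho_singleton] at h
      obtain ⟨κ, hκ⟩ := exists_slot_of_nearWeight_nonneg h
      exact ⟨κ, fun _ => hκ⟩
    · exact ⟨true, fun h => absurd h hv⟩
  choose φ hφ using h
  exact ⟨φ, isCol_of_forall_not_active (by simp [hE]) hφ⟩

/-- The case `(i, j) = (1, 2)`: an edge at a vertex with one poor slot and at least three rich
slots may be deleted. -/
lemma col_of_force_rich (hC : C.Sparse (nearWeight 1) 5 0)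
    (ih : ∀ C' : SignedGraph α β, C'.V.card + C'.E.card < C.V.card + C.E.card →
      C'.Sparse (nearWeight 1) 5 0 → C'.Col)
    (hgap : ∀ S ⊂ C.V, S.Nonempty → 3 ≤ C.rho (nearWeight 1) 5 S)
    {v : α} {e : β} (he : e ∈ C.E) (hi : C.Inc v e) (hp : C.slots v false = 1)
    (hr : 3 ≤ C.slots v true) : C.Col := by
  obtain ⟨u, huV, huv, hu⟩ := hi.exists_other he
  -- Without its only poor slot `v` is rich, so only the colour `!C.sgn e` of `u` violates `e`, and
  -- `u` need give up a slot of that colour alone. The costs `3` at `v` and `2` at `u` add up to `B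
  -- = 5`.
  set k : α → Bool → ℕ := fun w κ => if w = v then (if κ then C.slots v true - 1 else 0) else
    C.decAt u (!C.sgn e) w κ with hk
  have hkv : k v = fun κ => if κ then C.slots v true - 1 else 0 := by
    funext κ
    simp [hk]
  have hkw : ∀ w, w ≠ v → k w = C.decAt u (!C.sgn e) w := by
    intro w hw
    funext κ
    simp [hk, hw]
  refine col_of_eraseEdge he (k := k) ?_ ?_ (ih _ ?_ ?_)
  · intro w κ
    by_cases hw : w = v
    · subst hw
      rw [hkv]
      cases κ <;> simp
    · rw [hkw w hw]
      exact decAt_le _ _ _ _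
  · intro φ h1 ha w hw
    have hφv : φ v = true := by
      have := h1 v hi
      rw [hkv] at this
      by_contra hcon
      simp [hcon] at this
    by_cases hwv : w = v
    · subst hwv
      rw [hkv, hφv]
      exact (Nat.sub_add_cancel (by omega)).le
    · have hwu : w = u := by
        rcases hu with ⟨h, h'⟩ | ⟨h, h'⟩ <;> rcases hw with rfl | rfl <;> grind
      subst hwu
      have hφw : φ w = !C.sgn e := by
        unfold Active at ha
        rcases hu with ⟨h, h'⟩ | ⟨h, h'⟩ <;> rw [h, h', hφv] at ha <;> rw [← ha] <;>
          cases φ w <;> rfl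
      have h2 := h1 w hw
      rw [hkw w hwv, hφw] at h2 ⊢
      simp only [decAt, and_self, if_true] at h2 ⊢
      omega
  · have : (C.E.erase e).card < C.E.card := Finset.card_erase_lt_of_mem he
    simpa using this
  · have hlv : nearWeight 1 (C.slots v) - nearWeight 1 (k v) ≤ 3 := by
      rw [hkv, nearWeight_eq (i := 1) (C.slots v) (by omega) (x := 1) (y := 0) (by omega)
        (by omega)]
      by_cases h3 : C.slots v true = 3
      · rw [nearWeight_eq (i := 1) _ (by simp; omega) (x := 2) (y := 1) (by simp) (by simp; omega)]
        norm_num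
      · rw [nearWeight_eq (i := 1) _ (by simp; omega) (x := 2) (y := 0) (by simp) (by simp; omega)]
        norm_num
    have hlu : nearWeight 1 (C.slots u) - nearWeight 1 (k u) ≤ 2 := by
      rw [hkw u huv]
      have := nearWeight_decAt (C := C) (i := 1) u (!C.sgn e)
      push_cast at this
      linarith
    have hko : ∀ w, w ≠ v → w ≠ u → k w = C.slots w := by
      intro w hw hw'
      rw [hkw w hw, decAt_of_ne hw']
    intro S hS hne
    have hS' : S ⊆ C.V := hS
    have h0 := hC S hS' hne
    have hvV : v ∈ C.V := by
      rcases hi with rfl | rfl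
      exacts [C.fst_mem e he, C.snd_mem e he]
    rw [rho_withSlots, rho_eraseEdge _ _ he]
    have hs : (C.eraseEdge e).slots = C.slots := rfl
    rw [hs, sum_eq_of_support_pair (Ne.symm huv)
      (fun w h1 h2 => by rw [hko w h1 h2, sub_self])]
    have hin : (C.fst e ∈ S ∧ C.snd e ∈ S) ↔ v ∈ S ∧ u ∈ S := by
      rcases hu with ⟨h, h'⟩ | ⟨h, h'⟩ <;> rw [h, h']
      exact and_comm
    simp only [hin]
    by_cases h5 : v ∈ S <;> by_cases h6 : u ∈ S <;>
      simp only [h5, h6, and_true, and_false, if_true, if_false]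
    · linarith
    · have hss : S ⊂ C.V := hS'.ssubset_of_ne fun h => h6 (h ▸ huV)
      linarith [hgap S hss hne]
    · have hss : S ⊂ C.V := hS'.ssubset_of_ne fun h => h5 (h ▸ hvV)
      linarith [hgap S hss hne]
    · linarith

/-- The case `(i, j) = (1, 2)`, once all proper sets have potential at least three. -/
lemma col_of_gap_one_two (hC : C.Sparse (nearWeight 1) 5 0)
    (ih : ∀ C' : SignedGraph α β, C'.V.card + C'.E.card < C.V.card + C.E.card →
      C'.Sparse (nearWeight 1) 5 0 → C'.Col)
    (hgap : ∀ S ⊂ C.V, S.Nonempty → 3 ≤ C.rho (nearWeight 1) 5 S)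
    (hbridge : ∀ U ⊂ C.V, U.Nonempty → (C.cross (C.V \ U) U).card = 1 → C.Col) : C.Col := by
  by_contra hcol
  have hB5 : (((1 : ℕ) : ℤ) ^ 2 + 3 * ((1 : ℕ) : ℤ) + 1) = 5 := by norm_num
  have hE : C.E.Nonempty := by
    by_contra h
    exact hcol (col_of_no_edges (i := 1) (by rw [hB5]; exact hC)
      (Finset.not_nonempty_iff_eq_empty.1 h))
  obtain ⟨e₀, he₀⟩ := hE
  have hV : C.V.Nonempty := ⟨_, C.fst_mem e₀ he₀⟩
  -- Splitting costs `6` and returns `5`; a positive potential of `V` would make up the difference.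
  have hρ : C.rho (nearWeight 1) 5 C.V ≤ 0 := by
    by_contra! h
    refine hcol (col_of_split he₀ (ih _ (card_split e₀ he₀) (sparse_split he₀ hC (L := 3)
      (fun v _ => by simpa using nearWeight_sub_le (i := 1) (C.slots v)) ?_ ?_)))
    · rintro S hS (h' | h') -
      · linarith [hgap S hS ⟨_, h'⟩]
      · linarith [hgap S hS ⟨_, h'⟩]
    · intro S hS h3 h4
      rcases hS.eq_or_ssubset with rfl | hss
      · linarith
      · linarith [hgap S hss ⟨_, h3⟩]
  -- If twice the weight of every vertex is less than five times its degree, summation makes the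
  -- potential of `V` negative. A vertex that fails this has degree two, by `hρ`, the gap and the
  -- absence of bridges.
  have hlt : ∑ v ∈ C.V, (2 * nearWeight 1 (C.slots v)) <
      ∑ v ∈ C.V, ∑ e ∈ C.E.filter (C.Inc v), (5 : ℤ) := by
    refine Finset.sum_lt_sum_of_nonempty hV fun v hv => ?_
    rw [Finset.sum_const, nsmul_eq_mul]
    by_contra! hle
    have hU : C.V.erase v ⊂ C.V := Finset.erase_ssubset hv
    have hVU : C.V = {v} ∪ C.V.erase v := by rw [← Finset.insert_eq, Finset.insert_erase hv]
    have hUne : (C.V.erase v).Nonempty := by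
      by_contra h
      rw [Finset.not_nonempty_iff_eq_empty] at h
      have h1 := C.fst_mem e₀ he₀
      have h2 := C.snd_mem e₀ he₀
      have h3 := C.fst_ne_snd e₀ he₀
      rw [hVU, h] at h1 h2
      simp only [Finset.union_empty, Finset.mem_singleton] at h1 h2
      exact h3 (h1.trans h2.symm)
    have hfv : 3 ≤ nearWeight 1 (C.slots v) := by
      rw [← rho_singleton (C := C) (nearWeight 1) 5]
      refine hgap _ ?_ (by simp)
      refine Finset.ssubset_iff_subset_ne.2 ⟨by simpa using hv, fun h => ?_⟩
      rw [← h] at hUne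
      simp at hUne
    have hcr := cross_singleton_erase (C := C) v hv
    have hρV := rho_union (C := C) (nearWeight 1) 5 (X := {v}) (U := C.V.erase v) (by simp)
    rw [← hVU, rho_singleton, hcr] at hρV
    have hUρ := hgap _ hU hUne
    have hF := nearWeight_le (i := 1) (C.slots v)
    push_cast at hF
    have hd : (C.E.filter (C.Inc v)).card = 2 := by
      have h3 : (C.E.filter (C.Inc v)).card < 3 := by
        by_contra! h
        have : (3 : ℤ) ≤ (C.E.filter (C.Inc v)).card := by exact_mod_cast h
        linarith
      interval_cases h : (C.E.filter (C.Inc v)).card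
      · push_cast at hρV
        linarith
      · refine absurd (hbridge _ hU hUne ?_) hcol
        have : C.V \ C.V.erase v = {v} := by
          ext w
          simp only [Finset.mem_sdiff, Finset.mem_erase, Finset.mem_singleton]
          grind
        rw [this, hcr, h]
      · rfl
    rw [hd] at hle
    push_cast at hle
    obtain ⟨e₁, e₂, -, he⟩ := Finset.card_eq_two.1 hd
    have he₁ : e₁ ∈ C.E.filter (C.Inc v) := by simp [he]
    obtain ⟨he₁, hi⟩ := Finset.mem_filter.1 he₁
    have hr0 : C.slots v true ≠ 0 := by
      intro h0
      rw [nearWeight_eq_of_rich_zero (i := 1) _ h0 rfl] at hle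
      push_cast at hle
      have : (0 : ℤ) ≤ ((2 - C.slots v false : ℕ) : ℤ) := Int.natCast_nonneg _
      linarith
    obtain ⟨x, hx⟩ : ∃ x, 1 + 1 - C.slots v false = x := ⟨_, rfl⟩
    obtain ⟨y, hy⟩ : ∃ y, 1 + 2 - C.slots v true = y := ⟨_, rfl⟩
    rw [nearWeight_eq (i := 1) _ hr0 hx hy] at hle
    push_cast at hle
    -- So at most one slot is missing. If it is the poor one, `col_of_force_rich` applies; otherwise
    -- both colours keep two slots and `v` can be coloured last.
    have hxy : x + y + max x y ≤ 2 := by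
      zify
      linarith
    by_cases hp : C.slots v false = 1 ∧ 3 ≤ C.slots v true
    · exact hcol (col_of_force_rich hC ih hgap he₁ hi hp.1 hp.2)
    obtain ⟨u, huV, huv, hu⟩ := hi.exists_other he₁
    refine hcol (col_of_degree_two hv (u := u) (fun κ => ?_) he
      (by rcases hu with ⟨-, h⟩ | ⟨h, -⟩ <;> simp [Inc, h]) huv (ih _ ?_ ?_))
    · cases κ <;> omega
    · exact card_restrict_lt hU
    · intro S hS hne
      change S ⊆ (C.restrict (C.V.erase v)).V at hS
      rw [restrict_erase_V] at hS
      have hSV : S ⊂ C.V := hS.trans_ssubset hU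
      rw [rho_withSlots, rho_restrict _ _ hS]
      have hs : (C.restrict (C.V.erase v)).slots = C.slots := rfl
      rw [hs, sum_eq_of_support_pair huv
        (fun w hw _ => by rw [decSlots_of_notMem (by simpa using hw), sub_self]),
        decSlots_of_mem (Finset.mem_singleton_self u)]
      rw [if_neg (show v ∉ S from fun h => Finset.notMem_erase v C.V (hS h))]
      have h3 := hgap S hSV hne
      have h4 := nearWeight_sub_le (i := 1) (C.slots u)
      push_cast at h4
      split_ifs with huS <;> linarith
  rw [sum_incident (C := C) fun _ _ => (5 : ℤ), Finset.sum_const, nsmul_eq_mul,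
    ← Finset.mul_sum] at hlt
  have h0 := hC C.V subset_rfl hV
  rw [rho, inside_V] at hρ h0
  linarith

/-- The lower bound for proper sets is raised in two steps. Deleting a coloured set gains `i` per
edge of the cut, which excludes potentials up to `i`. This gap excludes bridges, and two edges in
the cut then exclude potentials up to `2 * i`. With the gap `2 * i + 1` any edge can be split if `2
* (2 * i + 1) ≤ i ^ 2 + 3 * i + 1`, that is, for `i ≥ 2`. -/
theorem col_of_sparse_near (hi : 1 ≤ i) (hC : C.Sparse (nearWeight i) (i ^ 2 + 3 * i + 1) 0) :
    C.Col := by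
  induction hn : C.V.card + C.E.card using Nat.strong_induction_on generalizing C with
  | _ n ih =>
  subst hn
  have ih' : ∀ C' : SignedGraph α β, C'.V.card + C'.E.card < C.V.card + C.E.card →
      C'.Sparse (nearWeight i) (i ^ 2 + 3 * i + 1) 0 → C'.Col := fun C' h h' => ih _ h h' rfl
  have hi0 : (1 : ℤ) ≤ i := by exact_mod_cast hi
  by_contra hcol
  set f := nearWeight i with hf
  set B : ℤ := i ^ 2 + 3 * i + 1 with hB
  have hkill : ∀ U ⊂ C.V, U.Nonempty → (∀ X ⊆ C.V \ U, X.Nonempty → (C.cross X U).card ≠ 0 →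
      0 ≤ C.rho f B (X ∪ U) - C.rho f B U + i * (C.cross X U).card) → False := by
    intro U hU hne h
    obtain ⟨φ, hφ⟩ := ih' _ (card_restrict_lt hU) (hC.restrict U)
    refine hcol (col_of_kill hU.1 hφ (ih' _ (card_kill_lt hU.1 hne φ) fun X hX hXne => ?_))
    have hX' := mem_kill_V hX
    have h1 := rho_kill (i := i) hX' φ
    by_cases h0 : (C.cross X U).card = 0
    · have hd : Disjoint X U :=
        Finset.disjoint_left.2 fun a ha => (Finset.mem_sdiff.1 (hX' ha)).2
      rw [rho_union _ _ hd, h0] at h1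
      have h2 := hC X (hX'.trans Finset.sdiff_subset) hXne
      push_cast at h1
      linarith
    · exact (h X hX' hXne h0).trans h1
  have hgap1 : ∀ U ⊂ C.V, U.Nonempty → (i : ℤ) + 1 ≤ C.rho f B U := by
    intro U hU hne
    by_contra! hlt
    refine hkill U hU hne fun X hX hXne h0 => ?_
    have h1 := hC (X ∪ U) (Finset.union_subset (hX.trans Finset.sdiff_subset) hU.1)
      (hne.mono Finset.subset_union_right)
    have h2 : (1 : ℤ) ≤ (C.cross X U).card := by exact_mod_cast Nat.one_le_iff_ne_zero.2 h0
    nlinarith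
  have hbridge : ∀ U ⊂ C.V, U.Nonempty → (C.cross (C.V \ U) U).card = 1 → C.Col :=
    fun U hU hne h => col_of_card_cross_eq_one hC ih' hgap1 hU hne h
  have hgap2 : ∀ U ⊂ C.V, U.Nonempty → 2 * (i : ℤ) + 1 ≤ C.rho f B U := by
    intro U hU hne
    by_contra! hlt
    refine hkill U hU hne fun X hX hXne h0 => ?_
    have hXU : X ∪ U ⊆ C.V := Finset.union_subset (hX.trans Finset.sdiff_subset) hU.1
    have h1 := hC (X ∪ U) hXU (hne.mono Finset.subset_union_right)
    -- A single edge to `X` gains only `i`. If `X ∪ U` is `V`, this edge is a bridge; otherwise `X ∪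
    -- U` has potential at least `i + 1` by the first gap.
    by_cases h2 : (C.cross X U).card = 1
    · rcases hXU.eq_or_ssubset with heq | hss
      · refine absurd (hbridge U hU hne ?_) hcol
        rw [← h2, ← heq, Finset.union_sdiff_right, Finset.sdiff_eq_self_of_disjoint]
        exact Finset.disjoint_left.2 fun a ha => (Finset.mem_sdiff.1 (hX ha)).2
      · have := hgap1 _ hss (hne.mono Finset.subset_union_right)
        rw [h2]
        push_cast
        linarith
    · have h3 : (2 : ℤ) ≤ (C.cross X U).card := by norm_cast; omega
      nlinarith
  by_cases hi1 : i = 1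
  · subst hi1
    have hB5 : B = 5 := by rw [hB]; norm_num
    rw [hf, hB5] at hC hgap2
    rw [hB5] at ih'
    refine hcol (col_of_gap_one_two hC ih' (fun S hS hne => ?_) hbridge)
    have := hgap2 S hS hne
    push_cast at this
    linarith
  · have hi2 : (2 : ℤ) ≤ i := by norm_cast; omega
    rcases C.E.eq_empty_or_nonempty with hE | ⟨e, he⟩
    · exact hcol (col_of_no_edges hC hE)
    · refine hcol (col_of_split he (ih' _ (card_split e he) (sparse_split he hC (L := 2 * i + 1)
        (fun v _ => nearWeight_sub_le (C.slots v)) ?_ ?_)))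
      · rintro S hS (h | h) -
        · linarith [hgap2 S hS ⟨_, h⟩]
        · linarith [hgap2 S hS ⟨_, h⟩]
      · intro S hS h3 h4
        have := hC S hS ⟨_, h3⟩
        nlinarith

theorem rho_lt_of_not_col_near (hi : 1 ≤ i)
    (hC : ¬ C.Col) (hcrit : ∀ S ⊂ C.V, (C.restrict S).Col) :
    C.rho (nearWeight i) (i ^ 2 + 3 * i + 1) C.V < 0 := by
  by_contra! hV
  have hne : C.V.Nonempty := by
    by_contra h
    rw [Finset.not_nonempty_iff_eq_empty] at h
    exact hC ⟨fun _ => true, by simp [IsCol, h]⟩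
  obtain ⟨S, hS, hSne, hmin, hmax⟩ :=
    exists_min_rho (C := C) (nearWeight i) (i ^ 2 + 3 * i + 1) hne
  refine hC ?_
  by_cases hτ : 0 ≤ C.rho (nearWeight i) (i ^ 2 + 3 * i + 1) S
  · exact col_of_sparse_near hi fun T hT hTne => hτ.trans (hmin T hT hTne)
  · have hSV : S ⊂ C.V := hS.ssubset_of_ne fun h => hτ (h ▸ hV)
    obtain ⟨φ, hφ⟩ := hcrit S hSV
    refine col_of_kill hS hφ (col_of_sparse_near hi fun X hX _ => ?_)
    have hX' := mem_kill_V hX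
    have h1 := rho_kill (i := i) hX' φ
    have h2 := hmin (X ∪ S) (Finset.union_subset (hX'.trans Finset.sdiff_subset) hS)
      (hSne.mono Finset.subset_union_right)
    have h3 : (0 : ℤ) ≤ i * (C.cross X S).card := by positivity
    linarith

end Near

/-! ### The case `i = 0` -/

/-- The inequality between the numbers of vertices and edges is all that is used of a spanning tree;
adding a vertex along an edge preserves it. -/
lemma card_le_of_step {P : β → Prop} [DecidablePred P] {A : Finset α}
    (hA : A.card ≤ ((C.inside A).filter P).card + 1) {e : β} (he : e ∈ C.E) (hP : P e) {w : α}
    (hw : w ∉ A) (hx : (C.fst e ∈ A ∧ C.snd e = w) ∨ (C.fst e = w ∧ C.snd e ∈ A)) :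
    (insert w A).card ≤ ((C.inside (insert w A)).filter P).card + 1 := by
  rw [Finset.card_insert_of_notMem hw]
  have h : insert e ((C.inside A).filter P) ⊆ (C.inside (insert w A)).filter P := by
    intro e' he'
    rw [Finset.mem_insert] at he'
    rcases he' with rfl | he'
    · rw [Finset.mem_filter, mem_inside]
      refine ⟨⟨he, ?_⟩, hP⟩
      rcases hx with ⟨h1, h2⟩ | ⟨h1, h2⟩ <;> simp [h1, h2]
    · rw [Finset.mem_filter] at he' ⊢
      exact ⟨inside_mono (Finset.subset_insert w A) he'.1, he'.2⟩
  have h1 : e ∉ (C.inside A).filter P := by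
    rw [Finset.mem_filter, mem_inside]
    rintro ⟨⟨-, h1, h2⟩, -⟩
    rcases hx with ⟨-, rfl⟩ | ⟨rfl, -⟩ <;> contradiction
  have h2 := Finset.card_le_card h
  rw [Finset.card_insert_of_notMem h1] at h2
  omega

/-- Every vertex of a set `D` that is not left by edges with the property `P` lies in a subset with
the same property that has a spanning tree of such edges. -/
lemma exists_spanned_subset {P : β → Prop} [DecidablePred P] {D : Finset α}
    (hD : ∀ e ∈ C.E, P e → (C.fst e ∈ D ↔ C.snd e ∈ D)) {a : α} (ha : a ∈ D) :
    ∃ A ⊆ D, a ∈ A ∧ (∀ e ∈ C.E, P e → (C.fst e ∈ A ↔ C.snd e ∈ A)) ∧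
      A.card ≤ ((C.inside A).filter P).card + 1 := by
  obtain ⟨A, hA, hmax⟩ := (D.powerset.filter fun A => a ∈ A ∧
    A.card ≤ ((C.inside A).filter P).card + 1).exists_max_image Finset.card
    ⟨{a}, by simp [ha]⟩
  simp only [Finset.mem_filter, Finset.mem_powerset] at hA hmax
  obtain ⟨hAD, haA, hcard⟩ := hA
  refine ⟨A, hAD, haA, fun e he hP => ?_, hcard⟩
  have key : ∀ w ∈ D, w ∉ A →
      ¬ ((C.fst e ∈ A ∧ C.snd e = w) ∨ (C.fst e = w ∧ C.snd e ∈ A)) := by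
    intro w hw hwA hx
    have := hmax (insert w A) ⟨Finset.insert_subset hw hAD, Finset.mem_insert_of_mem haA,
      card_le_of_step hcard he hP hwA hx⟩
    rw [Finset.card_insert_of_notMem hwA] at this
    omega
  constructor
  · intro h
    by_contra h'
    exact key _ ((hD e he hP).1 (hAD h)) h' (Or.inl ⟨h, rfl⟩)
  · intro h
    by_contra h'
    exact key _ ((hD e he hP).2 (hAD h)) h' (Or.inr ⟨rfl, h⟩)

/-- Among the colourings whose violated edges join rich vertices (all-rich is one) take one with the
fewest violations. Poor vertices then have degree `0`. At a rich `v`, the edges not counted by its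
degree number at least `|V| - 1`, which leaves at most `j`. -/
lemma col_of_connected {j : ℕ} (hconn : ∀ A ⊂ C.V, A.Nonempty → (C.cross A (C.V \ A)).Nonempty)
    (hslots : ∀ v ∈ C.V, 1 ≤ C.slots v false ∧ j + 1 ≤ C.slots v true)
    (hE : C.E.card + 1 ≤ C.V.card + j) : C.Col := by
  obtain ⟨n, hn⟩ : ∃ n, ∃ φ : α → Bool, (∀ e ∈ C.E, C.Active φ e →
      φ (C.fst e) = true ∧ φ (C.snd e) = true) ∧ (C.E.filter (C.Active φ)).card = n :=
    ⟨_, fun _ => true, by simp, rfl⟩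
  classical
  have hn' : ∃ n, ∃ φ : α → Bool, (∀ e ∈ C.E, C.Active φ e →
      φ (C.fst e) = true ∧ φ (C.snd e) = true) ∧ (C.E.filter (C.Active φ)).card = n := ⟨n, hn⟩
  obtain ⟨φ, hφ, hcard⟩ := Nat.find_spec hn'
  have hmin : ∀ ψ : α → Bool, (∀ e ∈ C.E, C.Active ψ e →
      ψ (C.fst e) = true ∧ ψ (C.snd e) = true) →
      (C.E.filter (C.Active φ)).card ≤ (C.E.filter (C.Active ψ)).card := by
    intro ψ hψ
    rw [hcard]
    exact Nat.find_min' hn' ⟨ψ, hψ, rfl⟩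
  -- If all edges leaving `D` are violated and none inside is, switching `D` satisfies the edges
  -- that leave it, of which connectivity provides one, and creates no violation.
  have hflip : ∀ D ⊂ C.V, D.Nonempty →
      (∀ e ∈ C.E, ¬ C.Active φ e → (C.fst e ∈ D ↔ C.snd e ∈ D)) →
      ∃ e ∈ C.inside D, C.Active φ e := by
    intro D hD hne hcl
    by_contra! hno
    obtain ⟨e₀, he₀⟩ := hconn D hD hne
    set ψ : α → Bool := fun v => if v ∈ D then !φ v else φ v with hψ
    have hiff : ∀ e ∈ C.E, C.Active ψ e ↔ C.Active φ e ∧ C.fst e ∉ D ∧ C.snd e ∉ D := by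
      intro e he
      have h1 := hno e
      have h2 := hcl e he
      rw [mem_inside] at h1
      unfold Active at h1 h2 ⊢
      simp only [hψ]
      by_cases h3 : C.fst e ∈ D <;> by_cases h4 : C.snd e ∈ D <;>
        simp only [h3, h4, he, if_true, if_false, not_true, not_false_eq_true,
          and_true, and_false, iff_false] at h1 h2 ⊢
      · simpa using h1 trivial
      · have h5 : (φ (C.fst e) ^^ φ (C.snd e)) = C.sgn e := by
          by_contra h5
          exact absurd (h2 h5) (by simp)
        rw [← h5]
        cases φ (C.fst e) <;> cases φ (C.snd e) <;> decide
      · have h5 : (φ (C.fst e) ^^ φ (C.snd e)) = C.sgn e := by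
          by_contra h5
          exact absurd (h2 h5) (by simp)
        rw [← h5]
        cases φ (C.fst e) <;> cases φ (C.snd e) <;> decide
    have h1 := hmin ψ fun e he ha => by
      obtain ⟨h1, h2, h3⟩ := (hiff e he).1 ha
      simp only [hψ, h2, h3, if_false]
      exact hφ e he h1
    refine absurd h1 (not_le.2 (Finset.card_lt_card ?_))
    rw [mem_cross] at he₀
    have he₁ : ¬ (C.fst e₀ ∈ D ↔ C.snd e₀ ∈ D) := by
      rcases he₀.2 with ⟨h3, h4⟩ | ⟨h3, h4⟩ <;> rw [Finset.mem_sdiff] at * <;> tauto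
    refine Finset.ssubset_iff_subset_ne.2 ⟨fun e he => ?_, fun h => ?_⟩
    · rw [Finset.mem_filter] at he ⊢
      exact ⟨he.1, ((hiff e he.1).1 he.2).1⟩
    · have h2 : e₀ ∈ C.E.filter (C.Active φ) :=
        Finset.mem_filter.2 ⟨he₀.1, by by_contra h; exact he₁ (hcl e₀ he₀.1 h)⟩
      rw [← h, Finset.mem_filter, hiff e₀ he₀.1] at h2
      exact he₁ (by simp [h2.2.2])
  refine ⟨φ, fun v hv => ?_⟩
  cases hv' : φ v
  · have : C.deg φ v = 0 := by
      unfold deg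
      rw [Finset.card_eq_zero, Finset.filter_eq_empty_iff]
      rintro e he ⟨h1 | h1, h2⟩ <;> have := hφ e he h2 <;> rw [h1, hv'] at this <;> simp at this
    rw [this]
    exact (hslots v hv).1
  · refine lt_of_lt_of_le ?_ (hslots v hv).2
    set Q : β → Prop := fun e => ¬ (C.Inc v e ∧ C.Active φ e) with hQ
    obtain ⟨A, hA, hmax⟩ := (C.V.powerset.filter fun A => v ∈ A ∧
      A.card ≤ ((C.inside A).filter Q).card + 1).exists_max_image Finset.card
      ⟨{v}, by simp [hv]⟩
    simp only [Finset.mem_filter, Finset.mem_powerset] at hA hmax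
    obtain ⟨hAV, hvA, hAc⟩ := hA
    have hstep : ∀ w ∈ C.V, w ∉ A → ∀ e ∈ C.E, Q e →
        ¬ ((C.fst e ∈ A ∧ C.snd e = w) ∨ (C.fst e = w ∧ C.snd e ∈ A)) := by
      intro w hw hwA e he hP hx
      have := hmax (insert w A) ⟨Finset.insert_subset hw hAV, Finset.mem_insert_of_mem hvA,
        card_le_of_step hAc he hP hwA hx⟩
      rw [Finset.card_insert_of_notMem hwA] at this
      omega
    have hAcl : ∀ e ∈ C.E, Q e → (C.fst e ∈ A ↔ C.snd e ∈ A) := by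
      intro e he hP
      have h1 := hstep _ (C.fst_mem e he)
      have h2 := hstep _ (C.snd_mem e he)
      grind
    have hAeq : A = C.V := by
      by_contra hne
      obtain ⟨a, haV, haA⟩ := Finset.exists_of_ssubset (hAV.ssubset_of_ne hne)
      -- A set outside `A` closed under satisfied edges has `|K| - 1` of these and, by `hflip`, a
      -- violated edge inside. That edge avoids `v`, so it counts too, and `A ∪ K` contradicts the
      -- maximality of `A`.
      obtain ⟨K, hK, haK, hKcl, hKc⟩ := exists_spanned_subset (C := C) (D := C.V \ A)
        (P := fun e => ¬ C.Active φ e) (fun e he hP => by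
          have := hAcl e he fun h => hP h.2
          have h1 := C.fst_mem e he
          have h2 := C.snd_mem e he
          simp [h1, h2, this]) (Finset.mem_sdiff.2 ⟨haV, haA⟩)
      have hKV : K ⊂ C.V := (hK.trans Finset.sdiff_subset).ssubset_of_ne fun h =>
        (Finset.mem_sdiff.1 (hK (h ▸ hv))).2 hvA
      obtain ⟨e, heK, hea⟩ := hflip K hKV ⟨a, haK⟩ hKcl
      have hd : Disjoint A K :=
        Finset.disjoint_right.2 fun a ha => (Finset.mem_sdiff.1 (hK ha)).2
      have hdE : Disjoint ((C.inside A).filter Q)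
          (insert e ((C.inside K).filter fun e => ¬ C.Active φ e)) := by
        rw [Finset.disjoint_left]
        intro e' h1 h2
        rw [Finset.mem_filter, mem_inside] at h1
        have h3 : e' ∈ C.inside K := by
          rcases Finset.mem_insert.1 h2 with rfl | h
          exacts [heK, (Finset.mem_filter.1 h).1]
        exact Finset.disjoint_left.1 hd h1.1.2.1 (mem_inside.1 h3).2.1
      have hsub : (C.inside A).filter Q ∪
          insert e ((C.inside K).filter fun e => ¬ C.Active φ e) ⊆
          (C.inside (A ∪ K)).filter Q := by
        intro e' h1
        have hvK : v ∉ K := Finset.disjoint_left.1 hd hvA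
        have hKQ : ∀ e ∈ C.inside K, Q e := by
          rintro e he ⟨h | h, -⟩ <;> rw [mem_inside] at he <;> rw [← h] at hvK
          exacts [hvK he.2.1, hvK he.2.2]
        rw [Finset.mem_filter]
        rcases Finset.mem_union.1 h1 with h1 | h1
        · rw [Finset.mem_filter] at h1
          exact ⟨inside_mono Finset.subset_union_left h1.1, h1.2⟩
        · have h3 : e' ∈ C.inside K := by
            rcases Finset.mem_insert.1 h1 with rfl | h
            exacts [heK, (Finset.mem_filter.1 h).1]
          exact ⟨inside_mono Finset.subset_union_right h3, hKQ e' h3⟩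
      have h1 := Finset.card_le_card hsub
      rw [Finset.card_union_of_disjoint hdE, Finset.card_insert_of_notMem (by simp [hea])] at h1
      have h2 := hmax (A ∪ K) ⟨Finset.union_subset hAV (hK.trans Finset.sdiff_subset),
        Finset.mem_union_left _ hvA, by rw [Finset.card_union_of_disjoint hd]; omega⟩
      rw [Finset.card_union_of_disjoint hd] at h2
      have h3 : 0 < K.card := Finset.card_pos.2 ⟨a, haK⟩
      omega
    rw [hAeq, inside_V] at hAc
    have h1 := Finset.card_filter_add_card_filter_not (s := C.E)
      (fun e => C.Inc v e ∧ C.Active φ e)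
    change _ + (C.E.filter Q).card = _ at h1
    unfold deg
    omega

/-- If `|E(S)| < |S| + j` for every nonempty set `S` of vertices, there is a `(0, j)`-colouring. -/
theorem col_of_sparse_zero {j : ℕ}
    (hslots : ∀ v ∈ C.V, 1 ≤ C.slots v false ∧ j + 1 ≤ C.slots v true)
    (hE : ∀ S ⊆ C.V, S.Nonempty → (C.inside S).card + 1 ≤ S.card + j) : C.Col := by
  induction hn : C.V.card using Nat.strong_induction_on generalizing C with
  | _ n ih =>
  subst hn
  rcases C.V.eq_empty_or_nonempty with h0 | hne
  · exact ⟨fun _ => true, by simp [IsCol, h0]⟩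
  by_cases hconn : ∀ A ⊂ C.V, A.Nonempty → (C.cross A (C.V \ A)).Nonempty
  · refine col_of_connected hconn hslots ?_
    have := hE C.V subset_rfl hne
    rwa [inside_V] at this
  · push Not at hconn
    obtain ⟨A, hA, hAne, hcr⟩ := hconn
    have hcol : ∀ S ⊂ C.V, (C.restrict S).Col := by
      intro S hS
      refine ih _ ?_ (fun v hv => hslots v (Finset.mem_inter.1 hv).1) (fun T hT hTne => ?_) rfl
      · rw [restrict_V, Finset.inter_eq_right.2 hS.1]
        exact Finset.card_lt_card hS
      · rw [restrict_V, Finset.subset_inter_iff] at hT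
        refine le_trans ?_ (hE T hT.1 hTne)
        gcongr
        intro e he
        rw [mem_inside] at he ⊢
        exact ⟨(mem_inside.1 he.1).1, he.2⟩
    obtain ⟨ψ, hψ⟩ := hcol A hA
    obtain ⟨φ, hφ⟩ := hcol (C.V \ A) (Finset.sdiff_ssubset hA.1 hAne)
    exact col_of_parts (Finset.union_sdiff_of_subset hA.1).symm Finset.disjoint_sdiff hψ hφ
      (by simp [Finset.not_nonempty_iff_eq_empty.1 (by simpa using hcr)])

theorem card_add_le_of_not_col {j : ℕ}
    (hslots : ∀ v ∈ C.V, 1 ≤ C.slots v false ∧ j + 1 ≤ C.slots v true)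
    (hC : ¬ C.Col) (hcrit : ∀ S ⊂ C.V, (C.restrict S).Col) : C.V.card + j ≤ C.E.card := by
  by_contra! hlt
  refine hC (col_of_connected (fun A hA hAne => ?_) hslots hlt)
  by_contra hcr
  obtain ⟨ψ, hψ⟩ := hcrit A hA
  obtain ⟨φ, hφ⟩ := hcrit (C.V \ A) (Finset.sdiff_ssubset hA.1 hAne)
  exact hC (col_of_parts (Finset.union_sdiff_of_subset hA.1).symm Finset.disjoint_sdiff hψ hφ
    (by simp [Finset.not_nonempty_iff_eq_empty.1 hcr]))

/-! ### Covers and signed graphs -/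

/-- The signed graph `C` has the underlying multigraph `G`. -/
structure Models (C : SignedGraph α β) (G : Graph α β) : Prop where
  vertexSet_eq : G.vertexSet = C.V
  edgeSet_eq : G.edgeSet = C.E
  isLink : ∀ e ∈ C.E, G.IsLink e (C.fst e) (C.snd e)

/-- The signed graph has `i + 1` poor and `j + 1` rich slots at each vertex. -/
def Full (C : SignedGraph α β) (i j : ℕ) : Prop :=
  ∀ v, C.slots v false = i + 1 ∧ C.slots v true = j + 1

/-- Change the signs. -/
@[simps] def withSgn (C : SignedGraph α β) (s : β → Bool) : SignedGraph α β := { C with sgn := s }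

variable {G : Graph α β}

lemma Models.isLink_iff (h : C.Models G) {e : β} {u v : α} :
    G.IsLink e u v ↔ e ∈ C.E ∧ (C.fst e = u ∧ C.snd e = v ∨ C.fst e = v ∧ C.snd e = u) := by
  constructor
  · intro he
    have h1 : e ∈ C.E := by
      have := he.edge_mem
      rwa [h.edgeSet_eq] at this
    exact ⟨h1, (h.isLink e h1).eq_and_eq_or_eq_and_eq he⟩
  · rintro ⟨he, ⟨rfl, rfl⟩ | ⟨rfl, rfl⟩⟩
    exacts [h.isLink e he, (h.isLink e he).symm]

/-- The cover of the underlying multigraph that is given by the signs. -/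
def cover (h : C.Models G) : TwoFoldCover G (α × Bool) (α ⊕ β × Bool) where
  -- `Sum.inl v` is the edge inside the list of `v`; `Sum.inr (e, b)` is the matching edge of `e` at
  -- colour `b` of its first end.
  graph := graphOfEnds {w | w.1 ∈ C.V} {f | Sum.elim (· ∈ C.V) (fun p => p.1 ∈ C.E) f}
    (Sum.elim (fun v => (v, false)) fun p => (C.fst p.1, p.2))
    (Sum.elim (fun v => (v, true)) fun p => (C.snd p.1, p.2 ^^ C.sgn p.1))
    (by rintro (v | p) h; exacts [h, C.fst_mem _ h])
    (by rintro (v | p) h; exacts [h, C.snd_mem _ h])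
  poor v := (v, false)
  rich v := (v, true)
  L v := {(v, false), (v, true)}
  M e := {f | ∃ b, f = Sum.inr (e, b)}
  loopless := ⟨by
    rintro (v | p) x ⟨hf, hx⟩
    · simp only [Sum.elim_inl] at hx
      grind
    · have := C.fst_ne_snd p.1 hf
      simp only [Sum.elim_inr] at hx
      grind⟩
  L_eq v _ := rfl
  poor_ne_rich v _ := by simp
  L_subset v hv := by
    rw [h.vertexSet_eq] at hv
    rintro x (rfl | rfl) <;> exact hv
  exists_mem_L x hx := by
    refine ⟨x.1, by rw [h.vertexSet_eq]; exact hx, ?_⟩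
    obtain ⟨v, b⟩ := x
    cases b <;> simp
  L_disjoint u _ v _ huv := by
    rw [Set.disjoint_left]
    rintro _ (rfl | rfl) (h | h) <;> grind
  L_complete v hv := by
    rw [h.vertexSet_eq] at hv
    refine ⟨Sum.inl v, ⟨hv, Or.inl ⟨rfl, rfl⟩⟩, ?_⟩
    rintro (w | p) ⟨hf, hx⟩
    · simp only [Sum.elim_inl] at hx
      grind
    · have := C.fst_ne_snd p.1 hf
      simp only [Sum.elim_inr] at hx
      grind
  M_link e u v he := by
    rintro _ ⟨b, rfl⟩
    rw [h.isLink_iff] at he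
    obtain ⟨he, ⟨rfl, rfl⟩ | ⟨rfl, rfl⟩⟩ := he
    · exact ⟨_, by cases b <;> simp, _, by cases b <;> cases C.sgn e <;> simp, he,
        Or.inl ⟨rfl, rfl⟩⟩
    · exact ⟨(C.snd e, b ^^ C.sgn e), by cases b <;> cases C.sgn e <;> simp, (C.fst e, b),
        by cases b <;> simp, he, Or.inr ⟨rfl, rfl⟩⟩
  M_perfect e u v he := by
    rw [h.isLink_iff] at he
    obtain ⟨he, huv⟩ := he
    have hne := C.fst_ne_snd e he
    have hx : ∀ x : α × Bool, x ∈ ({(u, false), (u, true)} : Set (α × Bool)) → x.1 = u := by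
      rintro x (rfl | rfl) <;> rfl
    intro x hxu
    have hxu := hx x hxu
    obtain ⟨w, b⟩ := x
    obtain rfl : w = u := hxu
    rcases huv with ⟨rfl, rfl⟩ | ⟨rfl, rfl⟩
    · refine ⟨Sum.inr (e, b), ⟨⟨b, rfl⟩, _, he, Or.inl ⟨rfl, rfl⟩⟩, ?_⟩
      rintro _ ⟨⟨b', rfl⟩, y, -, hy⟩
      simp only [Sum.elim_inr] at hy
      grind
    · refine ⟨Sum.inr (e, b ^^ C.sgn e), ⟨⟨_, rfl⟩, (C.fst e, b ^^ C.sgn e), he,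
        Or.inr ⟨rfl, by simp⟩⟩, ?_⟩
      rintro _ ⟨⟨b', rfl⟩, y, -, hy⟩
      simp only [Sum.elim_inr] at hy
      have : b = (b' ^^ C.sgn e) := by grind
      simp [this]
  mem_M f x y u v hf hu hv hx hy huv := by
    obtain ⟨hf, h1⟩ := hf
    have hfst : ∀ (x : α × Bool) w, x ∈ ({(w, false), (w, true)} : Set (α × Bool)) → x.1 = w := by
      rintro x w (rfl | rfl) <;> rfl
    have hx := hfst x u hx
    have hy := hfst y v hy
    rcases f with w | ⟨e, b⟩
    · simp only [Sum.elim_inl] at h1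
      grind
    · refine ⟨e, ⟨by rw [h.edgeSet_eq]; exact hf, b, rfl⟩, ?_⟩
      rintro e' ⟨-, b', hb⟩
      simp only [Sum.inr.injEq, Prod.mk.injEq] at hb
      exact hb.1.symm

lemma Models.col_of_colorable {i j : ℕ} (h : C.Models G) (hfull : C.Full i j)
    (hG : Colorable i j G) : C.Col := by
  obtain ⟨ψ, ⟨-, hψ⟩, hdeg⟩ := hG _ _ (cover h)
  have hV : ∀ v, v ∈ G.vertexSet ↔ v ∈ C.V := by simp [h.vertexSet_eq]
  have hψ1 : ∀ v ∈ C.V, (ψ v).1 = v := by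
    intro v hv
    have h1 : ψ v ∈ ({(v, false), (v, true)} : Set (α × Bool)) := hψ v ((hV v).2 hv)
    rcases h1 with h1 | h1 <;> rw [h1]
  refine ⟨fun v => (ψ v).2, fun v hv => ?_⟩
  have hle : (C.deg (fun v => (ψ v).2) v : ℕ∞) ≤ (cover h).inducedDegree ψ (ψ v) := by
    unfold deg TwoFoldCover.inducedDegree
    rw [← Set.encard_coe_eq_coe_finsetCard]
    refine Set.encard_le_encard_of_injOn (f := fun e => Sum.inr (e, (ψ (C.fst e)).2)) ?_ ?_
    · intro e he
      rw [Finset.mem_coe, Finset.mem_filter] at he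
      obtain ⟨he, hi, ha⟩ := he
      have h1 := C.fst_mem e he
      have h2 := C.snd_mem e he
      have h3 : ((C.fst e, (ψ (C.fst e)).2) : α × Bool) = ψ (C.fst e) :=
        Prod.ext (hψ1 _ h1).symm rfl
      have h4 : ((C.snd e, (ψ (C.fst e)).2 ^^ C.sgn e) : α × Bool) = ψ (C.snd e) := by
        refine Prod.ext (hψ1 _ h2).symm ?_
        rw [← ha]
        simp
      have h5 : (cover h).graph.IsLink (Sum.inr (e, (ψ (C.fst e)).2)) (ψ (C.fst e))
          (ψ (C.snd e)) := ⟨he, Or.inl ⟨h3, h4⟩⟩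
      have h6 : ∀ u ∈ C.V, ψ u ∈ ψ '' G.vertexSet := fun u hu => ⟨u, (hV u).2 hu, rfl⟩
      have h7 : ((cover h).inducedGraph ψ).IsLink (Sum.inr (e, (ψ (C.fst e)).2)) (ψ (C.fst e))
          (ψ (C.snd e)) := by
        unfold TwoFoldCover.inducedGraph
        rw [Graph.induce_isLink]
        exact ⟨h5, h6 _ h1, h6 _ h2⟩
      rcases hi with rfl | rfl
      exacts [h7.inc_left, h7.inc_right]
    · intro e _ e' _ hee
      simp only [Sum.inr.injEq, Prod.mk.injEq] at hee
      exact hee.1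
  have h1 := hdeg v ((hV v).2 hv)
  have h2 := hfull v
  cases h3 : (ψ v).2
  · have h4 := h1.1 (Prod.ext (hψ1 v hv) h3)
    have h5 := hle.trans h4
    change _ < C.slots v (ψ v).2
    rw [h3, h2.1]
    exact Nat.lt_succ_of_le (by exact_mod_cast h5)
  · have h4 := h1.2 (Prod.ext (hψ1 v hv) h3)
    have h5 := hle.trans h4
    change _ < C.slots v (ψ v).2
    rw [h3, h2.2]
    exact Nat.lt_succ_of_le (by exact_mod_cast h5)

/-- The vertex of `L(v)` of a given colour. -/
def _root_.DefectiveDP.TwoFoldCover.vertex {W F : Type} (H : TwoFoldCover G W F) (v : α)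
    (κ : Bool) : W := if κ then H.rich v else H.poor v

section Cover

variable {W F : Type} (H : TwoFoldCover G W F)

lemma _root_.DefectiveDP.TwoFoldCover.mem_L_iff {v : α} (hv : v ∈ G.vertexSet) {x : W} :
    x ∈ H.L v ↔ ∃ κ, x = H.vertex v κ := by
  rw [H.L_eq v hv]
  simp [TwoFoldCover.vertex]

lemma _root_.DefectiveDP.TwoFoldCover.vertex_inj {u v : α} (hu : u ∈ G.vertexSet)
    (hv : v ∈ G.vertexSet) {κ κ' : Bool} (h : H.vertex u κ = H.vertex v κ') :
    u = v ∧ κ = κ' := by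
  have huv : u = v := by
    by_contra hne
    exact Set.disjoint_left.1 (H.L_disjoint u hu v hv hne) ((H.mem_L_iff hu).2 ⟨κ, rfl⟩)
      ((H.mem_L_iff hv).2 ⟨κ', h⟩)
  subst huv
  have := H.poor_ne_rich u hu
  refine ⟨rfl, ?_⟩
  unfold TwoFoldCover.vertex at h
  cases κ <;> cases κ' <;> simp_all

/-- The matching of an edge is straight or crossed. -/
lemma _root_.DefectiveDP.TwoFoldCover.exists_sign {e : β} {u v : α} (he : G.IsLink e u v) :
    ∃ s, ∀ f ∈ H.M e, ∀ κ κ', H.graph.IsLink f (H.vertex u κ) (H.vertex v κ') →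
      (κ ^^ κ') = s := by
  have hu := he.left_mem
  have hv := he.right_mem
  have hmem : ∀ κ, H.vertex u κ ∈ H.L u := fun κ => (H.mem_L_iff hu).2 ⟨κ, rfl⟩
  have hmem' : ∀ κ, H.vertex v κ ∈ H.L v := fun κ => (H.mem_L_iff hv).2 ⟨κ, rfl⟩
  by_contra! hno
  obtain ⟨f, hf, a, a', hl, hs⟩ := hno true
  obtain ⟨g, hg, b, b', hl', hs'⟩ := hno false
  -- The two links have different sums of colours, so they share exactly one vertex, where the
  -- matching edge is unique.
  by_cases hab : a = b
  · subst hab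
    obtain rfl : f = g := (H.M_perfect e u v he _ (hmem a)).unique ⟨hf, hl.inc_left⟩
      ⟨hg, hl'.inc_left⟩
    have := (H.vertex_inj hv hv (hl.right_unique hl')).2
    subst this
    simp_all
  · have hab' : a' = b' := by
      cases a <;> cases b <;> cases a' <;> cases b' <;> simp_all
    subst hab'
    obtain rfl : f = g := (H.M_perfect e v u he.symm _ (hmem' a')).unique ⟨hf, hl.inc_right⟩
      ⟨hg, hl'.inc_right⟩
    exact hab (H.vertex_inj hu hu (hl.left_unique hl')).2

end Cover

/-- Only one vertex of each list is chosen, so every edge of `H_φ` lies in a matching `M(e)` of a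
violated edge `e`; at a given vertex, different edges come from different `e`. -/
lemma Models.colorable {i j : ℕ} (h : C.Models G) (hfull : C.Full i j)
    (hcol : ∀ s, (C.withSgn s).Col) : Colorable i j G := by
  intro W F H
  have hV : ∀ v, v ∈ G.vertexSet ↔ v ∈ C.V := by simp [h.vertexSet_eq]
  have hs : ∀ e, ∃ s, e ∈ C.E → ∀ f ∈ H.M e, ∀ κ κ', H.graph.IsLink f (H.vertex (C.fst e) κ)
      (H.vertex (C.snd e) κ') → (κ ^^ κ') = s := by
    intro e
    by_cases he : e ∈ C.E
    · obtain ⟨s, hs⟩ := H.exists_sign (h.isLink e he)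
      exact ⟨s, fun _ => hs⟩
    · exact ⟨true, fun h => absurd h he⟩
  choose s hs using hs
  obtain ⟨φ, hφ⟩ := hcol s
  have hmem : ∀ v ∈ C.V, H.vertex v (φ v) ∈ H.L v :=
    fun v hv => (H.mem_L_iff ((hV v).2 hv)).2 ⟨_, rfl⟩
  refine ⟨fun v => H.vertex v (φ v), ⟨fun u hu v hv huv => (H.vertex_inj hu hv huv).1,
    fun v hv => hmem v ((hV v).1 hv)⟩, fun v hv => ?_⟩
  have hvC := (hV v).1 hv
  have key : ∀ f ∈ (H.inducedGraph fun v => H.vertex v (φ v)).incidenceSet (H.vertex v (φ v)),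
      ∃ e ∈ C.E.filter (fun e => C.Inc v e ∧ (C.withSgn s).Active φ e), f ∈ H.M e ∧
        H.graph.Inc f (H.vertex v (φ v)) := by
    rintro f ⟨y, hy⟩
    unfold TwoFoldCover.inducedGraph at hy
    rw [Graph.induce_isLink] at hy
    obtain ⟨hl, -, w, hw, rfl⟩ := hy
    have hwC := (hV w).1 hw
    have hvw : v ≠ w := by
      rintro rfl
      exact H.loopless.1 _ _ hl
    obtain ⟨e, ⟨he, hf⟩, -⟩ := H.mem_M f _ _ v w hl hv hw (hmem v hvC) (hmem w hwC) hvw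
    rw [h.edgeSet_eq, Finset.mem_coe] at he
    have h1 := C.fst_mem e he
    have h2 := C.snd_mem e he
    obtain ⟨x, hx, x', hx', hl'⟩ := H.M_link e _ _ (h.isLink e he) f hf
    obtain ⟨κ, rfl⟩ := (H.mem_L_iff ((hV _).2 h1)).1 hx
    obtain ⟨κ', rfl⟩ := (H.mem_L_iff ((hV _).2 h2)).1 hx'
    have hact := hs e he f hf κ κ' hl'
    refine ⟨e, Finset.mem_filter.2 ⟨he, ?_⟩, hf, _, hl⟩
    rcases hl.eq_and_eq_or_eq_and_eq hl' with ⟨h3, h4⟩ | ⟨h3, h4⟩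
    · obtain ⟨rfl, rfl⟩ := H.vertex_inj hv ((hV _).2 h1) h3
      obtain ⟨rfl, rfl⟩ := H.vertex_inj hw ((hV _).2 h2) h4
      exact ⟨Or.inl rfl, hact⟩
    · obtain ⟨rfl, rfl⟩ := H.vertex_inj hv ((hV _).2 h2) h3
      obtain ⟨rfl, rfl⟩ := H.vertex_inj hw ((hV _).2 h1) h4
      exact ⟨Or.inr rfl, hact⟩
  have hle : H.inducedDegree (fun v => H.vertex v (φ v)) (H.vertex v (φ v)) ≤
      ((C.withSgn s).deg φ v : ℕ∞) := by
    unfold deg TwoFoldCover.inducedDegree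
    rw [← Set.encard_coe_eq_coe_finsetCard]
    rcases Set.eq_empty_or_nonempty ((H.inducedGraph fun v => H.vertex v (φ v)).incidenceSet
      (H.vertex v (φ v))) with h0 | ⟨f₀, hf₀⟩
    · simp [h0]
    have : Nonempty β := ⟨(key f₀ hf₀).choose⟩
    choose! g hg hgM hgI using key
    refine Set.encard_le_encard_of_injOn (f := g) (fun f hf => hg f hf) ?_
    intro f hf f' hf' hff
    have h1 := Finset.mem_filter.1 (hg f hf)
    have h3 := hgM f' hf'
    rw [← hff] at h3
    obtain ⟨u, hu⟩ : ∃ u, G.IsLink (g f) v u := by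
      have h4 := h.isLink _ h1.1
      rcases h1.2.1 with h5 | h5 <;> rw [h5] at h4
      exacts [⟨_, h4⟩, ⟨_, h4.symm⟩]
    exact (H.M_perfect _ _ _ hu _ (hmem v hvC)).unique ⟨hgM f hf, hgI f hf⟩ ⟨h3, hgI f' hf'⟩
  have hlt := hφ v hvC
  have hfv := hfull v
  rw [withSgn_slots] at hlt
  constructor
  · intro h1
    have : φ v = false := (H.vertex_inj hv hv (κ' := false) h1).2
    rw [this, hfv.1] at hlt
    exact hle.trans (by exact_mod_cast Nat.le_of_lt_succ hlt)
  · intro h1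
    have : φ v = true := (H.vertex_inj hv hv (κ' := true) h1).2
    rw [this, hfv.2] at hlt
    exact hle.trans (by exact_mod_cast Nat.le_of_lt_succ hlt)

/-! ### Critical multigraphs and signed graphs -/

section Critical

variable {G : Graph α β}

lemma Models.restrict (h : C.Models G) (S : Finset α) :
    (C.restrict S).Models (G.induce (C.V ∩ S)) where
  vertexSet_eq := by
    rw [restrict_V, Finset.coe_inter]
    rfl
  edgeSet_eq := by
    ext e
    simp only [Graph.edgeSet_induce, Set.mem_ofPred_eq, h.isLink_iff, restrict_E, Finset.mem_coe,
      mem_inside, Set.mem_inter_iff]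
    constructor
    · rintro ⟨x, y, ⟨he, ⟨rfl, rfl⟩ | ⟨rfl, rfl⟩⟩, hx, hy⟩
      exacts [⟨he, hx.2, hy.2⟩, ⟨he, hy.2, hx.2⟩]
    · rintro ⟨he, h1, h2⟩
      exact ⟨_, _, ⟨he, Or.inl ⟨rfl, rfl⟩⟩, ⟨C.fst_mem e he, h1⟩, C.snd_mem e he, h2⟩
  isLink e he := by
    rw [restrict_E, mem_inside] at he
    rw [Graph.induce_isLink]
    exact ⟨h.isLink e he.1, ⟨C.fst_mem e he.1, he.2.1⟩, C.snd_mem e he.1, he.2.2⟩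

/-- The signed graphs of a critical multigraph. -/
structure Minimal (C : SignedGraph α β) (i j : ℕ) : Prop where
  full : C.Full i j
  not_col : ¬ C.Col
  col_restrict : ∀ S ⊂ C.V, (C.restrict S).Col

lemma exists_minimal_of_isCritical [Nonempty α] {i j : ℕ} (hG : IsCritical i j G) :
    ∃ C : SignedGraph α β, C.Models G ∧ C.Minimal i j := by
  have hl : ∀ e, ∃ x y, e ∈ G.edgeSet → G.IsLink e x y := by
    intro e
    by_cases he : e ∈ G.edgeSet
    · obtain ⟨x, y, h⟩ := Graph.exists_isLink_of_mem_edgeSet he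
      exact ⟨x, y, fun _ => h⟩
    · exact ⟨Classical.arbitrary α, Classical.arbitrary α, fun h => absurd h he⟩
  choose x y hxy using hl
  let C : SignedGraph α β :=
    { V := hG.finite_vertexSet.toFinset
      E := hG.finite_edgeSet.toFinset
      fst := x
      snd := y
      sgn := fun _ => true
      slots := fun _ κ => if κ then j + 1 else i + 1
      fst_mem := fun e he => by simpa using (hxy e (by simpa using he)).left_mem
      snd_mem := fun e he => by simpa using (hxy e (by simpa using he)).right_mem
      fst_ne_snd := fun e he h => by
        have h1 := hxy e (by simpa using he)
        rw [h] at h1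
        exact hG.loopless.1 _ _ h1 }
  have hC : C.Models G := ⟨by simp [C], by simp [C], fun e he => hxy e (by simpa [C] using he)⟩
  have hs : ∃ s, ¬ (C.withSgn s).Col := by
    by_contra! h
    exact hG.not_colorable (hC.colorable (fun v => by simp [C]) h)
  obtain ⟨s, hs⟩ := hs
  have hCs : (C.withSgn s).Models G := ⟨hC.1, hC.2, hC.3⟩
  refine ⟨C.withSgn s, hCs, fun v => by simp [C], hs, fun S hS => ?_⟩
  refine (hCs.restrict S).col_of_colorable (fun v => by simp [C]) (hG.colorable_of_lt _ ?_)
  refine lt_of_le_of_ne (Graph.induce_le ?_) fun h => ?_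
  · rw [hCs.vertexSet_eq]
    exact Set.inter_subset_left
  · have h1 := congrArg Graph.vertexSet h
    rw [hCs.vertexSet_eq] at h1
    change (((C.withSgn s).V : Set α) ∩ S) = _ at h1
    exact hS.2 (by exact_mod_cast Set.inter_eq_left.1 h1)

/-- The underlying multigraph. -/
def toGraph (C : SignedGraph α β) : Graph α β :=
  graphOfEnds C.V C.E C.fst C.snd C.fst_mem C.snd_mem

lemma models_toGraph : C.Models C.toGraph :=
  ⟨rfl, rfl, fun _ he => ⟨he, Or.inl ⟨rfl, rfl⟩⟩⟩

/-- The potential of a set of vertices with given weights. -/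
def pot (C : SignedGraph α β) (g : α → ℤ) (B : ℤ) (S : Finset α) : ℤ :=
  ∑ v ∈ S, g v - B * (C.inside S).card

/-- The potential is at least `τ`, except that it is `τ - 1` for the set of all vertices. -/
def Tight (C : SignedGraph α β) (g : α → ℤ) (B τ : ℤ) : Prop :=
  C.pot g B C.V = τ - 1 ∧ ∀ S ⊂ C.V, S.Nonempty → τ ≤ C.pot g B S

/-- Only `V` lies below `τ`, and only by one. A proper subgraph that keeps all vertices has lost an
edge, which adds `B ≥ 1`. Signs play no part, so all covers of the subgraph are coloured at once. -/
lemma isCritical_toGraph {i j : ℕ} {F B τ : ℤ} (hB : 0 < B)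
    (hsparse : ∀ C' : SignedGraph α β, C'.Full i j →
      (∀ S ⊆ C'.V, S.Nonempty → τ ≤ C'.pot (fun _ => F) B S) → C'.Col)
    (hfull : C.Full i j) (hC : ¬ C.Col) (htight : C.Tight (fun _ => F) B τ) :
    IsCritical i j C.toGraph where
  finite_vertexSet := C.V.finite_toSet
  finite_edgeSet := C.E.finite_toSet
  loopless := ⟨fun e x ⟨he, hx⟩ => C.fst_ne_snd e he (by grind)⟩
  not_colorable h := hC (models_toGraph.col_of_colorable hfull h)
  colorable_of_lt G' hG' := by
    classical
    have hlink : ∀ e ∈ C.E, e ∈ G'.edgeSet → G'.IsLink e (C.fst e) (C.snd e) := by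
      intro e he he'
      rw [hG'.le.isLink_iff he']
      exact ⟨he, Or.inl ⟨rfl, rfl⟩⟩
    let C' : SignedGraph α β :=
      { V := C.V.filter (· ∈ G'.vertexSet)
        E := C.E.filter (· ∈ G'.edgeSet)
        fst := C.fst
        snd := C.snd
        sgn := C.sgn
        slots := fun _ κ => if κ then j + 1 else i + 1
        fst_mem := fun e he => by
          rw [Finset.mem_filter] at he ⊢
          exact ⟨C.fst_mem e he.1, (hlink e he.1 he.2).left_mem⟩
        snd_mem := fun e he => by
          rw [Finset.mem_filter] at he ⊢
          exact ⟨C.snd_mem e he.1, (hlink e he.1 he.2).right_mem⟩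
        fst_ne_snd := fun e he => C.fst_ne_snd e (Finset.mem_filter.1 he).1 }
    have hV : G'.vertexSet = C'.V := by
      ext v
      simp only [C', Finset.coe_filter, Set.mem_ofPred_eq]
      exact ⟨fun h => ⟨Graph.IsSubgraph.vertexSet_mono hG'.le h, h⟩, fun h => h.2⟩
    have hE : G'.edgeSet = C'.E := by
      ext e
      simp only [C', Finset.coe_filter, Set.mem_ofPred_eq]
      exact ⟨fun h => ⟨Graph.IsSubgraph.edgeSet_mono hG'.le h, h⟩, fun h => h.2⟩
    have hmodels : C'.Models G' := ⟨hV, hE, fun e he => by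
      simp only [C', Finset.mem_filter] at he
      exact hlink e he.1 he.2⟩
    have hfull' : C'.Full i j := fun v => by simp [C']
    refine hmodels.colorable hfull' fun s => hsparse _ hfull' fun S hS hne => ?_
    have hSV : S ⊆ C.V := hS.trans (Finset.filter_subset _ _)
    have hsub : (C'.withSgn s).inside S ⊆ C.inside S := by
      intro e he
      rw [mem_inside] at he ⊢
      exact ⟨(Finset.mem_filter.1 he.1).1, he.2⟩
    unfold pot
    rcases hSV.eq_or_ssubset with rfl | hss
    · have hlt : ((C'.withSgn s).inside C.V).card < (C.inside C.V).card := by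
        refine Finset.card_lt_card (hsub.ssubset_of_ne fun h => hG'.not_ge ?_)
        refine ⟨fun v hv => ?_, fun e x y he => ?_⟩
        · rw [hV]
          exact hS hv
        · have he1 : e ∈ C.E := he.1
          rw [← inside_V, ← h, mem_inside] at he1
          have he2 : e ∈ G'.edgeSet := by
            rw [hE]
            exact he1.1
          rwa [hG'.le.isLink_iff he2]
      have h1 := htight.1
      unfold pot at h1
      have h2 : (((C'.withSgn s).inside C.V).card : ℤ) + 1 ≤ (C.inside C.V).card := by
        exact_mod_cast hlt
      nlinarith
    · have h1 := htight.2 S hss hne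
      unfold pot at h1
      have h2 : (((C'.withSgn s).inside S).card : ℤ) ≤ (C.inside S).card := by
        exact_mod_cast Finset.card_le_card hsub
      nlinarith

end Critical

/-! ### Relabelling by natural numbers -/

section Relabel

/-- Relabel vertices and edges by natural numbers. -/
@[simps] noncomputable def relabel (C : SignedGraph α β) (a : α ↪ ℕ) (b : β ↪ ℕ)
    (k : Bool → ℕ) :
    SignedGraph ℕ ℕ where
  V := C.V.map a
  E := C.E.map b
  fst := Function.extend b (a ∘ C.fst) fun _ => 0
  snd := Function.extend b (a ∘ C.snd) fun _ => 0
  sgn := Function.extend b C.sgn fun _ => true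
  slots := Function.extend a C.slots fun _ => k
  fst_mem e he := by
    obtain ⟨e, h, rfl⟩ := Finset.mem_map.1 he
    rw [b.injective.extend_apply]
    exact Finset.mem_map_of_mem a (C.fst_mem e h)
  snd_mem e he := by
    obtain ⟨e, h, rfl⟩ := Finset.mem_map.1 he
    rw [b.injective.extend_apply]
    exact Finset.mem_map_of_mem a (C.snd_mem e h)
  fst_ne_snd e he := by
    obtain ⟨e, h, rfl⟩ := Finset.mem_map.1 he
    rw [b.injective.extend_apply, b.injective.extend_apply]
    exact fun h' => C.fst_ne_snd e h (a.injective h')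

variable {a : α ↪ ℕ} {b : β ↪ ℕ} {k : Bool → ℕ}

lemma Full.relabel {i j : ℕ} (h : C.Full i j) (hk : k false = i + 1 ∧ k true = j + 1) :
    (C.relabel a b k).Full i j := by
  intro v
  by_cases hv : ∃ w, a w = v
  · obtain ⟨w, rfl⟩ := hv
    simp only [relabel_slots, a.injective.extend_apply]
    exact h w
  · simp only [relabel_slots, Function.extend_apply' _ _ _ hv]
    exact hk

lemma col_of_col_relabel (h : (C.relabel a b k).Col) : C.Col := by
  obtain ⟨φ, hφ⟩ := h
  refine ⟨φ ∘ a, fun v hv => ?_⟩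
  have h1 := hφ (a v) (Finset.mem_map_of_mem a hv)
  rw [relabel_slots, a.injective.extend_apply] at h1
  have h2 : (C.relabel a b k).deg φ (a v) = C.deg (φ ∘ a) v := by
    unfold deg
    rw [relabel_E, Finset.filter_map, Finset.card_map]
    congr 1
    refine Finset.filter_congr fun e _ => ?_
    simp [Inc, Active, b.injective.extend_apply]
  rwa [h2] at h1

lemma Tight.relabel {F B τ : ℤ} (h : C.Tight (fun _ => F) B τ) :
    (C.relabel a b k).Tight (fun _ => F) B τ := by
  have key : ∀ S, (C.relabel a b k).pot (fun _ => F) B (S.map a) = C.pot (fun _ => F) B S := by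
    intro S
    unfold pot
    have : (C.relabel a b k).inside (S.map a) = (C.inside S).map b := by
      unfold inside
      rw [relabel_E, Finset.filter_map]
      congr 1
      refine Finset.filter_congr fun e _ => ?_
      simp [b.injective.extend_apply]
    rw [this, Finset.card_map, Finset.sum_map]
  refine ⟨(key _).trans h.1, fun S hS hne => ?_⟩
  obtain ⟨T, hT, rfl⟩ := Finset.subset_map_iff.1 hS.1
  rw [key]
  refine h.2 T ?_ (by simpa using hne)
  rw [relabel_V, Finset.map_ssubset_map] at hS
  exact hS

end Relabel

/-! ### The numbers `f_DP(i, j, n)` -/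

section fDP

variable {i j : ℕ}

lemma fDP_eq_top_or (i j n : ℕ) : fDP i j n = ⊤ ∨
    ∃ C : SignedGraph ℕ ℕ, C.Minimal i j ∧ C.V.card = n ∧ fDP i j n = C.E.card := by
  rcases Set.eq_empty_or_nonempty {m : ℕ∞ | ∃ G : Graph ℕ ℕ,
    IsCritical i j G ∧ G.vertexSet.encard = n ∧ G.edgeSet.encard = m} with h | h
  · left
    rw [fDP, h, sInf_empty]
  · right
    obtain ⟨G, hG, hn, hm⟩ := csInf_mem h
    obtain ⟨C, hC, hmin⟩ := exists_minimal_of_isCritical hG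
    rw [hC.vertexSet_eq, Set.encard_coe_eq_coe_finsetCard] at hn
    rw [hC.edgeSet_eq, Set.encard_coe_eq_coe_finsetCard] at hm
    exact ⟨C, hmin, by exact_mod_cast hn, hm.symm⟩

/-- A signed graph that gives an upper bound for `f_DP(i, j, n)`. -/
structure Extremal (C : SignedGraph α β) (i j : ℕ) (F B τ : ℤ) : Prop where
  full : C.Full i j
  not_col : ¬ C.Col
  tight : C.Tight (fun _ => F) B τ

lemma Extremal.fDP_le [Countable α] [Countable β] {F B τ : ℤ} (hB : 0 < B)
    (hsparse : ∀ C' : SignedGraph ℕ ℕ, C'.Full i j →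
      (∀ S ⊆ C'.V, S.Nonempty → τ ≤ C'.pot (fun _ => F) B S) → C'.Col)
    (hC : C.Extremal i j F B τ) : fDP i j C.V.card ≤ C.E.card := by
  obtain ⟨a⟩ := nonempty_embedding_nat α
  obtain ⟨b⟩ := nonempty_embedding_nat β
  refine sInf_le ⟨(C.relabel a b fun κ => if κ then j + 1 else i + 1).toGraph,
    isCritical_toGraph hB hsparse (hC.full.relabel (by simp))
    (fun h => hC.not_col (col_of_col_relabel h)) hC.tight.relabel, ?_, ?_⟩
  · change ((C.V.map a : Finset ℕ) : Set ℕ).encard = _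
    rw [Set.encard_coe_eq_coe_finsetCard, Finset.card_map]
  · change ((C.E.map b : Finset ℕ) : Set ℕ).encard = _
    rw [Set.encard_coe_eq_coe_finsetCard, Finset.card_map]

lemma Extremal.card_eq {F B τ : ℤ} (hC : C.Extremal i j F B τ) :
    F * C.V.card - B * C.E.card = τ - 1 := by
  have := hC.tight.1
  rw [pot, inside_V, Finset.sum_const, nsmul_eq_mul] at this
  linarith

lemma fDPReal_of_fDP_eq {n m : ℕ} (h : fDP i j n = m) : fDPReal i j n = ((m : ℝ) : EReal) := by
  rw [fDPReal, h]
  norm_cast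

/-- `r n` is the number of edges at which the potential of `n` vertices equals `τ - 1`. Critical
multigraphs have at most this potential, extremal ones exactly this. -/
theorem fDPReal_bounds [Countable α] [Countable β] {F B τ : ℤ} (hB : 0 < B) {r : ℕ → ℝ}
    (hr : ∀ n : ℕ, (B : ℝ) * r n = F * n - (τ - 1))
    (hlow : ∀ C : SignedGraph ℕ ℕ, C.Minimal i j → F * C.V.card - B * C.E.card ≤ τ - 1)
    (hsparse : ∀ C' : SignedGraph ℕ ℕ, C'.Full i j →
      (∀ S ⊆ C'.V, S.Nonempty → τ ≤ C'.pot (fun _ => F) B S) → C'.Col)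
    (hfam : ∀ N : ℕ, ∃ C : SignedGraph α β, C.Extremal i j F B τ ∧ N ≤ C.V.card) :
    (∀ n : ℕ, (r n : EReal) ≤ fDPReal i j n) ∧
      {n : ℕ | fDPReal i j n = (r n : EReal)}.Infinite := by
  have hB' : (0 : ℝ) < B := by exact_mod_cast hB
  have hle : ∀ n : ℕ, (r n : EReal) ≤ fDPReal i j n := by
    intro n
    rcases fDP_eq_top_or i j n with h | ⟨C, hmin, rfl, h⟩
    · rw [fDPReal, h]
      simp
    · rw [fDPReal_of_fDP_eq h, EReal.coe_le_coe_iff]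
      have h1 : (F : ℝ) * C.V.card - B * C.E.card ≤ τ - 1 := by exact_mod_cast hlow C hmin
      have h2 := hr C.V.card
      exact le_of_mul_le_mul_left (by linarith) hB'
  refine ⟨hle, Set.infinite_of_not_bddAbove ?_⟩
  rintro ⟨N, hN⟩
  obtain ⟨C, hC, hcard⟩ := hfam (N + 1)
  have hmem : fDPReal i j C.V.card = (r C.V.card : EReal) := by
    refine le_antisymm ?_ (hle _)
    have h1 := hC.fDP_le hB hsparse
    have h2 : r C.V.card = C.E.card := by
      have h3 : (F : ℝ) * C.V.card - B * C.E.card = τ - 1 := by exact_mod_cast hC.card_eq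
      have h4 := hr C.V.card
      exact mul_left_cancel₀ hB'.ne' (by linarith)
    rw [h2]
    obtain ⟨m, hm⟩ := ENat.ne_top_iff_exists.1 (ne_top_of_le_ne_top (ENat.natCast_ne_top _) h1)
    rw [fDPReal_of_fDP_eq hm.symm, EReal.coe_le_coe_iff]
    rw [← hm] at h1
    exact_mod_cast h1
  have := hN hmem
  omega

end fDP

/-! ### The bounds in terms of numbers of vertices and edges -/

section Bounds

variable {i j : ℕ}

lemma rho_eq_pot {f : (Bool → ℕ) → ℤ} {F : ℤ} (hf : ∀ v, f (C.slots v) = F) (B : ℤ)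
    (S : Finset α) : C.rho f B S = C.pot (fun _ => F) B S := by
  simp [rho, pot, hf]

lemma pot_univ (F B : ℤ) : C.pot (fun _ => F) B C.V = F * C.V.card - B * C.E.card := by
  rw [pot, inside_V, Finset.sum_const, nsmul_eq_mul]
  ring

lemma Full.maxWeight (h : C.Full i j) (F L : ℤ) (v : α) :
    maxWeight F L i j (C.slots v) = F := by
  simp [SignedGraph.maxWeight, h v]

lemma Full.nearWeight (h : C.Full i (i + 1)) (v : α) :
    nearWeight i (C.slots v) = 2 * i ^ 2 + 4 * i + 1 := by
  simp [SignedGraph.nearWeight, h v]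

lemma Full.balancedWeight (h : C.Full i i) (v : α) :
    balancedWeight i (C.slots v) = 2 * i + 2 := by
  simp [SignedGraph.balancedWeight, h v]
  ring

lemma Minimal.card_add_le (h : C.Minimal 0 j) : C.V.card + j ≤ C.E.card :=
  card_add_le_of_not_col (fun v _ => ⟨(h.full v).1.ge, (h.full v).2.ge⟩) h.not_col h.col_restrict

lemma col_of_pot_zero (hfull : C.Full 0 j)
    (h : ∀ S ⊆ C.V, S.Nonempty → 1 - (j : ℤ) ≤ C.pot (fun _ => 1) 1 S) : C.Col := by
  refine col_of_sparse_zero (fun v _ => ⟨(hfull v).1.ge, (hfull v).2.ge⟩) fun S hS hne => ?_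
  have := h S hS hne
  simp only [pot, Finset.sum_const, nsmul_eq_mul] at this
  zify
  linarith

lemma Minimal.pot_le_maxWeight {F L B : ℤ} (hij : i + 2 ≤ j) (hL : 0 < L) (hFB : F + L ≤ 2 * B)
    (h2L : 2 * L ≤ B) (hσ : F ≤ L * j) (hF : F ≤ B + L * i) (h : C.Minimal i j) :
    F * C.V.card - B * C.E.card ≤ F - L * j - L + 1 - 1 := by
  have := rho_lt_of_not_col_maxWeight hij hL hFB h2L hσ hF h.not_col h.col_restrict
  rw [rho_eq_pot (h.full.maxWeight F L), pot_univ] at this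
  linarith

lemma col_of_pot_maxWeight {F L B : ℤ} (hij : i + 2 ≤ j) (hL : 0 < L) (hFB : F + L ≤ 2 * B)
    (h2L : 2 * L ≤ B) (hσ : F ≤ L * j) (hF : F ≤ B + L * i) (hfull : C.Full i j)
    (h : ∀ S ⊆ C.V, S.Nonempty → F - L * j - L + 1 ≤ C.pot (fun _ => F) B S) : C.Col := by
  refine col_of_sparse_maxWeight hij hL hFB h2L hσ hF fun S hS hne => ?_
  rw [rho_eq_pot (hfull.maxWeight F L)]
  exact h S hS hne

lemma Minimal.pot_le_near (hi : 1 ≤ i) (h : C.Minimal i (i + 1)) :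
    (2 * (i : ℤ) ^ 2 + 4 * i + 1) * C.V.card - ((i : ℤ) ^ 2 + 3 * i + 1) * C.E.card ≤ 0 - 1 := by
  have := rho_lt_of_not_col_near hi h.not_col h.col_restrict
  rw [rho_eq_pot h.full.nearWeight, pot_univ] at this
  linarith

lemma col_of_pot_near (hi : 1 ≤ i) (hfull : C.Full i (i + 1))
    (h : ∀ S ⊆ C.V, S.Nonempty →
      0 ≤ C.pot (fun _ => 2 * (i : ℤ) ^ 2 + 4 * i + 1) ((i : ℤ) ^ 2 + 3 * i + 1) S) : C.Col := by
  refine col_of_sparse_near hi fun S hS hne => ?_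
  rw [rho_eq_pot hfull.nearWeight]
  exact h S hS hne

lemma Minimal.pot_le_balanced (hi : 1 ≤ i) (h : C.Minimal i i) :
    (2 * (i : ℤ) + 2) * C.V.card - ((i : ℤ) + 2) * C.E.card ≤ 1 - 1 := by
  have := rho_lt_of_not_col_balanced hi (fun v => (h.full v).1.trans (h.full v).2.symm) h.not_col
    h.col_restrict
  rw [rho_eq_pot h.full.balancedWeight, pot_univ] at this
  linarith

lemma col_of_pot_balanced (hi : 1 ≤ i) (hfull : C.Full i i)
    (h : ∀ S ⊆ C.V, S.Nonempty → 1 ≤ C.pot (fun _ => 2 * (i : ℤ) + 2) ((i : ℤ) + 2) S) :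
    C.Col := by
  refine col_of_sparse_balanced hi (fun v => (hfull v).1.trans (hfull v).2.symm)
    fun S hS hne => ?_
  rw [rho_eq_pot hfull.balancedWeight]
  exact h S hS hne

end Bounds

/-! ### Attaching double edges to leaves -/

section Leaves

/-- Attach `ℓ v` new vertices to each vertex `v`, each of them by one edge of each sign. -/
def addLeaves (C : SignedGraph α β) (ℓ : α → ℕ) :
    SignedGraph (α ⊕ (_ : α) × ℕ) (β ⊕ ((_ : α) × ℕ) × Bool) where
  V := C.V.disjSum (C.V.sigma fun v => Finset.range (ℓ v))
  E := C.E.disjSum ((C.V.sigma fun v => Finset.range (ℓ v)) ×ˢ Finset.univ)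
  fst := Sum.elim (fun e => Sum.inl (C.fst e)) fun p => Sum.inl p.1.1
  snd := Sum.elim (fun e => Sum.inl (C.snd e)) fun p => Sum.inr p.1
  sgn := Sum.elim C.sgn fun p => p.2
  slots := Sum.elim C.slots fun p => C.slots p.1
  fst_mem := by
    rintro (e | p) he
    · simpa using C.fst_mem e (by simpa using he)
    · have : p.1.1 ∈ C.V ∧ p.1.2 < ℓ p.1.1 := by simpa using he
      simpa using this.1
  snd_mem := by
    rintro (e | p) he
    · simpa using C.snd_mem e (by simpa using he)
    · simpa using he
  fst_ne_snd := by
    rintro (e | p) he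
    · simpa using C.fst_ne_snd e (by simpa using he)
    · simp

variable {ℓ : α → ℕ}

/-- Whatever the colours, exactly one of the two edges to a leaf is violated. -/
lemma col_of_col_addLeaves (h : (C.addLeaves ℓ).Col) :
    (C.withSlots fun v κ => C.slots v κ - ℓ v).Col := by
  obtain ⟨φ, hφ⟩ := h
  refine ⟨fun v => φ (Sum.inl v), fun v hv => ?_⟩
  have h1 := hφ (Sum.inl v) (by simpa [addLeaves] using hv)
  have h2 : C.deg (fun v => φ (Sum.inl v)) v + ℓ v ≤ (C.addLeaves ℓ).deg φ (Sum.inl v) := by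
    have hinj : Function.Injective fun a : ℕ => (Sum.inr (⟨v, a⟩,
        φ (Sum.inl v) ^^ φ (Sum.inr ⟨v, a⟩)) : β ⊕ ((_ : α) × ℕ) × Bool) := by
      intro a b hab
      simp only [Sum.inr.injEq, Prod.mk.injEq, Sigma.mk.injEq, heq_eq_eq, true_and] at hab
      exact hab.1
    have hsub : ((C.E.filter fun e => C.Inc v e ∧ C.Active (fun v => φ (Sum.inl v)) e).map
        Function.Embedding.inl) ∪ (Finset.range (ℓ v)).map ⟨_, hinj⟩ ⊆
        (C.addLeaves ℓ).E.filter fun e =>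
          (C.addLeaves ℓ).Inc (Sum.inl v) e ∧ (C.addLeaves ℓ).Active φ e := by
      intro e he
      simp only [Finset.mem_union, Finset.mem_map, Finset.mem_filter, Finset.mem_range] at he
      rcases he with ⟨e, ⟨he, hi, ha⟩, rfl⟩ | ⟨a, ha, rfl⟩
      · refine Finset.mem_filter.2 ⟨by simpa [addLeaves] using he, ?_, ha⟩
        simpa [Inc, addLeaves] using hi
      · exact Finset.mem_filter.2 ⟨Finset.inr_mem_disjSum.2 (Finset.mem_product.2
          ⟨Finset.mem_sigma.2 ⟨hv, Finset.mem_range.2 ha⟩, Finset.mem_univ _⟩), Or.inl rfl, rfl⟩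
    have h3 := Finset.card_le_card hsub
    rw [Finset.card_union_of_disjoint, Finset.card_map, Finset.card_map, Finset.card_range] at h3
    · exact h3
    · rw [Finset.disjoint_left]
      intro e he he'
      obtain ⟨_, -, rfl⟩ := Finset.mem_map.1 he
      obtain ⟨_, -, h⟩ := Finset.mem_map.1 he'
      simp at h
  simp only [withSlots_slots]
  have h3 : (C.addLeaves ℓ).slots (Sum.inl v) = C.slots v := rfl
  rw [h3] at h1
  rw [deg_withSlots]
  omega

lemma card_addLeaves_V : (C.addLeaves ℓ).V.card = C.V.card + ∑ v ∈ C.V, ℓ v := by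
  simp [addLeaves]

lemma Full.addLeaves {i j : ℕ} (h : C.Full i j) : (C.addLeaves ℓ).Full i j := by
  rintro (v | p)
  exacts [h v, h p.1]

/-- The potential as a sum over all vertices and edges. -/
lemma pot_eq_sum (g : α → ℤ) (B : ℤ) {S : Finset α} (hS : S ⊆ C.V) :
    C.pot g B S = ∑ v ∈ C.V, (if v ∈ S then g v else 0) -
      ∑ e ∈ C.E, if C.fst e ∈ S ∧ C.snd e ∈ S then B else 0 := by
  rw [pot, ← Finset.sum_filter, ← Finset.sum_filter, Finset.sum_const, nsmul_eq_mul, inside,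
    Finset.filter_mem_eq_inter, Finset.inter_eq_right.2 hS, mul_comm]

lemma pot_addLeaves (g : α ⊕ (_ : α) × ℕ → ℤ) (B : ℤ) {L : ℤ}
    (S : Finset (α ⊕ (_ : α) × ℕ)) (hS : S ⊆ (C.addLeaves ℓ).V) :
    (C.addLeaves ℓ).pot g B S = C.pot (fun v => g (Sum.inl v) - L * ℓ v) B S.toLeft +
      ∑ p ∈ C.V.sigma fun v => Finset.range (ℓ v), ((if Sum.inr p ∈ S then g (Sum.inr p) else 0) -
        (if Sum.inl p.1 ∈ S ∧ Sum.inr p ∈ S then 2 * B else 0) +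
        if Sum.inl p.1 ∈ S then L else 0) := by
  have hS' : S.toLeft ⊆ C.V := by
    intro v hv
    have := hS (Finset.mem_toLeft.1 hv)
    simpa [addLeaves] using this
  set P := C.V.sigma fun v => Finset.range (ℓ v) with hP
  have hV : ∑ x ∈ (C.addLeaves ℓ).V, (if x ∈ S then g x else 0) =
      ∑ v ∈ C.V, (if Sum.inl v ∈ S then g (Sum.inl v) else 0) +
        ∑ p ∈ P, if Sum.inr p ∈ S then g (Sum.inr p) else 0 := Finset.sum_disjSum ..
  have hE : ∑ e ∈ (C.addLeaves ℓ).E,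
      (if (C.addLeaves ℓ).fst e ∈ S ∧ (C.addLeaves ℓ).snd e ∈ S then B else 0) =
      ∑ e ∈ C.E, (if Sum.inl (C.fst e) ∈ S ∧ Sum.inl (C.snd e) ∈ S then B else 0) +
        ∑ p ∈ P, if Sum.inl p.1 ∈ S ∧ Sum.inr p ∈ S then 2 * B else 0 := by
    refine (Finset.sum_disjSum ..).trans (congrArg₂ _ rfl ?_)
    rw [Finset.sum_product]
    refine Finset.sum_congr rfl fun p _ => ?_
    change ∑ _b : Bool, (if Sum.inl p.1 ∈ S ∧ Sum.inr p ∈ S then B else 0) = _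
    rw [Finset.sum_const, Finset.card_univ, Fintype.card_bool, smul_ite, smul_zero, nsmul_eq_mul]
    rfl
  have h1 : ∑ p ∈ P, (if Sum.inl p.1 ∈ S then L else 0) =
      ∑ v ∈ C.V, if Sum.inl v ∈ S then L * ℓ v else 0 := by
    rw [hP, Finset.sum_sigma]
    refine Finset.sum_congr rfl fun v _ => ?_
    split_ifs <;> simp [mul_comm]
  have h2 : ∑ v ∈ C.V, (if Sum.inl v ∈ S then g (Sum.inl v) - L * ℓ v else 0) =
      ∑ v ∈ C.V, (if Sum.inl v ∈ S then g (Sum.inl v) else 0) -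
        ∑ v ∈ C.V, if Sum.inl v ∈ S then L * ℓ v else 0 := by
    rw [← Finset.sum_sub_distrib]
    refine Finset.sum_congr rfl fun v _ => ?_
    split_ifs <;> simp
  rw [pot_eq_sum _ _ hS, pot_eq_sum _ _ hS', hV, hE, Finset.sum_add_distrib,
    Finset.sum_sub_distrib, h1]
  simp only [Finset.mem_toLeft]
  rw [h2]
  ring

/-- A leaf with its two edges changes the potential by `F - 2 * B`, charged to the vertex that
carries it. A set that contains the vertex but omits the leaf gains `2 * B - F ≥ 1`; a leaf without
its neighbour contributes `F`. -/
lemma Tight.addLeaves {F B τ : ℤ} (hL : 0 < 2 * B - F) (hF : 0 ≤ F) (hτ : τ ≤ F)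
    (h : C.Tight (fun v => F - (2 * B - F) * ℓ v) B τ) :
    (C.addLeaves ℓ).Tight (fun _ => F) B τ := by
  have hterm : ∀ (S : Finset (α ⊕ (_ : α) × ℕ)) p,
      (0 : ℤ) ≤ (if Sum.inr p ∈ S then F else 0) -
        (if Sum.inl p.1 ∈ S ∧ Sum.inr p ∈ S then 2 * B else 0) +
        if Sum.inl p.1 ∈ S then 2 * B - F else 0 := by
    intro S p
    by_cases h1 : Sum.inl p.1 ∈ S <;> by_cases h2 : Sum.inr p ∈ S <;> simp [h1, h2] <;> linarith
  have hleft : (C.addLeaves ℓ).V.toLeft = C.V := by simp [SignedGraph.addLeaves]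
  constructor
  · rw [pot_addLeaves _ _ (L := 2 * B - F) _ subset_rfl, hleft, h.1, Finset.sum_eq_zero, add_zero]
    intro p hp
    have h1 : Sum.inr p ∈ (C.addLeaves ℓ).V := by simpa [SignedGraph.addLeaves] using hp
    have h2 : Sum.inl p.1 ∈ (C.addLeaves ℓ).V := by
      simpa [SignedGraph.addLeaves] using (Finset.mem_sigma.1 hp).1
    simp [h1, h2]
  · intro S hS hne
    rw [pot_addLeaves _ _ (L := 2 * B - F) _ hS.1]
    have hsub : S.toLeft ⊆ C.V := by
      rw [← hleft]
      exact Finset.toLeft_subset_toLeft hS.1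
    rcases hsub.eq_or_ssubset with heq | hss
    · rw [heq, h.1]
      obtain ⟨x, hx, hxS⟩ := Finset.exists_of_ssubset hS
      rcases x with v | p
      · refine absurd ?_ hxS
        rw [← Finset.mem_toLeft, heq]
        simpa [SignedGraph.addLeaves] using hx
      · have hp : p ∈ C.V.sigma fun v => Finset.range (ℓ v) := by
          simpa [SignedGraph.addLeaves] using hx
        have h1 : Sum.inl p.1 ∈ S := by
          rw [← Finset.mem_toLeft, heq]
          exact (Finset.mem_sigma.1 hp).1
        have h2 := Finset.single_le_sum (fun p _ => hterm S p) hp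
        simp only [h1, hxS, if_true, if_false, and_false] at h2
        linarith
    · have h0 := Finset.sum_nonneg fun p (_ : p ∈ C.V.sigma fun v => Finset.range (ℓ v)) =>
        hterm S p
      rcases S.toLeft.eq_empty_or_nonempty with he | hne'
      · obtain ⟨x, hx⟩ := hne
        rcases x with v | p
        · rw [← Finset.mem_toLeft, he] at hx
          simp at hx
        · have hp : p ∈ C.V.sigma fun v => Finset.range (ℓ v) := by
            simpa [SignedGraph.addLeaves] using hS.1 hx
          have h1 : Sum.inl p.1 ∉ S := by
            rw [← Finset.mem_toLeft, he]
            simp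
          have h2 := Finset.single_le_sum (fun p _ => hterm S p) hp
          simp only [h1, hx, if_true, if_false, false_and] at h2
          rw [he]
          simp only [pot, inside, Finset.sum_empty, Finset.notMem_empty, false_and,
            Finset.filter_false, Finset.card_empty]
          push_cast
          linarith
      · linarith [h.2 _ hss hne']

end Leaves

/-! ### Attaching paths of length two -/

section Gadgets

/-- Attach `ℓ v` paths of length two to each vertex `v`; their edges have sign `true`. -/
def addPaths (C : SignedGraph α β) (ℓ : α → ℕ) :
    SignedGraph (α ⊕ ((_ : α) × ℕ) × Bool) (β ⊕ ((_ : α) × ℕ) × Bool) where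
  V := C.V.disjSum ((C.V.sigma fun v => Finset.range (ℓ v)) ×ˢ Finset.univ)
  E := C.E.disjSum ((C.V.sigma fun v => Finset.range (ℓ v)) ×ˢ Finset.univ)
  fst := Sum.elim (fun e => Sum.inl (C.fst e))
    fun p => if p.2 then Sum.inr (p.1, false) else Sum.inl p.1.1
  snd := Sum.elim (fun e => Sum.inl (C.snd e)) fun p => Sum.inr p
  sgn := Sum.elim C.sgn fun _ => true
  slots := Sum.elim C.slots fun p => C.slots p.1.1
  fst_mem := by
    rintro (e | ⟨p, b⟩) he
    · simpa using C.fst_mem e (by simpa using he)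
    · have : p.1 ∈ C.V ∧ p.2 < ℓ p.1 := by simpa using he
      cases b <;> simp [this]
  snd_mem := by
    rintro (e | p) he
    · simpa using C.snd_mem e (by simpa using he)
    · simpa using he
  fst_ne_snd := by
    rintro (e | ⟨p, b⟩) he
    · simpa using C.fst_ne_snd e (by simpa using he)
    · cases b <;> simp

variable {ℓ : α → ℕ}

lemma Full.addPaths {i j : ℕ} (h : C.Full i j) : (C.addPaths ℓ).Full i j := by
  rintro (v | p)
  exacts [h v, h p.1.1]

lemma not_active_of_deg_lt_one {φ : α → Bool} {v : α} (h : C.deg φ v < 1) {e : β} (he : e ∈ C.E)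
    (hi : C.Inc v e) : ¬ C.Active φ e := by
  intro ha
  have : 0 < C.deg φ v := Finset.card_pos.2 ⟨e, Finset.mem_filter.2 ⟨he, hi, ha⟩⟩
  omega

/-- If the ends of the attached paths have to be rich, without violated edges, then each path
takes one poor slot. -/
lemma col_of_col_addPaths {k : α ⊕ ((_ : α) × ℕ) × Bool → Bool → ℕ}
    (hk : ∀ p, k (Sum.inr (p, true)) false = 0 ∧ k (Sum.inr (p, true)) true ≤ 1)
    (h : ((C.addPaths ℓ).withSlots k).Col) :
    (C.withSlots fun v κ => k (Sum.inl v) κ - if κ then 0 else ℓ v).Col := by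
  obtain ⟨φ, hφ⟩ := h
  refine ⟨fun v => φ (Sum.inl v), fun v hv => ?_⟩
  change v ∈ C.V at hv
  have h1 := hφ (Sum.inl v) (by simpa [addPaths] using hv)
  rw [deg_withSlots, withSlots_slots] at h1
  change C.deg (fun v => φ (Sum.inl v)) v <
    k (Sum.inl v) (φ (Sum.inl v)) - if φ (Sum.inl v) then 0 else ℓ v
  -- The far end is rich and tolerates no violation, so the middle vertex is rich too; its edge to
  -- `v` is then violated exactly when `v` is poor.
  have hrich : ∀ a < ℓ v, φ (Sum.inr (⟨v, a⟩, false)) = true := by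
    intro a ha
    have hp : (⟨v, a⟩ : (_ : α) × ℕ) ∈ C.V.sigma fun v => Finset.range (ℓ v) :=
      Finset.mem_sigma.2 ⟨hv, Finset.mem_range.2 ha⟩
    have h2 := hφ (Sum.inr (⟨v, a⟩, true)) (by simpa [addPaths] using hp)
    rw [deg_withSlots, withSlots_slots] at h2
    have h3 := hk ⟨v, a⟩
    have h4 : φ (Sum.inr (⟨v, a⟩, true)) = true := by
      by_contra h4
      rw [Bool.not_eq_true] at h4
      rw [h4] at h2
      omega
    rw [h4] at h2
    have h5 := not_active_of_deg_lt_one (lt_of_lt_of_le h2 h3.2) (e := Sum.inr (⟨v, a⟩, true))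
      (by simpa [addPaths] using hp) (Or.inr rfl)
    have h6 : ¬ (φ (Sum.inr (⟨v, a⟩, false)) ^^ φ (Sum.inr (⟨v, a⟩, true))) = true := h5
    rw [h4] at h6
    simpa using h6
  cases hc : φ (Sum.inl v)
  · have h2 : C.deg (fun v => φ (Sum.inl v)) v + ℓ v ≤ (C.addPaths ℓ).deg φ (Sum.inl v) := by
      have hinj : Function.Injective fun a : ℕ =>
          (Sum.inr (⟨v, a⟩, false) : β ⊕ ((_ : α) × ℕ) × Bool) := by
        intro a b hab
        simpa using hab
      have hsub : ((C.E.filter fun e => C.Inc v e ∧ C.Active (fun v => φ (Sum.inl v)) e).map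
          Function.Embedding.inl) ∪ (Finset.range (ℓ v)).map ⟨_, hinj⟩ ⊆
          (C.addPaths ℓ).E.filter fun e =>
            (C.addPaths ℓ).Inc (Sum.inl v) e ∧ (C.addPaths ℓ).Active φ e := by
        intro e he
        simp only [Finset.mem_union, Finset.mem_map, Finset.mem_filter, Finset.mem_range] at he
        rcases he with ⟨e, ⟨he, hi, ha⟩, rfl⟩ | ⟨a, ha, rfl⟩
        · refine Finset.mem_filter.2 ⟨by simpa [addPaths] using he, ?_, ha⟩
          simpa [Inc, addPaths] using hi
        · refine Finset.mem_filter.2 ⟨Finset.inr_mem_disjSum.2 (Finset.mem_product.2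
            ⟨Finset.mem_sigma.2 ⟨hv, Finset.mem_range.2 ha⟩, Finset.mem_univ _⟩), Or.inl rfl, ?_⟩
          change (φ (Sum.inl v) ^^ φ (Sum.inr (⟨v, a⟩, false))) = true
          rw [hc, hrich a ha]
          rfl
      have h3 := Finset.card_le_card hsub
      rw [Finset.card_union_of_disjoint, Finset.card_map, Finset.card_map,
        Finset.card_range] at h3
      · exact h3
      · rw [Finset.disjoint_left]
        intro e he he'
        obtain ⟨_, -, rfl⟩ := Finset.mem_map.1 he
        obtain ⟨_, -, h⟩ := Finset.mem_map.1 he'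
        simp at h
    rw [hc] at h1
    simp only [Bool.false_eq_true, if_false]
    omega
  · have h2 : C.deg (fun v => φ (Sum.inl v)) v ≤ (C.addPaths ℓ).deg φ (Sum.inl v) := by
      unfold deg
      rw [← Finset.card_map Function.Embedding.inl]
      refine Finset.card_le_card fun e he => ?_
      obtain ⟨e, h2, rfl⟩ := Finset.mem_map.1 he
      obtain ⟨he, hi, ha⟩ := Finset.mem_filter.1 h2
      refine Finset.mem_filter.2 ⟨by simpa [addPaths] using he, ?_, ha⟩
      simpa [Inc, addPaths] using hi
    rw [hc] at h1
    simp only [if_true, Nat.sub_zero]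
    omega

lemma pot_addPaths (g : α ⊕ ((_ : α) × ℕ) × Bool → ℤ) (B : ℤ) {L : ℤ}
    (S : Finset (α ⊕ ((_ : α) × ℕ) × Bool)) (hS : S ⊆ (C.addPaths ℓ).V) :
    (C.addPaths ℓ).pot g B S = C.pot (fun v => g (Sum.inl v) - L * ℓ v) B S.toLeft +
      ∑ p ∈ C.V.sigma fun v => Finset.range (ℓ v),
        ((if Sum.inr (p, true) ∈ S then g (Sum.inr (p, true)) else 0) +
          (if Sum.inr (p, false) ∈ S then g (Sum.inr (p, false)) else 0) -
          ((if Sum.inr (p, false) ∈ S ∧ Sum.inr (p, true) ∈ S then B else 0) +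
          if Sum.inl p.1 ∈ S ∧ Sum.inr (p, false) ∈ S then B else 0) +
          if Sum.inl p.1 ∈ S then L else 0) := by
  have hS' : S.toLeft ⊆ C.V := by
    intro v hv
    have := hS (Finset.mem_toLeft.1 hv)
    simpa [addPaths] using this
  set P := C.V.sigma fun v => Finset.range (ℓ v) with hP
  have hV : ∑ x ∈ (C.addPaths ℓ).V, (if x ∈ S then g x else 0) =
      ∑ v ∈ C.V, (if Sum.inl v ∈ S then g (Sum.inl v) else 0) +
        ∑ p ∈ P, ((if Sum.inr (p, true) ∈ S then g (Sum.inr (p, true)) else 0) +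
          if Sum.inr (p, false) ∈ S then g (Sum.inr (p, false)) else 0) := by
    refine (Finset.sum_disjSum ..).trans (congrArg₂ _ rfl ?_)
    rw [Finset.sum_product]
    exact Finset.sum_congr rfl fun p _ => Fintype.sum_bool _
  have hE : ∑ e ∈ (C.addPaths ℓ).E,
      (if (C.addPaths ℓ).fst e ∈ S ∧ (C.addPaths ℓ).snd e ∈ S then B else 0) =
      ∑ e ∈ C.E, (if Sum.inl (C.fst e) ∈ S ∧ Sum.inl (C.snd e) ∈ S then B else 0) +
        ∑ p ∈ P, ((if Sum.inr (p, false) ∈ S ∧ Sum.inr (p, true) ∈ S then B else 0) +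
          if Sum.inl p.1 ∈ S ∧ Sum.inr (p, false) ∈ S then B else 0) := by
    refine (Finset.sum_disjSum ..).trans (congrArg₂ _ rfl ?_)
    rw [Finset.sum_product]
    exact Finset.sum_congr rfl fun p _ => Fintype.sum_bool _
  have h1 : ∑ p ∈ P, (if Sum.inl p.1 ∈ S then L else 0) =
      ∑ v ∈ C.V, if Sum.inl v ∈ S then L * ℓ v else 0 := by
    rw [hP, Finset.sum_sigma]
    refine Finset.sum_congr rfl fun v _ => ?_
    split_ifs <;> simp [mul_comm]
  have h2 : ∑ v ∈ C.V, (if Sum.inl v ∈ S then g (Sum.inl v) - L * ℓ v else 0) =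
      ∑ v ∈ C.V, (if Sum.inl v ∈ S then g (Sum.inl v) else 0) -
        ∑ v ∈ C.V, if Sum.inl v ∈ S then L * ℓ v else 0 := by
    rw [← Finset.sum_sub_distrib]
    refine Finset.sum_congr rfl fun v _ => ?_
    split_ifs <;> simp
  rw [pot_eq_sum _ _ hS, pot_eq_sum _ _ hS', hV, hE]
  simp only [Finset.mem_toLeft, Finset.sum_add_distrib, Finset.sum_sub_distrib]
  rw [h1, h2]
  ring

/-- A whole path with its two edges contributes `-L`, charged to `v`. After this charge no part of a
path contributes negatively, and a path with a missing vertex contributes a positive amount if `v`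
is present. -/
lemma Tight.addPaths {g : α ⊕ ((_ : α) × ℕ) × Bool → ℤ} {B τ L x t : ℤ} (hL : L = 2 * B - x - t)
    (hx : ∀ p, g (Sum.inr (p, false)) = x) (ht : ∀ p, g (Sum.inr (p, true)) = t) (hL0 : 0 < L)
    (ht0 : 0 ≤ t) (hxt : B ≤ x + t) (htB : t < B) (hτ : τ ≤ 0)
    (h : C.Tight (fun v => g (Sum.inl v) - L * ℓ v) B τ) :
    (C.addPaths ℓ).Tight g B τ := by
  have hterm : ∀ (S : Finset (α ⊕ ((_ : α) × ℕ) × Bool)) p,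
      (0 : ℤ) ≤ (if Sum.inr (p, true) ∈ S then g (Sum.inr (p, true)) else 0) +
          (if Sum.inr (p, false) ∈ S then g (Sum.inr (p, false)) else 0) -
          ((if Sum.inr (p, false) ∈ S ∧ Sum.inr (p, true) ∈ S then B else 0) +
          if Sum.inl p.1 ∈ S ∧ Sum.inr (p, false) ∈ S then B else 0) +
          if Sum.inl p.1 ∈ S then L else 0 := by
    intro S p
    rw [hx, ht]
    by_cases h1 : Sum.inl p.1 ∈ S <;> by_cases h2 : Sum.inr (p, false) ∈ S <;>
      by_cases h3 : Sum.inr (p, true) ∈ S <;> simp [h1, h2, h3] <;> linarith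
  have hleft : (C.addPaths ℓ).V.toLeft = C.V := by simp [SignedGraph.addPaths]
  constructor
  · rw [pot_addPaths _ _ (L := L) _ subset_rfl, hleft, h.1, Finset.sum_eq_zero, add_zero]
    intro p hp
    have h1 : ∀ b, Sum.inr (p, b) ∈ (C.addPaths ℓ).V := by
      simpa [SignedGraph.addPaths] using hp
    have h2 : Sum.inl p.1 ∈ (C.addPaths ℓ).V := by
      simpa [SignedGraph.addPaths] using (Finset.mem_sigma.1 hp).1
    rw [hx, ht]
    simp only [h1, h2, and_self, if_true]
    linarith
  · intro S hS hne
    rw [pot_addPaths _ _ (L := L) _ hS.1]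
    have hsub : S.toLeft ⊆ C.V := by
      rw [← hleft]
      exact Finset.toLeft_subset_toLeft hS.1
    have h0 := Finset.sum_nonneg fun p (_ : p ∈ C.V.sigma fun v => Finset.range (ℓ v)) =>
      hterm S p
    rcases hsub.eq_or_ssubset with heq | hss
    · rw [heq, h.1]
      obtain ⟨y, hy, hyS⟩ := Finset.exists_of_ssubset hS
      rcases y with v | ⟨p, b⟩
      · refine absurd ?_ hyS
        rw [← Finset.mem_toLeft, heq]
        simpa [SignedGraph.addPaths] using hy
      · have hp : p ∈ C.V.sigma fun v => Finset.range (ℓ v) := by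
          simpa [SignedGraph.addPaths] using hy
        have h1 : Sum.inl p.1 ∈ S := by
          rw [← Finset.mem_toLeft, heq]
          exact (Finset.mem_sigma.1 hp).1
        have h2 := Finset.single_le_sum (fun p _ => hterm S p) hp
        rw [hx, ht] at h2
        cases b
        · simp only [h1, hyS, if_true, if_false, and_false, false_and] at h2
          split_ifs at h2 <;> linarith
        · simp only [h1, hyS, if_true, if_false, and_false, true_and] at h2
          split_ifs at h2 <;> linarith
    · rcases S.toLeft.eq_empty_or_nonempty with he | hne'
      · rw [he]
        simp only [pot, inside, Finset.sum_empty, Finset.notMem_empty, false_and,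
          Finset.filter_false, Finset.card_empty]
        push_cast
        linarith
      · linarith [h.2 _ hss hne']

end Gadgets

/-! ### Signed paths and cycles -/

section Path

/-- The path with `K + 2` vertices. -/
@[simps] def path (K : ℕ) (s : ℕ → Bool) (k : ℕ → Bool → ℕ) : SignedGraph ℕ ℕ where
  V := Finset.range (K + 2)
  E := Finset.range (K + 1)
  fst e := e
  snd e := e + 1
  sgn := s
  slots := k
  fst_mem e he := by simp at he ⊢; omega
  snd_mem e he := by simpa using he
  fst_ne_snd e _ := by omega

variable {K : ℕ} {s : ℕ → Bool} {k : ℕ → Bool → ℕ}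

/-- The cost `B` of the edge from `a` to `a + 1` is shared as `p a` and `B - p a`, so only the
surplus `τ - 1` at `0` is negative. A proper set through `0` contains some `a` but not `a + 1`,
which leaves `p a ≥ 1` unspent. -/
lemma tight_path {g p : ℕ → ℤ} {B τ : ℤ} (hτ : τ ≤ 0) (h0 : g 0 = p 0 + τ - 1)
    (hg : ∀ a ≤ K, g (a + 1) = B - p a + p (a + 1)) (hK : p (K + 1) = 0)
    (hp : ∀ a ≤ K, 1 ≤ p a ∧ p a ≤ B) : (path K s k).Tight g B τ := by
  have key : ∀ S ⊆ Finset.range (K + 2), (path K s k).pot g B S =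
      (if 0 ∈ S then τ - 1 else 0) + ∑ a ∈ Finset.range (K + 1),
        ((if a ∈ S then p a else 0) + (if a + 1 ∈ S then B - p a else 0) -
          if a ∈ S ∧ a + 1 ∈ S then B else 0) := by
    intro S hS
    rw [pot_eq_sum g B (C := path K s k) hS]
    simp only [path_V, path_E, path_fst, path_snd, Finset.sum_add_distrib,
      Finset.sum_sub_distrib]
    have h1 := Finset.sum_range_succ' (fun a => if a ∈ S then p a else 0) (K + 1)
    rw [Finset.sum_range_succ, hK, ite_self, add_zero] at h1
    rw [h1, Finset.sum_range_succ' _ (K + 1)]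
    have h2 : ∑ a ∈ Finset.range (K + 1), (if a + 1 ∈ S then g (a + 1) else 0) =
        ∑ a ∈ Finset.range (K + 1), (if a + 1 ∈ S then p (a + 1) else 0) +
          ∑ a ∈ Finset.range (K + 1), if a + 1 ∈ S then B - p a else 0 := by
      rw [← Finset.sum_add_distrib]
      refine Finset.sum_congr rfl fun a ha => ?_
      rw [hg a (by simpa [Nat.lt_succ_iff] using ha)]
      split_ifs <;> ring
    rw [h2, h0]
    split_ifs <;> ring
  have hterm : ∀ (S : Finset ℕ), ∀ a ∈ Finset.range (K + 1),
      0 ≤ (if a ∈ S then p a else 0) + (if a + 1 ∈ S then B - p a else 0) -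
          if a ∈ S ∧ a + 1 ∈ S then B else 0 := by
    intro S a ha
    have := hp a (by simpa [Nat.lt_succ_iff] using ha)
    by_cases h1 : a ∈ S <;> by_cases h2 : a + 1 ∈ S <;> simp [h1, h2] <;> linarith
  constructor
  · rw [path_V, key _ subset_rfl, Finset.sum_eq_zero]
    · simp
    · intro a ha
      have h1 : a + 1 ∈ Finset.range (K + 2) := by simpa using ha
      have h2 : a ∈ Finset.range (K + 2) := by simp at ha ⊢; omega
      rw [if_pos h1, if_pos h2, if_pos ⟨h2, h1⟩]
      ring
  · intro S hS hne
    rw [key S hS.1]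
    have h0 := Finset.sum_nonneg (hterm S)
    by_cases h : 0 ∈ S
    · obtain ⟨a, ha, haS, haS'⟩ : ∃ a < K + 1, a ∈ S ∧ a + 1 ∉ S := by
        by_contra! hcon
        refine hS.2 fun a ha => ?_
        rw [path_V, Finset.mem_range] at ha
        induction a with
        | zero => exact h
        | succ a ih => exact hcon a (by omega) (ih (by omega))
      have h1 := Finset.single_le_sum (hterm S) (Finset.mem_range.2 ha)
      simp only [haS, haS', if_true, if_false, and_false] at h1
      have := (hp a (by omega)).1
      rw [if_pos h]
      linarith
    · rw [if_neg h]
      linarith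

/-- Vertex `0` must be rich with no violated edge, so vertex `1` is poor; poor vertices with a
single slot pass this colour on to the last vertex, which has no poor slot. -/
lemma not_col_path (hs : s 0 = false) (hs' : ∀ a, s (a + 1) = true)
    (h0 : k 0 false = 0 ∧ k 0 true ≤ 1) (hk : ∀ a, 1 ≤ a → a ≤ K → k a false ≤ 1)
    (hK : k (K + 1) false = 0) : ¬ (path K s k).Col := by
  rintro ⟨φ, hφ⟩
  have hφ' : ∀ a ≤ K + 1, (path K s k).deg φ a < k a (φ a) :=
    fun a ha => hφ a (by simp; omega)
  have hno : ∀ a ≤ K, (path K s k).deg φ a < 1 → (φ a ^^ φ (a + 1)) ≠ s a := fun a ha h =>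
    not_active_of_deg_lt_one h (e := a) (by simp; omega) (Or.inl rfl)
  have hpoor : ∀ a ≤ K, φ (a + 1) = false := by
    intro a ha
    induction a with
    | zero =>
      have h1 := hφ' 0 (by omega)
      cases h2 : φ 0 <;> rw [h2] at h1
      · omega
      · have h3 := hno 0 (by omega) (by omega)
        rw [h2, hs] at h3
        simpa using h3
    | succ a ih =>
      have h1 := hφ' (a + 1) (by omega)
      have h2 := hk (a + 1) (by omega) ha
      rw [ih (by omega)] at h1
      have h3 := hno (a + 1) ha (by omega)
      rw [ih (by omega), hs'] at h3
      simpa using h3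
  have h1 := hφ' (K + 1) le_rfl
  rw [hpoor K le_rfl] at h1
  omega

/-- Even vertices must be rich, and then one of the two edges at each odd vertex is violated. These
`m + 1` violations fall on even vertices, but the two ends tolerate none and the `m` inner ones a
single violation each. -/
lemma not_col_path_alternating {m : ℕ} (hs : ∀ a, s (2 * a) = true)
    (hs' : ∀ a, s (2 * a + 1) = false) (hp : ∀ a, k (2 * a) false = 0)
    (h0 : k 0 true ≤ 1) (hk : ∀ a, k (2 * a) true ≤ 2) (hm : k (2 * m + 2) true ≤ 1) :
    ¬ (path (2 * m + 1) s k).Col := by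
  rintro ⟨φ, hφ⟩
  set C := path (2 * m + 1) s k
  have hφ' : ∀ a ≤ 2 * m + 2, C.deg φ a < k a (φ a) :=
    fun a ha => hφ a (by simp [C]; omega)
  have hrich : ∀ a ≤ m + 1, φ (2 * a) = true := by
    intro a ha
    by_contra h
    rw [Bool.not_eq_true] at h
    have h1 := hφ' (2 * a) (by omega)
    rw [h, hp] at h1
    omega
  have hstep : ∀ a ≤ m, ¬ C.Active φ (2 * a) → C.Active φ (2 * a + 1) := by
    intro a ha h
    have h1 : ¬ (φ (2 * a) ^^ φ (2 * a + 1)) = s (2 * a) := h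
    rw [hs, hrich a (by omega)] at h1
    have h2 : φ (2 * a + 1) = true := by simpa using h1
    change (φ (2 * a + 1) ^^ φ (2 * (a + 1))) = s (2 * a + 1)
    rw [h2, hs', hrich (a + 1) (by omega)]
    rfl
  have hdeg : ∀ a ≤ m, C.Active φ (2 * a + 1) → 1 ≤ C.deg φ (2 * (a + 1)) := by
    intro a ha h
    exact Finset.card_pos.2 ⟨2 * a + 1, Finset.mem_filter.2 ⟨by simp [C]; omega,
      Or.inr rfl, h⟩⟩
  have hno : ∀ a ≤ m, ¬ C.Active φ (2 * a) := by
    intro a ha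
    induction a with
    | zero =>
      have h1 := hφ' 0 (by omega)
      rw [hrich 0 (by omega)] at h1
      exact not_active_of_deg_lt_one (v := 0) (by omega) (by simp [C]) (Or.inl rfl)
    | succ a ih =>
      intro hact
      have h1 := hφ' (2 * (a + 1)) (by omega)
      rw [hrich (a + 1) (by omega)] at h1
      have h2 := hk (a + 1)
      have h3 : 1 < C.deg φ (2 * (a + 1)) := by
        refine Finset.one_lt_card.2 ⟨2 * a + 1, Finset.mem_filter.2 ⟨by simp [C]; omega,
          Or.inr rfl, hstep a (by omega) (ih (by omega))⟩, 2 * (a + 1),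
          Finset.mem_filter.2 ⟨by simp [C]; omega, Or.inl rfl, hact⟩, by omega⟩
      omega
  have h1 := hdeg m le_rfl (hstep m le_rfl (hno m le_rfl))
  have h2 := hφ' (2 * m + 2) le_rfl
  rw [show 2 * m + 2 = 2 * (m + 1) by ring] at h2 hm
  rw [hrich (m + 1) le_rfl] at h2
  omega

/-- The cycle with `K + 2` vertices. -/
@[simps] def cycle (K : ℕ) (s : ℕ → Bool) (k : ℕ → Bool → ℕ) : SignedGraph ℕ ℕ where
  V := Finset.range (K + 2)
  E := Finset.range (K + 2)
  fst e := e
  snd e := if e = K + 1 then 0 else e + 1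
  sgn := s
  slots := k
  fst_mem e he := he
  snd_mem e he := by
    simp only [Finset.mem_range] at he ⊢
    split_ifs <;> omega
  fst_ne_snd e _ := by split_ifs <;> omega

/-- As for paths, but the weights pay for the edges exactly, so the whole cycle has potential `0`. A
proper nonempty set is left somewhere in the direction of the cycle. -/
lemma tight_cycle {g p : ℕ → ℤ} {B : ℤ} (h0 : g 0 = B - p (K + 1) + p 0)
    (hg : ∀ a ≤ K, g (a + 1) = B - p a + p (a + 1))
    (hp : ∀ a ≤ K + 1, 1 ≤ p a ∧ p a ≤ B) : (cycle K s k).Tight g B 1 := by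
  have key : ∀ S ⊆ Finset.range (K + 2), (cycle K s k).pot g B S =
      ∑ a ∈ Finset.range (K + 2),
        ((if a ∈ S then p a else 0) + (if (if a = K + 1 then 0 else a + 1) ∈ S then B - p a else 0) -
          if a ∈ S ∧ (if a = K + 1 then 0 else a + 1) ∈ S then B else 0) := by
    intro S hS
    rw [pot_eq_sum g B (C := cycle K s k) hS]
    simp only [cycle_V, cycle_E, cycle_fst, cycle_snd, Finset.sum_add_distrib,
      Finset.sum_sub_distrib]
    congr 1
    rw [Finset.sum_range_succ' _ (K + 1), Finset.sum_range_succ' _ (K + 1),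
      Finset.sum_range_succ _ (K + 1)]
    have h2 : ∑ a ∈ Finset.range (K + 1), (if a + 1 ∈ S then g (a + 1) else 0) =
        ∑ a ∈ Finset.range (K + 1), (if a + 1 ∈ S then p (a + 1) else 0) +
          ∑ a ∈ Finset.range (K + 1),
            if (if a = K + 1 then 0 else a + 1) ∈ S then B - p a else 0 := by
      rw [← Finset.sum_add_distrib]
      refine Finset.sum_congr rfl fun a ha => ?_
      rw [Finset.mem_range] at ha
      rw [hg a (by omega), if_neg (show a ≠ K + 1 by omega)]
      split_ifs <;> ring
    rw [h2, h0]
    simp only [if_true]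
    split_ifs <;> ring
  have hterm : ∀ (S : Finset ℕ), ∀ a ∈ Finset.range (K + 2),
      0 ≤ (if a ∈ S then p a else 0) +
        (if (if a = K + 1 then 0 else a + 1) ∈ S then B - p a else 0) -
          if a ∈ S ∧ (if a = K + 1 then 0 else a + 1) ∈ S then B else 0 := by
    intro S a ha
    rw [Finset.mem_range] at ha
    have := hp a (by omega)
    by_cases h1 : a ∈ S <;> by_cases h2 : (if a = K + 1 then 0 else a + 1) ∈ S <;>
      simp only [h1, h2, if_true, if_false, and_true, and_false] <;> linarith
  constructor
  · rw [cycle_V, key _ subset_rfl, Finset.sum_eq_zero]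
    · rfl
    · intro a ha
      have h1 := (cycle K s k).snd_mem a ha
      rw [cycle_snd, cycle_V] at h1
      rw [if_pos h1, if_pos ha, if_pos ⟨ha, h1⟩]
      ring
  · intro S hS hne
    rw [key S hS.1]
    obtain ⟨a, ha, haS, haS'⟩ : ∃ a < K + 2, a ∈ S ∧
        (if a = K + 1 then 0 else a + 1) ∉ S := by
      by_contra! hcon
      have hup : ∀ a b, a ∈ S → a + b < K + 2 → a + b ∈ S := by
        intro a b ha hb
        induction b with
        | zero => exact ha
        | succ b ih =>
          have := hcon (a + b) (by omega) (ih (by omega))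
          rwa [if_neg (show a + b ≠ K + 1 by omega)] at this
      obtain ⟨a, ha⟩ := hne
      have ha' : a < K + 2 := by simpa using hS.1 ha
      have h1 := hup a (K + 1 - a) ha (by omega)
      rw [show a + (K + 1 - a) = K + 1 by omega] at h1
      have h2 := hcon (K + 1) (by omega) h1
      rw [if_pos rfl] at h2
      refine hS.2 fun b hb => ?_
      have := hup 0 b h2 (by simpa using hb)
      rwa [zero_add] at this
    have h1 := Finset.single_le_sum (hterm S) (Finset.mem_range.2 ha)
    simp only [haS, haS', if_true, if_false, and_false] at h1
    have := (hp a (by omega)).1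
    linarith

/-- Every edge has an even end, which tolerates no violation; a single negative edge makes the cycle
unsatisfiable. -/
lemma not_col_cycle {m : ℕ} (hs : ∀ a, s a = true ↔ a ≠ 2 * m + 1)
    (hk : ∀ a κ, k (2 * a) κ ≤ 1) : ¬ (cycle (2 * m) s k).Col := by
  rintro ⟨φ, hφ⟩
  have hno : ∀ a < 2 * m + 2, ¬ (cycle (2 * m) s k).Active φ a := by
    intro a ha
    obtain ⟨v, hv, hi, hkv⟩ : ∃ v < 2 * m + 2, (cycle (2 * m) s k).Inc v a ∧
        ∀ κ, k v κ ≤ 1 := by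
      obtain ⟨b, rfl | rfl⟩ := Nat.even_or_odd' a
      · exact ⟨2 * b, ha, Or.inl rfl, hk b⟩
      · by_cases hb : b = m
        · exact ⟨0, by omega, Or.inr (by simp [hb]), hk 0⟩
        · refine ⟨2 * (b + 1), by omega, Or.inr ?_, hk (b + 1)⟩
          rw [cycle_snd, if_neg (by omega)]
          ring
    have h1 := hφ v (by simpa using hv)
    rw [cycle_slots] at h1
    exact not_active_of_deg_lt_one (lt_of_lt_of_le h1 (hkv _)) (by simpa using ha) hi
  have hconst : ∀ a < 2 * m + 2, φ a = φ 0 := by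
    intro a ha
    induction a with
    | zero => rfl
    | succ a ih =>
      have h1 := hno a (by omega)
      unfold Active at h1
      rw [cycle_fst, cycle_snd, cycle_sgn, if_neg (show a ≠ 2 * m + 1 by omega),
        (hs a).2 (by omega), ih (by omega)] at h1
      cases h2 : φ 0 <;> cases h3 : φ (a + 1) <;> simp_all
  have h1 := hno (2 * m + 1) (by omega)
  have h2 : s (2 * m + 1) = false := by
    have := hs (2 * m + 1)
    simpa using this
  unfold Active at h1
  rw [cycle_fst, cycle_snd, cycle_sgn, if_pos rfl, h2, hconst _ (by omega)] at h1
  simp at h1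

end Path

/-! ### Extremal families -/

/-- The numbers of slots for `(i, j)`-colourings. -/
def fullSlots (i j : ℕ) (κ : Bool) : ℕ := if κ then j + 1 else i + 1

/-! ### Caterpillars for `j ≥ 2 * i + 1`, and for `i = 0` -/

section Caterpillar

/-- The numbers of leaves in the case `j ≥ 2 i + 1`. -/
def caterpillarLeaves (i j K a : ℕ) : ℕ := if a = 0 then j else if a = K + 1 then i + 1 else i

lemma extremal_caterpillar {i j : ℕ} (hj : 1 ≤ j) (hij : 2 * i + 1 ≤ j) (K : ℕ) :
    ((path K (fun a => decide (a ≠ 0)) fun _ => fullSlots i j).addLeaves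
      (caterpillarLeaves i j K)).Extremal i j (2 * i + 1) (i + 1) (2 * i + 1 - j) where
  full := Full.addLeaves fun _ => ⟨rfl, rfl⟩
  not_col h := by
    refine not_col_path (K := K) (s := fun a => decide (a ≠ 0)) (k := fun a κ =>
      fullSlots i j κ - caterpillarLeaves i j K a) rfl (fun a => by simp) ?_ ?_ ?_
      (col_of_col_addLeaves h)
    · simp only [caterpillarLeaves, fullSlots]
      exact ⟨by simp; omega, by simp⟩
    · intro a h1 h2
      simp only [caterpillarLeaves, fullSlots]
      rw [if_neg (show ¬ a = 0 by omega), if_neg (show ¬ a = K + 1 by omega)]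
      simp
    · simp [caterpillarLeaves, fullSlots]
  tight := by
    have hi : (0 : ℤ) ≤ i := Int.natCast_nonneg _
    have hij' : 2 * (i : ℤ) + 1 ≤ j := by exact_mod_cast hij
    refine Tight.addLeaves (by linarith) (by linarith) (by linarith) ?_
    -- A leaf costs `2 * B - F = 1`, so the inner weights are `2 * i + 1 - i = B` and a constant
    -- share of `1` works.
    refine tight_path (p := fun a => if a ≤ K then 1 else 0) (by linarith) ?_ ?_ ?_ ?_
    · simp [caterpillarLeaves]
      ring
    · intro a ha
      simp only [caterpillarLeaves, ha, if_true, Nat.add_eq_zero_iff, one_ne_zero, and_false,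
        if_false, Nat.add_right_cancel_iff]
      by_cases h : a = K
      · rw [if_pos h, if_neg (by omega)]
        push_cast
        ring
      · rw [if_neg h, if_pos (by omega)]
        ring
    · simp
    · intro a ha
      rw [if_pos ha]
      constructor <;> linarith

lemma card_caterpillar (j K : ℕ) :
    ((path K (fun a => decide (a ≠ 0)) fun _ => fullSlots 0 j).addLeaves
      (caterpillarLeaves 0 j K)).V.card = K + 3 + j := by
  rw [card_addLeaves_V, path_V, Finset.card_range, Finset.sum_range_succ', Finset.sum_range_succ,
    Finset.sum_eq_zero]
  · simp [caterpillarLeaves]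
    ring
  · intro a ha
    rw [Finset.mem_range] at ha
    rw [caterpillarLeaves, if_neg (by omega), if_neg (by omega)]

end Caterpillar

/-! ### Paths with leaves at every second vertex, for `i + 2 ≤ j ≤ 2 * i` -/

section Alternating

/-- The numbers of leaves in the case `i + 2 ≤ j ≤ 2 i`. -/
def alternatingLeaves (j m a : ℕ) : ℕ :=
  if a % 2 = 1 then 0 else if a = 0 ∨ a = 2 * m + 2 then j else j - 1

lemma extremal_alternating {i j : ℕ} (hij : i + 2 ≤ j) (m : ℕ) :
    ((path (2 * m + 1) (fun a => decide (a % 2 = 0)) fun _ => fullSlots i j).addLeaves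
      (alternatingLeaves j m)).Extremal i j (2 * j) (j + 1) (-1) where
  full := Full.addLeaves fun _ => ⟨rfl, rfl⟩
  not_col h := by
    refine not_col_path_alternating (m := m) (s := fun a => decide (a % 2 = 0)) (k := fun a κ =>
      fullSlots i j κ - alternatingLeaves j m a) (fun a => by simp) (fun a => ?_) (fun a => ?_)
      ?_ (fun a => ?_) ?_ (col_of_col_addLeaves h)
    · simp only [decide_eq_false_iff_not]
      omega
    · simp only [alternatingLeaves, fullSlots]
      rw [if_neg (show ¬ 2 * a % 2 = 1 by omega)]
      simp only [Bool.false_eq_true, if_false]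
      split_ifs <;> omega
    · simp [alternatingLeaves, fullSlots]
    · simp only [alternatingLeaves, fullSlots]
      rw [if_neg (show ¬ 2 * a % 2 = 1 by omega)]
      simp only [if_true]
      split_ifs <;> omega
    · simp only [alternatingLeaves, fullSlots]
      rw [if_neg (show ¬ (2 * m + 2) % 2 = 1 by omega)]
      simp
  tight := by
    have hj : (2 : ℤ) ≤ j := by norm_cast; omega
    refine Tight.addLeaves (by linarith) (by linarith) (by linarith) ?_
    -- A leaf costs `2`, which leaves inner even vertices weight `2`, just enough for their share of
    -- the next edge. Odd vertices pay the rest of both their edges, `2 * B - 2 = 2 * j`.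
    refine tight_path (p := fun a => if a = 2 * m + 2 then 0 else if a % 2 = 1 then (j : ℤ) + 1
      else 2) (by norm_num) ?_ ?_ ?_ ?_
    · simp [alternatingLeaves]
      ring
    · intro a ha
      simp only [alternatingLeaves]
      rw [if_neg (show ¬ a = 2 * m + 2 by omega)]
      rcases Nat.mod_two_eq_zero_or_one a with h | h
      · rw [if_pos (show (a + 1) % 2 = 1 by omega), if_neg (show ¬ a % 2 = 1 by omega),
          if_neg (show ¬ a + 1 = 2 * m + 2 by omega), if_pos (show (a + 1) % 2 = 1 by omega)]
        push_cast
        ring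
      · rw [if_neg (show ¬ (a + 1) % 2 = 1 by omega), if_pos h]
        by_cases h1 : a + 1 = 2 * m + 2
        · rw [if_pos (Or.inr h1), if_pos h1]
          ring
        · rw [if_neg (by omega), if_neg h1, if_neg (show ¬ (a + 1) % 2 = 1 by omega)]
          push_cast [show 1 ≤ j by omega]
          ring
    · simp
    · intro a ha
      rw [if_neg (by omega)]
      split_ifs <;> constructor <;> linarith

end Alternating

/-! ### Paths with both kinds of gadgets for `j = i + 1` -/

section Near

/-- The numbers of attached paths in the case `j = i + 1`. -/
def nearPaths (i K a : ℕ) : ℕ := if a = 0 then 0 else if a = K + 1 then i + 1 else i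

/-- The numbers of leaves in the case `j = i + 1`. -/
def nearLeaves (i : ℕ) : ℕ ⊕ ((_ : ℕ) × ℕ) × Bool → ℕ :=
  Sum.elim (fun a => if a = 0 then i + 1 else 0) fun p => if p.2 then i + 1 else 0

lemma extremal_near {i : ℕ} (hi : 1 ≤ i) (K : ℕ) :
    (((path K (fun a => decide (a ≠ 0)) fun _ => fullSlots i (i + 1)).addPaths
      (nearPaths i K)).addLeaves (nearLeaves i)).Extremal i (i + 1)
      (2 * i ^ 2 + 4 * i + 1) (i ^ 2 + 3 * i + 1) 0 where
  full := Full.addLeaves (Full.addPaths fun _ => ⟨rfl, rfl⟩)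
  not_col h := by
    have h1 := col_of_col_addPaths (fun p => ?_) (col_of_col_addLeaves h)
    · refine not_col_path (K := K) (s := fun a => decide (a ≠ 0)) (k := fun a κ =>
        fullSlots i (i + 1) κ - nearLeaves i (Sum.inl a) - if κ then 0 else nearPaths i K a)
        rfl (fun a => by simp) ?_ ?_ ?_ h1
      · simp [nearLeaves, fullSlots]
      · intro a h1 h2
        simp only [nearLeaves, nearPaths, fullSlots, Sum.elim_inl]
        rw [if_neg (show ¬ a = 0 by omega), if_neg (show ¬ a = 0 by omega),
          if_neg (show ¬ a = K + 1 by omega)]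
        simp
      · simp [nearLeaves, nearPaths, fullSlots]
    · change fullSlots i (i + 1) false - (i + 1) = 0 ∧ fullSlots i (i + 1) true - (i + 1) ≤ 1
      simp [fullSlots]
  tight := by
    have hi' : (1 : ℤ) ≤ i := by exact_mod_cast hi
    refine Tight.addLeaves (by nlinarith) (by nlinarith) (by nlinarith) ?_
    -- The `i + 1` leaves at a far end cost `2 * i + 1` each and leave it weight `t = i`; an
    -- attached path then costs `i + 1`, the price of a single slot.
    refine Tight.addPaths (L := i + 1) (x := 2 * i ^ 2 + 4 * i + 1) (t := i) (by ring)
      (fun p => ?_) (fun p => ?_) (by linarith) (by linarith) (by nlinarith) (by nlinarith)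
      le_rfl ?_
    · simp [nearLeaves]
    · simp [nearLeaves]
      ring
    · refine tight_path (p := fun a => if a ≤ K then (i : ℤ) + 1 else 0) le_rfl ?_ ?_ ?_ ?_
      · simp [nearLeaves, nearPaths]
        ring
      · intro a ha
        simp only [nearLeaves, nearPaths, Sum.elim_inl, ha, if_true, Nat.add_eq_zero_iff,
          one_ne_zero, and_false, if_false, Nat.add_right_cancel_iff]
        by_cases h : a = K
        · rw [if_pos h, if_neg (by omega)]
          push_cast
          ring
        · rw [if_neg h, if_pos (by omega)]
          push_cast
          ring
      · simp
      · intro a ha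
        rw [if_pos ha]
        constructor <;> nlinarith

end Near

/-! ### Unsatisfiable cycles with leaves for `j = i` -/

section Balanced

/-- The numbers of leaves in the case `j = i`. -/
def balancedLeaves (i a : ℕ) : ℕ := if a % 2 = 0 then i else 0

lemma extremal_balanced {i : ℕ} (m : ℕ) :
    ((cycle (2 * m) (fun a => decide (a ≠ 2 * m + 1)) fun _ => fullSlots i i).addLeaves
      (balancedLeaves i)).Extremal i i (2 * i + 2) (i + 2) 1 where
  full := Full.addLeaves fun _ => ⟨rfl, rfl⟩
  not_col h := by
    refine not_col_cycle (m := m) (s := fun a => decide (a ≠ 2 * m + 1)) (k := fun a κ =>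
      fullSlots i i κ - balancedLeaves i a) (fun a => by simp) (fun a κ => ?_)
      (col_of_col_addLeaves h)
    cases κ <;> simp [balancedLeaves, fullSlots]
  tight := by
    have hi : (0 : ℤ) ≤ i := Int.natCast_nonneg _
    refine Tight.addLeaves (by linarith) (by linarith) (by linarith) ?_
    refine tight_cycle (p := fun a => if a % 2 = 0 then 1 else (i : ℤ) + 1) ?_ ?_ ?_
    · simp [balancedLeaves, Nat.add_mod]
      ring
    · intro a ha
      simp only [balancedLeaves]
      rcases Nat.mod_two_eq_zero_or_one a with h | h
      · rw [if_neg (show ¬ (a + 1) % 2 = 0 by omega), if_pos h,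
          if_neg (show ¬ (a + 1) % 2 = 0 by omega)]
        push_cast
        ring
      · rw [if_pos (show (a + 1) % 2 = 0 by omega), if_neg (by omega),
          if_pos (show (a + 1) % 2 = 0 by omega)]
        ring
    · intro a _
      split_ifs <;> constructor <;> linarith

end Balanced

/-! ### The case `i = 0` -/

lemma add_le_fDP_zero (j n : ℕ) : (n : ℕ∞) + j ≤ fDP 0 j n := by
  rcases fDP_eq_top_or 0 j n with h | ⟨C, hmin, rfl, h⟩
  · rw [h]
    exact le_top
  · rw [h]
    exact_mod_cast hmin.card_add_le

/-- The path has `K + 2` vertices and carries `j + 1` leaves, so every `n ≥ j + 3` occurs; for `j ≥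
1` this includes all `n ≥ 2 * j + 2`. -/
lemma fDP_zero_eq {j n : ℕ} (hj : 1 ≤ j) (hn : j + 3 ≤ n) : fDP 0 j n = (n : ℕ∞) + j := by
  refine le_antisymm ?_ (add_le_fDP_zero j n)
  obtain ⟨K, rfl⟩ : ∃ K, n = K + 3 + j := ⟨n - 3 - j, by omega⟩
  have hC := extremal_caterpillar (i := 0) hj (by omega) K
  have h1 := hC.card_eq
  have h2 := hC.fDP_le (by norm_num) fun C' hfull h => col_of_pot_zero hfull fun S hS hne => by
    simpa using h S hS hne
  rw [card_caterpillar] at h1 h2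
  generalize Finset.card _ = m at h1 h2
  refine h2.trans ?_
  norm_cast
  push_cast at h1
  omega

/-! ### The case `j = i + 1` -/

set_option synthInstance.maxSize 400 in
lemma fDPReal_bounds_near {i : ℕ} (hi : 1 ≤ i) :
    (∀ n : ℕ, ((((2 * i ^ 2 + 4 * i + 1) * n + 1) / (i ^ 2 + 3 * i + 1) : ℝ) : EReal)
        ≤ fDPReal i (i + 1) n) ∧
      {n : ℕ | fDPReal i (i + 1) n =
        ((((2 * i ^ 2 + 4 * i + 1) * n + 1) / (i ^ 2 + 3 * i + 1) : ℝ) : EReal)}.Infinite := by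
  refine fDPReal_bounds (F := 2 * i ^ 2 + 4 * i + 1) (B := i ^ 2 + 3 * i + 1) (τ := 0)
    (by positivity) (fun n => ?_) (fun C hC => hC.pot_le_near hi)
    (fun C hfull h => col_of_pot_near hi hfull h) fun N => ⟨_, extremal_near hi N, ?_⟩
  · push_cast
    field_simp
    ring
  · rw [card_addLeaves_V]
    refine le_trans ?_ (Nat.le_add_right _ _)
    simp [addPaths]
    omega

end SignedGraph

end DefectiveDP

/-! ### The five cases of the theorem -/

open DefectiveDP in
theorem mainTheorem1 :
    -- `i = 0`, `j ≥ 1`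
    (∀ j : ℕ, 1 ≤ j →
      (∀ n : ℕ, (n : ℕ∞) + j ≤ fDP 0 j n) ∧
      (∀ n : ℕ, 2 * j + 2 ≤ n → fDP 0 j n = (n : ℕ∞) + j)) ∧
    -- `i ≥ 1`, `j ≥ 2i + 1`
    (∀ i j : ℕ, 1 ≤ i → 2 * i + 1 ≤ j →
      (∀ n : ℕ, ((((2 * i + 1) * n - (2 * i - j)) / (i + 1) : ℝ) : EReal) ≤ fDPReal i j n) ∧
      {n : ℕ | fDPReal i j n = ((((2 * i + 1) * n - (2 * i - j)) / (i + 1) : ℝ) : EReal)}.Infinite) ∧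
    -- `i ≥ 1`, `i + 2 ≤ j ≤ 2i`
    (∀ i j : ℕ, 1 ≤ i → i + 2 ≤ j → j ≤ 2 * i →
      (∀ n : ℕ, (((2 * j * n + 2) / (j + 1) : ℝ) : EReal) ≤ fDPReal i j n) ∧
      {n : ℕ | fDPReal i j n = (((2 * j * n + 2) / (j + 1) : ℝ) : EReal)}.Infinite) ∧
    -- `i ≥ 1`, `j = i + 1`
    (∀ i : ℕ, 1 ≤ i →
      (∀ n : ℕ, ((((2 * i ^ 2 + 4 * i + 1) * n + 1) / (i ^ 2 + 3 * i + 1) : ℝ) : EReal)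
        ≤ fDPReal i (i + 1) n) ∧
      {n : ℕ | fDPReal i (i + 1) n =
        ((((2 * i ^ 2 + 4 * i + 1) * n + 1) / (i ^ 2 + 3 * i + 1) : ℝ) : EReal)}.Infinite) ∧
    -- `i ≥ 1`, `j = i`
    (∀ i : ℕ, 1 ≤ i →
      (∀ n : ℕ, (((2 * i + 2) * n / (i + 2) : ℝ) : EReal) ≤ fDPReal i i n) ∧
      {n : ℕ | fDPReal i i n = (((2 * i + 2) * n / (i + 2) : ℝ) : EReal)}.Infinite) := by
  refine ⟨fun j hj => ⟨fun n => SignedGraph.add_le_fDP_zero j n,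
    fun n hn => SignedGraph.fDP_zero_eq hj (by omega)⟩, fun i j hi hij => ?_,
    fun i j hi hij hji => ?_, fun i hi => ?_, fun i hi => ?_⟩
  · have hi' : (1 : ℤ) ≤ i := by exact_mod_cast hi
    have hij' : 2 * (i : ℤ) + 1 ≤ j := by exact_mod_cast hij
    -- Here `L = 1`, and `τ` is the value of `F - L * j - L + 1`.
    refine SignedGraph.fDPReal_bounds (F := 2 * i + 1) (B := i + 1) (τ := 2 * i + 1 - j)
      (by linarith) (fun n => ?_) (fun C hC => ?_) (fun C hfull h => ?_) fun N =>
      ⟨_, SignedGraph.extremal_caterpillar (by omega) hij N, ?_⟩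
    · push_cast
      field_simp
      ring
    · have := hC.pot_le_maxWeight (F := 2 * i + 1) (L := 1) (B := i + 1) (by omega) one_pos
        (by linarith) (by linarith) (by linarith) (by linarith)
      linarith
    · refine SignedGraph.col_of_pot_maxWeight (F := 2 * i + 1) (L := 1) (B := i + 1) (by omega)
        one_pos (by linarith) (by linarith) (by linarith) (by linarith) hfull fun S hS hne => ?_
      linarith [h S hS hne]
    · rw [SignedGraph.card_addLeaves_V, SignedGraph.path_V, Finset.card_range]
      omega
  · have hi' : (1 : ℤ) ≤ i := by exact_mod_cast hi
    have hij' : (i : ℤ) + 2 ≤ j := by exact_mod_cast hij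
    have hji' : (j : ℤ) ≤ 2 * i := by exact_mod_cast hji
    -- Here `L = 2` and `F = L * j`, so `τ = 1 - L`; the condition `F ≤ B + L * i` needs `j ≤ 2 * i
    -- + 1`.
    refine SignedGraph.fDPReal_bounds (F := 2 * j) (B := j + 1) (τ := -1)
      (by linarith) (fun n => ?_) (fun C hC => ?_) (fun C hfull h => ?_) fun N =>
      ⟨_, SignedGraph.extremal_alternating hij N, ?_⟩
    · push_cast
      field_simp
      ring
    · have := hC.pot_le_maxWeight (F := 2 * j) (L := 2) (B := j + 1) hij two_pos
        (by linarith) (by linarith) (by linarith) (by linarith)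
      linarith
    · refine SignedGraph.col_of_pot_maxWeight (F := 2 * j) (L := 2) (B := j + 1) hij two_pos
        (by linarith) (by linarith) (by linarith) (by linarith) hfull fun S hS hne => ?_
      linarith [h S hS hne]
    · rw [SignedGraph.card_addLeaves_V, SignedGraph.path_V, Finset.card_range]
      omega
  · exact SignedGraph.fDPReal_bounds_near hi
  · refine SignedGraph.fDPReal_bounds (F := 2 * i + 2) (B := i + 2) (τ := 1) (by positivity)
      (fun n => ?_) (fun C hC => hC.pot_le_balanced hi)
      (fun C hfull h => SignedGraph.col_of_pot_balanced hi hfull h) fun N =>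
      ⟨_, SignedGraph.extremal_balanced N, ?_⟩
    · push_cast
      field_simp
      ring
    · rw [SignedGraph.card_addLeaves_V, SignedGraph.cycle_V, Finset.card_range]
      omega
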